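/- Let $n\ge 1$ and let $(W_-,\Omega_-)$, $(W_+,\Omega_+)$ be smooth symplectic $2n$-dimensional manifolds with boundary (Hausdorff, second countable, not necessarily compact). Let $N$ be a smooth $(2n-1)$-dimensional manifold without boundary, $\alpha_N$ a nowhere vanishing closed smooth $1$-form on $N$ and $\Omega_N$ a closed smooth $2$-form on $N$. Let $P_N:[0,2)\times N\to N$ be the projection, $t$ the coordinate on $[0,2)$, and $$\Omega = dt\wedge P_N^*\alpha_N+P_N^*\Omega_N .$$ Suppose that $\partial W_-$ and $\partial W_+$ admit collar neighbourhoods both of which are symplectomorphic to $([0,2)\times N,\Omega)$; that is, there are diffeomorphisms $c_\pm$ of $[0,2)\times N$ onto open neighbourhoods of $\partial W_\pm$ in $W_\pm$ with $c_\pm(\{0\}\times N)=\partial W_\pm$ and $c_\pm^*\Omega_\pm=\Omega$. Let $W=W_-\cup_{\partial W_-=\partial W_+}W_+$ be the quotient space of $W_-\sqcup W_+$ in which $c_-(0,x)$ is identified with $c_+(0,x)$ for every $x\in N$. Then $W$ is a Hausdorff second countable space; it carries the smooth structure of a $2n$-manifold without boundary glued along the collars, i.e. such that the interiors of $W_\pm$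 and the two-sided collar $(-2,2)\times N\to W$, given by $(\tau,x)\mapsto c_+(\tau,x)$ for $\tau\ge 0$ and $(\tau,x)\mapsto c_-(-\tau,x)$ for $\tau\le 0$, are local diffeomorphisms into $W$; and $W$ with this smooth structure admits a $b$-symplectic structure whose singular locus is the common boundary $\partial W_-=\partial W_+\subset W$. Here a $b$-symplectic structure on a $2n$-manifold $W$ is a Poisson structure, i.e. a smooth bivector field $\Pi$ on $W$ whose bracket $\{f,g\}=\Pi(df,dg)$ satisfies the Jacobi identity, such that the graph of $\bigwedge^n\Pi$ is transverse to the zero section of $\bigwedge^{2n}TW$; its singular locus is $\{w\in W : \bigwedge^n\Pi(w)=0\}$. -/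

import Mathlib

open Set Function
open scoped Manifold ContDiff

noncomputable section

/-! ### Differential forms on manifolds (possibly with boundary) -/

section Forms

variable {E : Type*} [NormedAddCommGroup E] [NormedSpace ℝ E]
  {H : Type*} [TopologicalSpace H]
  {E' : Type*} [NormedAddCommGroup E'] [NormedSpace ℝ E']
  {H' : Type*} [TopologicalSpace H']

/-- A (not necessarily continuous) differential `k`-form on the manifold `M`: an alternating
`k`-linear form on every tangent space. -/
abbrev DiffForm (I : ModelWithCorners ℝ E H) (M : Type*) [TopologicalSpace M] [ChartedSpace H M]
    (k : ℕ) : Type _ :=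
  ∀ x : M, TangentSpace I x [⋀^Fin k]→L[ℝ] ℝ

/-- The pullback `f^* θ` of a form along a map `f` defined on `s` (the differential of `f` is
taken within `s`). -/
def DiffForm.pullback {I : ModelWithCorners ℝ E H} {M : Type*} [TopologicalSpace M]
    [ChartedSpace H M] {I' : ModelWithCorners ℝ E' H'} {M' : Type*} [TopologicalSpace M']
    [ChartedSpace H' M'] {k : ℕ} (θ : DiffForm I' M' k) (f : M → M') (s : Set M) :
    DiffForm I M k :=
  fun x => (θ (f x)).compContinuousLinearMap (mfderivWithin I I' f s x)

/-- The expression of a form in the preferred chart at `x₀`, a form on the model vector space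
(meaningful on the target of the chart). -/
def DiffForm.inChart {I : ModelWithCorners ℝ E H} {M : Type*} [TopologicalSpace M]
    [ChartedSpace H M] {k : ℕ} (θ : DiffForm I M k) (x₀ : M) : E → E [⋀^Fin k]→L[ℝ] ℝ :=
  DiffForm.pullback (I := 𝓘(ℝ, E)) θ (extChartAt I x₀).symm (extChartAt I x₀).target

/-- The form is smooth. -/
def DiffForm.IsSmooth {I : ModelWithCorners ℝ E H} {M : Type*} [TopologicalSpace M]
    [ChartedSpace H M] {k : ℕ} (θ : DiffForm I M k) : Prop :=
  ∀ x₀ : M, ContDiffOn ℝ ∞ (θ.inChart x₀) (extChartAt I x₀).target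

/-- The form is closed: its exterior derivative, computed in charts, vanishes. -/
def DiffForm.IsClosed {I : ModelWithCorners ℝ E H} {M : Type*} [TopologicalSpace M]
    [ChartedSpace H M] {k : ℕ} (θ : DiffForm I M k) : Prop :=
  ∀ x₀ : M, ∀ y ∈ (extChartAt I x₀).target,
    extDerivWithin (θ.inChart x₀) (extChartAt I x₀).target y = 0

/-- A symplectic form: a smooth, closed, nondegenerate `2`-form. -/
structure DiffForm.IsSymplectic {I : ModelWithCorners ℝ E H} {M : Type*} [TopologicalSpace M]
    [ChartedSpace H M] (θ : DiffForm I M 2) : Prop where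
  smooth : θ.IsSmooth
  closed : θ.IsClosed
  nondegenerate : ∀ (x : M) (v : TangentSpace I x),
    (∀ w : TangentSpace I x, θ x ![v, w] = 0) → v = 0

end Forms

section Wedge

variable {V : Type*} [AddCommGroup V] [Module ℝ V] [TopologicalSpace V]

/-- The wedge product of two covectors, `(a ∧ b)(u, v) = a u * b v - a v * b u`. -/
def wedgeCovectors (a b : V →L[ℝ] ℝ) : V [⋀^Fin 2]→L[ℝ] ℝ where
  toFun v := a (v 0) * b (v 1) - a (v 1) * b (v 0)
  map_update_add' := by
    intro _ m i x y
    have hi : i = 0 ∨ i = 1 := by fin_cases i <;> simp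
    rcases hi with rfl | rfl <;> simp <;> ring
  map_update_smul' := by
    intro _ m i r x
    have hi : i = 0 ∨ i = 1 := by fin_cases i <;> simp
    rcases hi with rfl | rfl <;> simp <;> ring
  map_eq_zero_of_eq' := by
    intro v i j hij hne
    have h : v 0 = v 1 := by
      fin_cases i <;> fin_cases j <;> simp_all
    simp [h]
  cont := by
    have h : ∀ (c : V →L[ℝ] ℝ) (i : Fin 2), Continuous fun v : Fin 2 → V => c (v i) :=
      fun c i => c.continuous.comp (continuous_apply i)
    exact ((h a 0).mul (h b 1)).sub ((h a 1).mul (h b 0))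

theorem wedgeCovectors_apply (a b : V →L[ℝ] ℝ) (u v : V) :
    wedgeCovectors a b ![u, v] = a u * b v - a v * b u := rfl

end Wedge

/-! ### Multivector fields, Poisson structures and `b`-symplectic structures -/

section Multivectors

variable {E : Type*} [NormedAddCommGroup E] [NormedSpace ℝ E]
  {H : Type*} [TopologicalSpace H]

/-- A (not necessarily continuous) `k`-vector field on `M`: a section of `⋀^k TM`. -/
abbrev MultivectorField (I : ModelWithCorners ℝ E H) (M : Type*) [TopologicalSpace M]
    [ChartedSpace H M] (k : ℕ) : Type _ :=
  ∀ x : M, ⋀[ℝ]^k (TangentSpace I x)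

variable {I : ModelWithCorners ℝ E H} {M : Type*} [TopologicalSpace M] [ChartedSpace H M]

/-- The expression of a `k`-vector field in the preferred chart at `x₀`: its push-forward by the
chart, a `⋀^k E`-valued function (meaningful on the target of the chart). -/
def MultivectorField.inChart {k : ℕ} (s : MultivectorField I M k) (x₀ : M) : E → ⋀[ℝ]^k E :=
  fun y => exteriorPower.map k
    (ContinuousLinearMap.toLinearMap (M₂ := E)
      (mfderiv I 𝓘(ℝ, E) (extChartAt I x₀) ((extChartAt I x₀).symm y)))
    (s ((extChartAt I x₀).symm y))

/-- The `k`-vector field is smooth: in charts, all its components are. (A map into the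
finite-dimensional space `⋀^k E` is smooth iff its composition with every linear functional is.) -/
def MultivectorField.IsSmooth {k : ℕ} (s : MultivectorField I M k) : Prop :=
  ∀ (x₀ : M) (l : ⋀[ℝ]^k E →ₗ[ℝ] ℝ),
    ContDiffOn ℝ ∞ (fun y => l (s.inChart x₀ y)) (extChartAt I x₀).target

/-- The graph of the `k`-vector field is transverse to the zero section of `⋀^k TM`: in charts, at
every zero the differential `E → ⋀^k E` is surjective, i.e. no nonzero linear functional on
`⋀^k E` vanishes on its image. -/
def MultivectorField.IsTransverseToZero {k : ℕ} (s : MultivectorField I M k) : Prop :=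
  ∀ (x₀ : M), ∀ y ∈ (extChartAt I x₀).target, s.inChart x₀ y = 0 →
    ∀ l : ⋀[ℝ]^k E →ₗ[ℝ] ℝ, l ≠ 0 →
      fderivWithin ℝ (fun z => l (s.inChart x₀ z)) (extChartAt I x₀).target y ≠ 0

/-- The `n`-th exterior power `Π ∧ ⋯ ∧ Π`, a `2n`-vector field, of a bivector field. -/
def MultivectorField.wedgePow (P : MultivectorField I M 2) (n : ℕ) :
    MultivectorField I M (2 * n) :=
  fun x => ⟨(P x : ExteriorAlgebra ℝ (TangentSpace I x)) ^ n, by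
    have h := Submodule.pow_mem_pow _ (P x).2 n
    rwa [← pow_mul] at h⟩

/-- The bracket `{f, g} = ⟨Π, df ∧ dg⟩` defined by a bivector field. -/
def MultivectorField.bracket (P : MultivectorField I M 2) (f g : M → ℝ) : M → ℝ :=
  fun x => exteriorPower.pairingDual ℝ (TangentSpace I x) 2
    (exteriorPower.ιMulti ℝ 2
      ![ContinuousLinearMap.toLinearMap (M₂ := ℝ) (mfderiv I 𝓘(ℝ, ℝ) f x),
        ContinuousLinearMap.toLinearMap (M₂ := ℝ) (mfderiv I 𝓘(ℝ, ℝ) g x)])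
    (P x)

/-- A Poisson structure: a smooth bivector field whose bracket satisfies the Jacobi identity. -/
structure MultivectorField.IsPoisson (P : MultivectorField I M 2) : Prop where
  smooth : P.IsSmooth
  jacobi : ∀ f g h : M → ℝ, ContMDiff I 𝓘(ℝ, ℝ) ∞ f → ContMDiff I 𝓘(ℝ, ℝ) ∞ g →
    ContMDiff I 𝓘(ℝ, ℝ) ∞ h → ∀ x : M,
      P.bracket f (P.bracket g h) x + P.bracket g (P.bracket h f) x
        + P.bracket h (P.bracket f g) x = 0

/-- A `b`-symplectic structure on a manifold of dimension `2n`: a Poisson structure `Π` such that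
the graph of `⋀^n Π` is transverse to the zero section. -/
structure MultivectorField.IsBSymplectic (n : ℕ) (P : MultivectorField I M 2) : Prop where
  poisson : P.IsPoisson
  transverse : (P.wedgePow n).IsTransverseToZero

/-- The singular locus of a bivector field on a `2n`-dimensional manifold: the zero set of
`⋀^n Π`. -/
def MultivectorField.singularLocus (n : ℕ) (P : MultivectorField I M 2) : Set M :=
  {x | P.wedgePow n x = 0}

end Multivectors

/-! ### Collars and gluing -/

/-- `c` is a collar of the boundary of the `2n`-manifold `W` parametrized by `N`: a smooth
diffeomorphism of `[0, 2) × N` onto an open subset of `W`, mapping `{0} × N` onto `∂W`. -/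
structure IsCollar (n : ℕ) [NeZero n]
    {N : Type*} [TopologicalSpace N] [ChartedSpace (EuclideanSpace ℝ (Fin (2 * n - 1))) N]
    {W : Type*} [TopologicalSpace W] [ChartedSpace (EuclideanHalfSpace (2 * n)) W]
    (c : PartialEquiv (ℝ × N) W) : Prop where
  source_eq : c.source = Ico (0 : ℝ) 2 ×ˢ univ
  isOpen_target : IsOpen c.target
  contMDiffOn_toFun : ContMDiffOn (𝓘(ℝ, ℝ).prod (𝓡 (2 * n - 1))) (𝓡∂ (2 * n)) ∞ c c.source
  contMDiffOn_symm : ContMDiffOn (𝓡∂ (2 * n)) (𝓘(ℝ, ℝ).prod (𝓡 (2 * n - 1))) ∞ c.symm c.target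
  image_zero : range (fun x : N => c (0, x)) = (𝓡∂ (2 * n)).boundary W

/-- The `2`-form `dt ∧ P_N^* α + P_N^* θ` on `ℝ × N`, where `P_N : ℝ × N → N` is the
projection. -/
def cylindricalForm {m : ℕ} {N : Type*} [TopologicalSpace N]
    [ChartedSpace (EuclideanSpace ℝ (Fin m)) N]
    (α : DiffForm (𝓡 m) N 1) (θ : DiffForm (𝓡 m) N 2) :
    DiffForm (𝓘(ℝ, ℝ).prod (𝓡 m)) (ℝ × N) 2 :=
  fun p => wedgeCovectors (V := TangentSpace (𝓘(ℝ, ℝ).prod (𝓡 m)) p)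
      (mfderiv (𝓘(ℝ, ℝ).prod (𝓡 m)) 𝓘(ℝ, ℝ) (Prod.fst : ℝ × N → ℝ) p)
      ((ContinuousAlternatingMap.ofSubsingleton ℝ (TangentSpace (𝓘(ℝ, ℝ).prod (𝓡 m)) p) ℝ
          (0 : Fin 1)).symm
        (DiffForm.pullback (I := 𝓘(ℝ, ℝ).prod (𝓡 m)) α (Prod.snd : ℝ × N → N) univ p))
    + DiffForm.pullback (I := 𝓘(ℝ, ℝ).prod (𝓡 m)) θ (Prod.snd : ℝ × N → N) univ p

section Gluing

variable {N Wm Wp : Type*}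

/-- The identification of `b₋ x ∈ W₋` with `b₊ x ∈ W₊` for `x ∈ N`. -/
inductive GlueRel (bm : N → Wm) (bp : N → Wp) : Wm ⊕ Wp → Wm ⊕ Wp → Prop
  | glue (x : N) : GlueRel bm bp (Sum.inl (bm x)) (Sum.inr (bp x))

/-- The space `W₋ ∪_N W₊` obtained from the disjoint union of `W₋` and `W₊` by identifying `b₋ x`
with `b₊ x` for all `x ∈ N`. -/
def Glued (bm : N → Wm) (bp : N → Wp) : Type _ := Quot (GlueRel bm bp)

/-- The glued space carries the quotient topology. -/
instance [TopologicalSpace Wm] [TopologicalSpace Wp] (bm : N → Wm) (bp : N → Wp) :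
    TopologicalSpace (Glued bm bp) :=
  inferInstanceAs (TopologicalSpace (Quot (GlueRel bm bp)))

/-- The canonical map `W₋ → W₋ ∪_N W₊`. -/
def Glued.inl (bm : N → Wm) (bp : N → Wp) (w : Wm) : Glued bm bp := Quot.mk _ (Sum.inl w)

/-- The canonical map `W₊ → W₋ ∪_N W₊`. -/
def Glued.inr (bm : N → Wm) (bp : N → Wp) (w : Wp) : Glued bm bp := Quot.mk _ (Sum.inr w)

/-- The space `W = W₋ ∪ W₊` obtained by identifying the boundaries of `W₋` and `W₊` through their
parametrizations by `N` given by the collars. -/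
abbrev GluedAlongCollars (cm : ℝ × N → Wm) (cp : ℝ × N → Wp) : Type _ :=
  Glued (fun x => cm (0, x)) (fun x => cp (0, x))

/-- The two-sided collar `(-2, 2) × N → W` of the common boundary: with coordinate `τ = -t₋` on
the collar of `W₋` and `τ = t₊` on the collar of `W₊`. -/
def bicollar (cm : ℝ × N → Wm) (cp : ℝ × N → Wp) (p : ℝ × N) : GluedAlongCollars cm cp :=
  if 0 ≤ p.1 then Glued.inr _ _ (cp p) else Glued.inl _ _ (cm (-p.1, p.2))

/-- The smooth structure on `W = W₋ ∪ W₊` is the one obtained by gluing along the collars: the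
interiors of `W₋` and `W₊` and the two-sided collar `(-2, 2) × N` are smoothly included in `W` as
open sets. (These cover `W`, so there is at most one such smooth structure.) -/
structure IsGluedSmoothStructure (n : ℕ) [NeZero n]
    [TopologicalSpace N] [ChartedSpace (EuclideanSpace ℝ (Fin (2 * n - 1))) N]
    [TopologicalSpace Wm] [ChartedSpace (EuclideanHalfSpace (2 * n)) Wm]
    [TopologicalSpace Wp] [ChartedSpace (EuclideanHalfSpace (2 * n)) Wp]
    (cm : ℝ × N → Wm) (cp : ℝ × N → Wp)
    [ChartedSpace (EuclideanSpace ℝ (Fin (2 * n))) (GluedAlongCollars cm cp)] : Prop where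
  isManifold : IsManifold (𝓡 (2 * n)) ∞ (GluedAlongCollars cm cp)
  inl : IsLocalDiffeomorphOn (𝓡∂ (2 * n)) (𝓡 (2 * n)) ∞
    (Glued.inl (fun x => cm (0, x)) (fun x => cp (0, x))) ((𝓡∂ (2 * n)).interior Wm)
  inr : IsLocalDiffeomorphOn (𝓡∂ (2 * n)) (𝓡 (2 * n)) ∞
    (Glued.inr (fun x => cm (0, x)) (fun x => cp (0, x))) ((𝓡∂ (2 * n)).interior Wp)
  bicollar : IsLocalDiffeomorphOn (𝓘(ℝ, ℝ).prod (𝓡 (2 * n - 1))) (𝓡 (2 * n)) ∞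
    (bicollar cm cp) (Ioo (-2 : ℝ) 2 ×ˢ univ)

end Gluing

end

/-! Write θ for `ΩN` and use the coordinate τ on the two-sided collar, with τ = t on the plus side
and τ = -t on the minus side. Off τ = 0 the two symplectic forms together read d|τ| ∧ α + θ. Replace
|τ| by a function F(τ, x) that equals |τ| for |τ| > ρ(x), equals log|τ| - log ρ(x) near τ = 0, and
has ∂F/∂τ ≠ 0 off τ = 0. Then dF ∧ α + θ is closed, agrees with the given forms for |τ| > ρ(x), and
has a logarithmic pole along the seam. Its inverse is the required bivector Π.

The singular form is never handled across the seam. Let B be the endomorphism v ↦ v + ((G - 1) dτ(v)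
+ μ(v)) ∂_τ, where G = 1/∂_τF and μ = -(∂_rF/∂_τF) dρ, with r the slot of F filled by ρ(x). Since dF
∘ B = dτ and B preserves the N-component, B pulls dF ∧ α + θ back to Π₀⁻¹ = dτ ∧ α + θ, so Π is the
push-forward of Π₀ by B. This formula is smooth at τ = 0, because G and μ extend smoothly and G = τ
near the seam. As det B = G, one gets ⋀ⁿΠ = G ⋀ⁿΠ₀, where ⋀ⁿΠ₀ vanishes nowhere. Hence the zero set
is exactly τ = 0 and the zero is transverse. Off the seam the Jacobi identity is dual to closedness
of dF ∧ α + θ, and it extends to the seam by density. The local statement is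
`isLocalBSymplectic_cylinder`; the explicit F is `logProfile`, and monotonicity is
`logProfileEuler_pos`.

The width ρ varies with x because N need not be compact. It is chosen by a partition of unity so
that {t ≤ ρ(x)} is closed in each W± (`IsCollarGluing.exists_isWidth`). The complements of these
thin collars and the two-sided collar then form an open cover of W, and on overlaps Π agrees with
the inverse of Ω± (`IsSideOf.exists_centerField_eq`). Smoothness and transversality are tested in
preferred charts, so the smooth structure is built with every preferred chart inside one member of
this cover. There Π is given by a single formula, and `isBSymplectic_of_inChart` reduces everything
to the local models. -/

noncomputable section

/-! ### Bivectors as skew maps V* → V, their powers, and the determinant on top degree. -/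

section Bivectors

variable {V : Type*} [NormedAddCommGroup V] [NormedSpace ℝ V] [FiniteDimensional ℝ V]
  {V' : Type*} [NormedAddCommGroup V'] [NormedSpace ℝ V'] [FiniteDimensional ℝ V']

/-- The `i`-th coordinate functional of the standard basis, as a continuous functional. -/
def dualCoord (V : Type*) [NormedAddCommGroup V] [NormedSpace ℝ V] [FiniteDimensional ℝ V]
    (i : Fin (Module.finrank ℝ V)) : V →L[ℝ] ℝ :=
  LinearMap.toContinuousLinearMap ((Module.finBasis ℝ V).coord i)

theorem sum_dualCoord_smul (v : V) :
    ∑ i, dualCoord V i v • Module.finBasis ℝ V i = v := by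
  simp [dualCoord, (Module.finBasis ℝ V).sum_repr v]

theorem sum_smul_dualCoord (ξ : V →L[ℝ] ℝ) :
    ∑ i, ξ (Module.finBasis ℝ V i) • dualCoord V i = ξ := by
  ext v
  conv_rhs => rw [← sum_dualCoord_smul v, map_sum]
  simp [mul_comm]

/-- The bivector `½ ∑ eᵢ ∧ A eⁱ` attached to a map `A : V* → V`. -/
def bivector (A : (V →L[ℝ] ℝ) →L[ℝ] V) : ⋀[ℝ]^2 V :=
  (1 / 2 : ℝ) • ∑ i, exteriorPower.ιMulti ℝ 2 ![Module.finBasis ℝ V i, A (dualCoord V i)]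

/-- The map `V'* → V'` obtained from `A : V* → V` by pushing forward along `T : V → V'`. -/
def pushSharp (T : V →L[ℝ] V') (A : (V →L[ℝ] ℝ) →L[ℝ] V) : (V' →L[ℝ] ℝ) →L[ℝ] V' :=
  T ∘L A ∘L ((ContinuousLinearMap.compL ℝ V V' ℝ).flip T)

omit [FiniteDimensional ℝ V] [FiniteDimensional ℝ V'] in
@[simp]
theorem pushSharp_apply (T : V →L[ℝ] V') (A : (V →L[ℝ] ℝ) →L[ℝ] V) (ξ : V' →L[ℝ] ℝ) :
    pushSharp T A ξ = T (A (ξ ∘L T)) := rfl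

/-- `ιMulti` in degree two as a bilinear map. -/
def wedgeTwo (V : Type*) [AddCommGroup V] [Module ℝ V] : V →ₗ[ℝ] V →ₗ[ℝ] ⋀[ℝ]^2 V :=
  LinearMap.mk₂ ℝ (fun u v => exteriorPower.ιMulti ℝ 2 ![u, v])
    (fun u u' v => Subtype.ext (by simp [ExteriorAlgebra.ιMulti_apply, add_mul]))
    (fun c u v => Subtype.ext (by simp [ExteriorAlgebra.ιMulti_apply]))
    (fun u v v' => Subtype.ext (by simp [ExteriorAlgebra.ιMulti_apply, mul_add]))
    (fun c u v => Subtype.ext (by simp [ExteriorAlgebra.ιMulti_apply]))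

theorem wedgeTwo_apply {V : Type*} [AddCommGroup V] [Module ℝ V] (u v : V) :
    wedgeTwo V u v = exteriorPower.ιMulti ℝ 2 ![u, v] := rfl

theorem bivector_eq (A : (V →L[ℝ] ℝ) →L[ℝ] V) :
    bivector A = (1 / 2 : ℝ) • ∑ i, wedgeTwo V (Module.finBasis ℝ V i) (A (dualCoord V i)) := rfl

/-- The canonical tensor ∑ eᵢ ⊗ eⁱ does not depend on bases. Expanding T eᵢ in the basis of V', and
e'ʲ ∘ T in the dual basis of V, turns both sides into the same double sum. -/
theorem map_bivector (T : V →L[ℝ] V') (A : (V →L[ℝ] ℝ) →L[ℝ] V) :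
    exteriorPower.map 2 (T : V →ₗ[ℝ] V') (bivector A) = bivector (pushSharp T A) := by
  have h1 : ∀ u v : V, exteriorPower.map 2 (T : V →ₗ[ℝ] V') (wedgeTwo V u v)
      = wedgeTwo V' (T u) (T v) := by
    intro u v
    rw [wedgeTwo_apply, wedgeTwo_apply, exteriorPower.map_apply_ιMulti]
    congr 1
    ext i
    fin_cases i <;> rfl
  rw [bivector_eq, bivector_eq, map_smul, map_sum]
  simp only [h1, pushSharp_apply]
  congr 1
  have h2 : ∀ j, A (dualCoord V' j ∘L T)
      = ∑ i, dualCoord V' j (T (Module.finBasis ℝ V i)) • A (dualCoord V i) := by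
    intro j
    rw [← sum_smul_dualCoord (dualCoord V' j ∘L T), map_sum]
    simp
  simp only [h2, map_sum, map_smul]
  rw [Finset.sum_comm]
  refine Finset.sum_congr rfl fun i _ => ?_
  conv_lhs => rw [← sum_dualCoord_smul (T (Module.finBasis ℝ V i)), map_sum, LinearMap.sum_apply]
  refine Finset.sum_congr rfl fun j _ => ?_
  simp

/-- `A : V* → V` is skew-symmetric. -/
def IsSkewSharp (A : (V →L[ℝ] ℝ) →L[ℝ] V) : Prop := ∀ ξ η : V →L[ℝ] ℝ, η (A ξ) = -ξ (A η)

omit [FiniteDimensional ℝ V] [FiniteDimensional ℝ V'] in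
theorem IsSkewSharp.pushSharp {A : (V →L[ℝ] ℝ) →L[ℝ] V} (hA : IsSkewSharp A) (T : V →L[ℝ] V') :
    IsSkewSharp (pushSharp T A) := fun ξ η => hA (ξ ∘L T) (η ∘L T)

/-- The two terms of the 2 × 2 determinant contribute η(Aξ) and -ξ(Aη), which coincide by skewness,
and the factor ½ compensates. This fixes the sign convention {f, g} = dg(A df). -/
theorem pairingDual_bivector {A : (V →L[ℝ] ℝ) →L[ℝ] V} (hA : IsSkewSharp A)
    (ξ η : V →L[ℝ] ℝ) :
    exteriorPower.pairingDual ℝ V 2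
      (exteriorPower.ιMulti ℝ 2 ![(ξ : V →ₗ[ℝ] ℝ), (η : V →ₗ[ℝ] ℝ)]) (bivector A) = η (A ξ) := by
  rw [bivector, map_smul, map_sum]
  simp only [exteriorPower.pairingDual_ιMulti_ιMulti, Matrix.det_fin_two, Matrix.of_apply,
    Matrix.cons_val_zero, Matrix.cons_val_one, ContinuousLinearMap.coe_coe]
  have e1 : ∑ i, ξ (Module.finBasis ℝ V i) * η (A (dualCoord V i)) = η (A ξ) := by
    conv_rhs => rw [← sum_smul_dualCoord ξ]
    simp
  have e2 : ∑ i, η (Module.finBasis ℝ V i) * ξ (A (dualCoord V i)) = ξ (A η) := by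
    conv_rhs => rw [← sum_smul_dualCoord η]
    simp
  rw [Finset.sum_sub_distrib, e1, e2, hA η ξ]
  simp
  ring

section Power

variable {A : (V →L[ℝ] ℝ) →L[ℝ] V}

local notation "Λ" => ExteriorAlgebra ℝ V

theorem coe_bivector (A : (V →L[ℝ] ℝ) →L[ℝ] V) :
    (bivector A : Λ) = (1 / 2 : ℝ) • ∑ i, ExteriorAlgebra.ι ℝ (Module.finBasis ℝ V i)
      * ExteriorAlgebra.ι ℝ (A (dualCoord V i)) := by
  rw [bivector, Submodule.coe_smul, Submodule.coe_sum]
  simp [ExteriorAlgebra.ιMulti_apply]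

omit [FiniteDimensional ℝ V] in
theorem ι_mul_ι_anticomm (u v : V) :
    ExteriorAlgebra.ι ℝ u * ExteriorAlgebra.ι ℝ v
      = -(ExteriorAlgebra.ι ℝ v * ExteriorAlgebra.ι ℝ u) := by
  rw [eq_neg_iff_add_eq_zero]
  exact ExteriorAlgebra.ι_add_mul_swap u v

theorem commute_ι_bivector (A : (V →L[ℝ] ℝ) →L[ℝ] V) (v : V) :
    Commute (ExteriorAlgebra.ι ℝ v) (bivector A : Λ) := by
  rw [coe_bivector]
  refine (Commute.sum_right _ _ _ fun i _ => ?_).smul_right _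
  rw [Commute, SemiconjBy, ← mul_assoc, ι_mul_ι_anticomm v, neg_mul, mul_assoc,
    ι_mul_ι_anticomm v, mul_neg, neg_neg, mul_assoc]

/-- Contraction with a covector in the exterior algebra. -/
def contract (ξ : V →L[ℝ] ℝ) : Λ →ₗ[ℝ] Λ :=
  CliffordAlgebra.contractLeft (Q := (0 : QuadraticForm ℝ V)) (ξ : Module.Dual ℝ V)

omit [FiniteDimensional ℝ V] in
theorem contract_ι_mul (ξ : V →L[ℝ] ℝ) (v : V) (x : Λ) :
    contract ξ (ExteriorAlgebra.ι ℝ v * x)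
      = ξ v • x - ExteriorAlgebra.ι ℝ v * contract ξ x :=
  CliffordAlgebra.contractLeft_ι_mul _ _ _

omit [FiniteDimensional ℝ V] in
theorem contract_one (ξ : V →L[ℝ] ℝ) : contract ξ (1 : Λ) = 0 :=
  CliffordAlgebra.contractLeft_one (Q := (0 : QuadraticForm ℝ V)) _

/-- Contraction is a derivation on even elements. The contraction of the bivector with ξ is Aξ: each
of the two slots yields half of it, the second one through skewness. -/
theorem contract_bivector_mul (hA : IsSkewSharp A) (ξ : V →L[ℝ] ℝ) (x : Λ) :
    contract ξ ((bivector A : Λ) * x)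
      = ExteriorAlgebra.ι ℝ (A ξ) * x + (bivector A : Λ) * contract ξ x := by
  rw [coe_bivector]
  simp only [smul_mul_assoc, Finset.sum_mul, map_smul, map_sum, mul_assoc, contract_ι_mul,
    mul_sub, mul_smul_comm]
  have e1 : ∑ i, ξ (Module.finBasis ℝ V i) • (ExteriorAlgebra.ι ℝ (A (dualCoord V i)) * x)
      = ExteriorAlgebra.ι ℝ (A ξ) * x := by
    conv_rhs => rw [← sum_smul_dualCoord ξ]
    simp [Finset.sum_mul]
  have e2 : ∑ i, ξ (A (dualCoord V i)) • (ExteriorAlgebra.ι ℝ (Module.finBasis ℝ V i) * x)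
      = -(ExteriorAlgebra.ι ℝ (A ξ) * x) := by
    conv_rhs => rw [← sum_dualCoord_smul (A ξ)]
    simp only [hA _ ξ]
    simp [Finset.sum_mul]
  rw [Finset.sum_sub_distrib, Finset.sum_sub_distrib, e1, e2, smul_sub, smul_sub, smul_neg]
  module

theorem contract_bivector_pow (hA : IsSkewSharp A) (ξ : V →L[ℝ] ℝ) (k : ℕ) :
    contract ξ ((bivector A : Λ) ^ (k + 1))
      = ((k : ℝ) + 1) • (ExteriorAlgebra.ι ℝ (A ξ) * (bivector A : Λ) ^ k) := by
  induction k with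
  | zero =>
    have := contract_bivector_mul hA ξ 1
    simpa [contract_one] using this
  | succ k ih =>
    rw [pow_succ', contract_bivector_mul hA, ih, mul_smul_comm, ← mul_assoc _ (ExteriorAlgebra.ι ℝ _),
      ← (commute_ι_bivector A (A ξ)).eq, mul_assoc, ← pow_succ']
    push_cast
    module

/-- The top power of a nondegenerate bivector does not vanish. -/
theorem bivector_pow_ne_zero (hA : IsSkewSharp A) (hs : Surjective A) {n : ℕ}
    (hn : Module.finrank ℝ V = 2 * n) : (bivector A : Λ) ^ n ≠ 0 := by
  suffices H : ∀ k, k ≤ n → (bivector A : Λ) ^ k ≠ 0 from H n le_rfl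
  intro k
  induction k with
  | zero => intro _; simp
  | succ k ih =>
    intro hk h0
    apply ih (by omega)
    -- If the (k+1)-st power vanishes, its contraction (k+1) Aξ ∧ πᵏ vanishes for every ξ, and by
    -- surjectivity of A every vector wedges πᵏ to zero.
    have hι : ∀ v, ExteriorAlgebra.ι ℝ v * (bivector A : Λ) ^ k = 0 := by
      intro v
      obtain ⟨ξ, rfl⟩ := hs v
      have := contract_bivector_pow hA ξ k
      rw [h0, map_zero] at this
      have hk : (k : ℝ) + 1 ≠ 0 := by positivity
      exact (smul_eq_zero.1 this.symm).resolve_left hk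
    have hc : ∀ i, (bivector A : Λ) ^ k = ExteriorAlgebra.ι ℝ (Module.finBasis ℝ V i)
        * contract (dualCoord V i) ((bivector A : Λ) ^ k) := by
      intro i
      have := contract_ι_mul (dualCoord V i) (Module.finBasis ℝ V i) ((bivector A : Λ) ^ k)
      rw [hι, map_zero] at this
      have h1 : dualCoord V i (Module.finBasis ℝ V i) = 1 := by simp [dualCoord]
      rw [h1, one_smul] at this
      exact (sub_eq_zero.1 this.symm)
    -- The Euler operator ∑ eᵢ ∧ ι_{eⁱ} is computed on πᵏ in two ways: here it multiplies by the
    -- dimension 2n, and in `hsum2` by the degree 2k. Since k < n, this forces πᵏ = 0.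
    have hsum : ((2 * n : ℕ) : ℝ) • (bivector A : Λ) ^ k
        = ∑ i, ExteriorAlgebra.ι ℝ (Module.finBasis ℝ V i)
          * contract (dualCoord V i) ((bivector A : Λ) ^ k) := by
      rw [← Finset.sum_congr rfl fun i _ => hc i]
      simp [hn, ← Nat.cast_smul_eq_nsmul ℝ]
    have hsum2 : ∑ i, ExteriorAlgebra.ι ℝ (Module.finBasis ℝ V i)
          * contract (dualCoord V i) ((bivector A : Λ) ^ k)
        = ((2 * k : ℕ) : ℝ) • (bivector A : Λ) ^ k := by
      cases k with
      | zero => simp [contract_one]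
      | succ j =>
        simp only [contract_bivector_pow hA, mul_smul_comm, ← mul_assoc]
        rw [← Finset.smul_sum, ← Finset.sum_mul]
        have : ∑ i, ExteriorAlgebra.ι ℝ (Module.finBasis ℝ V i)
            * ExteriorAlgebra.ι ℝ (A (dualCoord V i)) = (2 : ℝ) • (bivector A : Λ) := by
          rw [coe_bivector, smul_smul]; norm_num
        rw [this, smul_mul_assoc, ← pow_succ', smul_smul]
        congr 1
        push_cast; ring
    rw [hsum2, ← sub_eq_zero, ← sub_smul] at hsum
    refine (smul_eq_zero.1 hsum).resolve_left ?_
    have : (k : ℝ) < n := by exact_mod_cast hk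
    push_cast
    intro h; linarith

end Power

/-- An endomorphism acts on the top exterior power by its determinant. -/
theorem map_top_eq_det_smul {k : ℕ} (hk : Module.finrank ℝ V = k) (B : V →ₗ[ℝ] V)
    (z : ⋀[ℝ]^k V) : exteriorPower.map k B z = LinearMap.det B • z := by
  subst hk
  suffices h : exteriorPower.map _ B = LinearMap.det B • LinearMap.id by rw [h]; rfl
  apply exteriorPower.linearMap_ext
  refine (Module.finBasis ℝ V).ext_alternating fun v hv => ?_
  rw [LinearMap.compAlternatingMap_apply, exteriorPower.map_apply_ιMulti,
    LinearMap.compAlternatingMap_apply]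
  set b := Module.finBasis ℝ V with hb
  set f := exteriorPower.ιMulti ℝ (Module.finrank ℝ V) (M := V) with hf
  -- The universal alternating map in top degree is the determinant times its value on the basis,
  -- since both sides agree on permutations of that basis.
  have key : ∀ w : Fin (Module.finrank ℝ V) → V, f w = b.det w • f b := by
    intro w
    have : f = (LinearMap.toSpanSingleton ℝ _ (f b)).compAlternatingMap b.det := by
      refine b.ext_alternating fun σ hσ => ?_
      let e : Equiv.Perm (Fin (Module.finrank ℝ V)) := Equiv.ofBijective σ hσ.bijective_of_finite
      have h1 : (fun i => b (σ i)) = b ∘ e := rfl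
      rw [h1, AlternatingMap.map_perm, LinearMap.compAlternatingMap_apply,
        AlternatingMap.map_perm, b.det_self]
      simp
    conv_lhs => rw [this]
    simp
  rw [key, key (fun i => b (v i))]
  have h2 : b.det (B ∘ fun i => b (v i)) = LinearMap.det B * b.det fun i => b (v i) :=
    b.det_comp B _
  rw [h2]
  simp only [LinearMap.smul_apply, LinearMap.id_apply, smul_smul]

end Bivectors


/-! ### Nondegenerate two-forms and their inverse maps V* → V. -/

section FlatSharp

variable {V : Type*} [NormedAddCommGroup V] [NormedSpace ℝ V]
  {V' : Type*} [NormedAddCommGroup V'] [NormedSpace ℝ V']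

/-- The map `V → V*` attached to a `2`-form. -/
def flatForm (σ : V [⋀^Fin 2]→L[ℝ] ℝ) : V →L[ℝ] V →L[ℝ] ℝ :=
  ((ContinuousAlternatingMap.ofSubsingletonLIE (𝕜 := ℝ) (E := V) (F := ℝ)
    (0 : Fin 1)).symm.toContinuousLinearEquiv : (V [⋀^Fin 1]→L[ℝ] ℝ) →L[ℝ] (V →L[ℝ] ℝ)) ∘L
    σ.curryLeft

theorem contDiff_flatForm {k : WithTop ℕ∞} : ContDiff ℝ k (flatForm (V := V)) := by
  have h : ContDiff ℝ k (ContinuousAlternatingMap.curryLeftLI (𝕜 := ℝ) (E := V) (F := ℝ)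
      (n := 1)) := LinearIsometry.contDiff _
  exact contDiff_const.clm_comp h

@[simp]
theorem flatForm_apply (σ : V [⋀^Fin 2]→L[ℝ] ℝ) (v w : V) : flatForm σ v w = σ ![v, w] := by
  change σ (Matrix.vecCons v fun _ => w) = _
  congr 1
  ext i
  fin_cases i <;> rfl

theorem alternating_swap (σ : V [⋀^Fin 2]→L[ℝ] ℝ) (v w : V) : σ ![v, w] = -σ ![w, v] := by
  have h := σ.toAlternatingMap.map_swap ![w, v] (i := 0) (j := 1) (by decide)
  rw [← ContinuousAlternatingMap.coe_toAlternatingMap, ← h]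
  congr 1
  ext i
  fin_cases i <;> rfl

/-- Nondegeneracy of a `2`-form on a vector space. -/
def FormNondeg (σ : V [⋀^Fin 2]→L[ℝ] ℝ) : Prop := ∀ v, (∀ w, σ ![v, w] = 0) → v = 0

/-- The inverse `V* → V` of the map `V → V*` attached to a `2`-form. -/
def sharpForm (σ : V [⋀^Fin 2]→L[ℝ] ℝ) : (V →L[ℝ] ℝ) →L[ℝ] V := (flatForm σ).inverse

variable [FiniteDimensional ℝ V]

theorem FormNondeg.exists_equiv {σ : V [⋀^Fin 2]→L[ℝ] ℝ} (hσ : FormNondeg σ) :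
    ∃ e : V ≃L[ℝ] (V →L[ℝ] ℝ), (e : V →L[ℝ] V →L[ℝ] ℝ) = flatForm σ := by
  have hinj : Injective ((flatForm σ : V →L[ℝ] V →L[ℝ] ℝ) : V →ₗ[ℝ] (V →L[ℝ] ℝ)) := by
    refine (injective_iff_map_eq_zero _).2 fun v hv => hσ v fun w => ?_
    rw [← flatForm_apply]
    exact DFunLike.congr_fun (f := (flatForm σ v)) (g := (0 : V →L[ℝ] ℝ)) hv w
  have hrank : Module.finrank ℝ V = Module.finrank ℝ (V →L[ℝ] ℝ) := by
    rw [← (LinearMap.toContinuousLinearMap (𝕜 := ℝ) (E := V) (F' := ℝ)).finrank_eq]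
    exact (Subspace.dual_finrank_eq (K := ℝ) (V := V)).symm
  refine ⟨(LinearMap.linearEquivOfInjective _ hinj hrank).toContinuousLinearEquiv, ?_⟩
  ext v w
  rfl

theorem FormNondeg.apply_sharpForm {σ : V [⋀^Fin 2]→L[ℝ] ℝ} (hσ : FormNondeg σ)
    (ξ : V →L[ℝ] ℝ) (v : V) : σ ![sharpForm σ ξ, v] = ξ v := by
  obtain ⟨e, he⟩ := hσ.exists_equiv
  rw [← flatForm_apply, sharpForm, ← he, ContinuousLinearMap.inverse_equiv]
  simp

theorem FormNondeg.surjective_sharpForm {σ : V [⋀^Fin 2]→L[ℝ] ℝ} (hσ : FormNondeg σ) :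
    Surjective (sharpForm σ) := by
  obtain ⟨e, he⟩ := hσ.exists_equiv
  rw [sharpForm, ← he, ContinuousLinearMap.inverse_equiv]
  exact e.symm.surjective

theorem FormNondeg.eq_sharpForm {σ : V [⋀^Fin 2]→L[ℝ] ℝ} (hσ : FormNondeg σ)
    {A : (V →L[ℝ] ℝ) →L[ℝ] V} (hA : ∀ ξ v, σ ![A ξ, v] = ξ v) : A = sharpForm σ := by
  ext1 ξ
  rw [← sub_eq_zero]
  refine hσ _ fun w => ?_
  rw [← flatForm_apply, map_sub, sub_apply, flatForm_apply, flatForm_apply,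
    hA, hσ.apply_sharpForm, sub_self]

theorem FormNondeg.isSkewSharp {σ : V [⋀^Fin 2]→L[ℝ] ℝ} (hσ : FormNondeg σ) :
    IsSkewSharp (sharpForm σ) := fun ξ η => by
  rw [← hσ.apply_sharpForm η, ← hσ.apply_sharpForm ξ, alternating_swap]

omit [FiniteDimensional ℝ V] in
theorem FormNondeg.comp_equiv {σ' : V' [⋀^Fin 2]→L[ℝ] ℝ} (hσ' : FormNondeg σ') (T : V ≃L[ℝ] V') :
    FormNondeg (σ'.compContinuousLinearMap (T : V →L[ℝ] V')) := fun v hv => by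
  refine (map_eq_zero_iff _ T.injective).1 (hσ' (T v) fun w => ?_)
  have := hv (T.symm w)
  rw [ContinuousAlternatingMap.compContinuousLinearMap_apply] at this
  rw [← this]
  congr 1
  ext i
  fin_cases i <;> simp

omit [FiniteDimensional ℝ V] in
theorem compContinuousLinearMap_pair (σ' : V' [⋀^Fin 2]→L[ℝ] ℝ) (T : V →L[ℝ] V') (v w : V) :
    σ'.compContinuousLinearMap T ![v, w] = σ' ![T v, T w] := by
  rw [ContinuousAlternatingMap.compContinuousLinearMap_apply]
  congr 1
  ext i
  fin_cases i <;> rfl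

/-- Pulling a form back and pushing its inverse forward cancel out, because the inverse is
characterised by σ(Aξ, v) = ξ(v). All later changes of chart and collar identifications are
instances of this. -/
theorem pushSharp_sharpForm [FiniteDimensional ℝ V'] {σ' : V' [⋀^Fin 2]→L[ℝ] ℝ}
    (hσ' : FormNondeg σ') (T : V ≃L[ℝ] V') :
    pushSharp (T : V →L[ℝ] V') (sharpForm (σ'.compContinuousLinearMap (T : V →L[ℝ] V')))
      = sharpForm σ' := by
  refine hσ'.eq_sharpForm fun ξ v => ?_
  have h := (hσ'.comp_equiv T).apply_sharpForm (ξ ∘L (T : V →L[ℝ] V')) (T.symm v)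
  rw [compContinuousLinearMap_pair] at h
  simpa using h

theorem contDiffAt_sharpForm {X : Type*} [NormedAddCommGroup X] [NormedSpace ℝ X]
    {σ : X → V [⋀^Fin 2]→L[ℝ] ℝ} {x : X} {k : WithTop ℕ∞}
    (hσ : ContDiffAt ℝ k (fun y => flatForm (σ y)) x) (hn : FormNondeg (σ x)) : ContDiffAt ℝ k (fun y => sharpForm (σ y)) x := by
  obtain ⟨e, he⟩ := hn.exists_equiv
  have : CompleteSpace V := FiniteDimensional.complete ℝ V
  have h2 := contDiffAt_map_inverse (𝕜 := ℝ) (n := k) e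
  rw [he] at h2
  exact h2.comp x hσ

end FlatSharp

/-! ### The Jacobi identity for the inverse of a closed form. -/

section LocalPoisson

variable {V : Type*} [NormedAddCommGroup V] [NormedSpace ℝ V]

/-- The bracket of functions on a vector space defined by a field of maps `V* → V`. -/
def localBracket (A : V → (V →L[ℝ] ℝ) →L[ℝ] V) (f g : V → ℝ) (y : V) : ℝ :=
  fderiv ℝ g y (A y (fderiv ℝ f y))

/-- The cyclic form of `dβ = 0` at a point for a field `β` of bilinear forms. -/
def CyclicClosedAt (β : V → V →L[ℝ] V →L[ℝ] ℝ) (y : V) : Prop :=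
  ∀ u v w : V, fderiv ℝ β y u v w + fderiv ℝ β y v w u + fderiv ℝ β y w u v = 0

theorem fderiv_apply_apply {β : V → V →L[ℝ] V →L[ℝ] ℝ} {y : V} (hβ : DifferentiableAt ℝ β y)
    (u v w : V) : fderiv ℝ (fun z => β z v w) y u = fderiv ℝ β y u v w := by
  have h := (hβ.hasFDerivAt.clm_apply (hasFDerivAt_const v y)).clm_apply (hasFDerivAt_const w y)
  rw [h.fderiv]
  simp

/-- One transposition in the middle term absorbs the sign of the alternating sum that defines dσ and
leaves the cyclic sum. -/
theorem cyclicClosedAt_flatForm {σ : V → V [⋀^Fin 2]→L[ℝ] ℝ} {y : V}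
    (hσ : DifferentiableAt ℝ σ y) (hc : extDeriv σ y = 0) :
    CyclicClosedAt (fun z => flatForm (σ z)) y := by
  intro u v w
  have hf : DifferentiableAt ℝ (fun z => flatForm (σ z)) y :=
    (contDiff_flatForm.differentiable one_ne_zero _).comp y hσ
  have h := extDeriv_apply hσ ![u, v, w]
  rw [hc, Fin.sum_univ_three] at h
  have e0 : (0 : Fin 3).removeNth ![u, v, w] = ![v, w] := by ext i; fin_cases i <;> rfl
  have e1 : (1 : Fin 3).removeNth ![u, v, w] = ![u, w] := by ext i; fin_cases i <;> rfl
  have e2 : (2 : Fin 3).removeNth ![u, v, w] = ![u, v] := by ext i; fin_cases i <;> rfl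
  have e3 : (fun z => σ z ![u, w]) = fun z => -σ z ![w, u] :=
    funext fun z => alternating_swap _ _ _
  rw [e0, e1, e2, e3, fderiv_fun_neg] at h
  rw [← fderiv_apply_apply hf, ← fderiv_apply_apply hf, ← fderiv_apply_apply hf]
  simp only [flatForm_apply]
  simp at h
  linarith

/-- The Jacobi identity at a point near which the field `A` inverts a closed skew form. -/
theorem localBracket_jacobi {A : V → (V →L[ℝ] ℝ) →L[ℝ] V} {β : V → V →L[ℝ] V →L[ℝ] ℝ} {y : V}
    (hA : DifferentiableAt ℝ A y) (hβ : DifferentiableAt ℝ β y)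
    (hskew : ∀ᶠ z in nhds y, ∀ v w, β z v w = -β z w v)
    (hinv : ∀ᶠ z in nhds y, ∀ ξ v, β z (A z ξ) v = ξ v) (hcl : CyclicClosedAt β y)
    {f g h : V → ℝ} (hf : ContDiffAt ℝ 2 f y) (hg : ContDiffAt ℝ 2 g y) (hh : ContDiffAt ℝ 2 h y) :
    localBracket A f (localBracket A g h) y + localBracket A g (localBracket A h f) y
      + localBracket A h (localBracket A f g) y = 0 := by
  have hd : ∀ {f : V → ℝ}, ContDiffAt ℝ 2 f y → DifferentiableAt ℝ (fderiv ℝ f) y :=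
    fun hf => (hf.fderiv_right (m := 1) (by norm_num)).differentiableAt (by norm_num)
  -- With X_f = A df, the iterated bracket is X_f(dh(X_g)) = h''(X_f, X_g) - g''(X_f, X_h) +
  -- (D_{X_f}β)(X_g, X_h). In the cyclic sum the Hessians cancel by symmetry, and the β-terms add up
  -- to dβ = 0.
  have key : ∀ {f g h : V → ℝ}, ContDiffAt ℝ 2 g y → ContDiffAt ℝ 2 h y →
      localBracket A f (localBracket A g h) y
        = fderiv ℝ (fderiv ℝ h) y (A y (fderiv ℝ f y)) (A y (fderiv ℝ g y))
          - fderiv ℝ (fderiv ℝ g) y (A y (fderiv ℝ f y)) (A y (fderiv ℝ h y))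
          + fderiv ℝ β y (A y (fderiv ℝ f y)) (A y (fderiv ℝ g y)) (A y (fderiv ℝ h y)) := by
    intro f g h hg hh
    set X := fun z => A z (fderiv ℝ g z) with hX
    have hXd : HasFDerivAt X (fderiv ℝ X y) y :=
      (hA.clm_apply (hd hg)).hasFDerivAt
    have h1 : HasFDerivAt (localBracket A g h) _ y := (hd hh).hasFDerivAt.clm_apply hXd
    -- Differentiating β(X_g, v) = dg(v) expresses the derivative of X_g through β, so no derivative
    -- of A survives in `key`.
    have h2 : ∀ u v, fderiv ℝ β y u (X y) v + β y (fderiv ℝ X y u) v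
        = fderiv ℝ (fderiv ℝ g) y u v := by
      intro u v
      have e : (fun z => β z (X z) v) =ᶠ[nhds y] fun z => fderiv ℝ g z v := by
        filter_upwards [hinv] with z hz
        exact hz _ _
      have d1 := (hβ.hasFDerivAt.clm_apply hXd).clm_apply (hasFDerivAt_const v y)
      have d2 := (hd hg).hasFDerivAt.clm_apply (hasFDerivAt_const v y)
      have d3 := d1.unique (d2.congr_of_eventuallyEq e)
      have d4 := DFunLike.congr_fun d3 u
      simp at d4
      linarith
    have h3 : ∀ v, fderiv ℝ h y v = -β y v (A y (fderiv ℝ h y)) := by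
      intro v
      rw [← hskew.self_of_nhds, hinv.self_of_nhds]
    unfold localBracket at h1 ⊢
    rw [h1.fderiv]
    simp only [add_apply, ContinuousLinearMap.comp_apply,
      ContinuousLinearMap.flip_apply]
    rw [h3 (fderiv ℝ X y _)]
    have := h2 (A y (fderiv ℝ f y)) (A y (fderiv ℝ h y))
    simp only [hX] at this ⊢
    linarith
  have hs : ∀ {f : V → ℝ}, ContDiffAt ℝ 2 f y → IsSymmSndFDerivAt ℝ f y :=
    fun hf => hf.isSymmSndFDerivAt (by simp)
  rw [key hg hh, key hh hf, key hf hg]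
  have s1 := hs hf (A y (fderiv ℝ g y)) (A y (fderiv ℝ h y))
  have s2 := hs hg (A y (fderiv ℝ f y)) (A y (fderiv ℝ h y))
  have s3 := hs hh (A y (fderiv ℝ f y)) (A y (fderiv ℝ g y))
  have := hcl (A y (fderiv ℝ f y)) (A y (fderiv ℝ g y)) (A y (fderiv ℝ h y))
  linarith

theorem contDiffOn_localBracket {A : V → (V →L[ℝ] ℝ) →L[ℝ] V} {s : Set V} (hs : IsOpen s)
    (hA : ContDiffOn ℝ ∞ A s) {f g : V → ℝ} (hf : ContDiffOn ℝ ∞ f s) (hg : ContDiffOn ℝ ∞ g s) :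
    ContDiffOn ℝ ∞ (localBracket A f g) s :=
  (hg.fderiv_of_isOpen hs (by simp)).clm_apply
    (hA.clm_apply (hf.fderiv_of_isOpen hs (by simp)))

/-- The Jacobi identity extends from a dense set of points by continuity. -/
theorem localBracket_jacobi_of_dense {A : V → (V →L[ℝ] ℝ) →L[ℝ] V} {s t : Set V} (hs : IsOpen s)
    (hA : ContDiffOn ℝ ∞ A s) (ht : s ⊆ closure (s ∩ t)) {f g h : V → ℝ}
    (hf : ContDiffOn ℝ ∞ f s) (hg : ContDiffOn ℝ ∞ g s) (hh : ContDiffOn ℝ ∞ h s)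
    (hJ : ∀ y ∈ s ∩ t,
      localBracket A f (localBracket A g h) y + localBracket A g (localBracket A h f) y
        + localBracket A h (localBracket A f g) y = 0) (y : V) (hy : y ∈ s) :
    localBracket A f (localBracket A g h) y + localBracket A g (localBracket A h f) y
      + localBracket A h (localBracket A f g) y = 0 := by
  set J := fun y => localBracket A f (localBracket A g h) y
    + localBracket A g (localBracket A h f) y + localBracket A h (localBracket A f g) y with hJd
  have hc : ContinuousOn J s :=
    (((contDiffOn_localBracket hs hA hf (contDiffOn_localBracket hs hA hg hh)).add
      (contDiffOn_localBracket hs hA hg (contDiffOn_localBracket hs hA hh hf))).add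
      (contDiffOn_localBracket hs hA hh (contDiffOn_localBracket hs hA hf hg))).continuousOn
  have hcl : J y ∈ closure (J '' (s ∩ t)) :=
    ((hc y hy).mono inter_subset_left).mem_closure_image (ht hy)
  have himg : J '' (s ∩ t) ⊆ {0} := by
    rintro _ ⟨z, hz, rfl⟩
    exact hJ z hz
  simpa using closure_mono himg hcl

end LocalPoisson

/-! ### Smooth dependence of powers of a bivector on parameters. -/

section SmoothPowers

variable {V : Type*} [NormedAddCommGroup V] [NormedSpace ℝ V] [FiniteDimensional ℝ V]
  {X : Type*} [NormedAddCommGroup X] [NormedSpace ℝ X]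

/-- Splitting off one factor π = ½ ∑ aᵢⱼ eᵢ ∧ eⱼ replaces l by l composed with right multiplication
by eᵢ ∧ eⱼ. This is why the induction must run over all functionals l at once. -/
theorem contDiffOn_functional_bivector_pow {A : X → (V →L[ℝ] ℝ) →L[ℝ] V} {s : Set X}
    {k : WithTop ℕ∞} (hA : ContDiffOn ℝ k A s) (n : ℕ) (l : ExteriorAlgebra ℝ V →ₗ[ℝ] ℝ) :
    ContDiffOn ℝ k (fun y => l ((bivector (A y) : ExteriorAlgebra ℝ V) ^ n)) s := by
  induction n generalizing l with
  | zero => simpa using contDiffOn_const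
  | succ n ih =>
    have e : ∀ y, l ((bivector (A y) : ExteriorAlgebra ℝ V) ^ (n + 1))
        = (1 / 2 : ℝ) * ∑ i, ∑ j, dualCoord V j (A y (dualCoord V i)) *
          (l ∘ₗ LinearMap.mulRight ℝ (ExteriorAlgebra.ι ℝ (Module.finBasis ℝ V i)
            * ExteriorAlgebra.ι ℝ (Module.finBasis ℝ V j)))
            ((bivector (A y) : ExteriorAlgebra ℝ V) ^ n) := by
      intro y
      rw [pow_succ]
      generalize (bivector (A y) : ExteriorAlgebra ℝ V) ^ n = x
      rw [coe_bivector, mul_smul_comm, map_smul, smul_eq_mul, Finset.mul_sum, map_sum]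
      congr 1
      refine Finset.sum_congr rfl fun i _ => ?_
      conv_lhs => rw [← sum_dualCoord_smul (A y (dualCoord V i))]
      simp only [map_sum, map_smul, Finset.mul_sum, mul_smul_comm, smul_eq_mul]
      rfl
    simp only [e]
    refine contDiffOn_const.mul (ContDiffOn.sum fun i _ => ContDiffOn.sum fun j _ => ?_)
    exact ((dualCoord V j).contDiff.comp_contDiffOn (hA.clm_apply contDiffOn_const)).mul (ih _)

end SmoothPowers

/-! ### The n-th power of a bivector as an element of degree 2n. -/

section TopPower

variable {V : Type*} [NormedAddCommGroup V] [NormedSpace ℝ V] [FiniteDimensional ℝ V]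
  {V' : Type*} [NormedAddCommGroup V'] [NormedSpace ℝ V'] [FiniteDimensional ℝ V']

theorem coe_exteriorPower_map {V V' : Type*} [AddCommGroup V] [Module ℝ V] [AddCommGroup V']
    [Module ℝ V'] (k : ℕ) (T : V →ₗ[ℝ] V') (z : ⋀[ℝ]^k V) :
    (exteriorPower.map k T z : ExteriorAlgebra ℝ V')
      = ExteriorAlgebra.map T (z : ExteriorAlgebra ℝ V) := by
  have h : (Submodule.subtype _) ∘ₗ exteriorPower.map k T
      = (ExteriorAlgebra.map T).toLinearMap ∘ₗ Submodule.subtype _ := by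
    apply exteriorPower.linearMap_ext
    ext v
    simp only [LinearMap.compAlternatingMap_apply, LinearMap.comp_apply,
      exteriorPower.map_apply_ιMulti, Submodule.subtype_apply, exteriorPower.ιMulti_apply_coe,
      AlgHom.toLinearMap_apply, ExteriorAlgebra.map_apply_ιMulti]
  exact LinearMap.congr_fun h z

/-- The `n`-th power of a bivector in degree `2n`. -/
def bivectorPow {V : Type*} [AddCommGroup V] [Module ℝ V] (z : ⋀[ℝ]^2 V) (n : ℕ) :
    ⋀[ℝ]^(2 * n) V :=
  ⟨(z : ExteriorAlgebra ℝ V) ^ n, by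
    have h := Submodule.pow_mem_pow _ z.2 n
    rwa [← pow_mul] at h⟩

theorem map_bivectorPow {V V' : Type*} [AddCommGroup V] [Module ℝ V] [AddCommGroup V']
    [Module ℝ V'] (T : V →ₗ[ℝ] V') (z : ⋀[ℝ]^2 V) (n : ℕ) :
    exteriorPower.map (2 * n) T (bivectorPow z n) = bivectorPow (exteriorPower.map 2 T z) n := by
  apply Subtype.ext
  rw [coe_exteriorPower_map]
  simp [bivectorPow, coe_exteriorPower_map]

theorem bivectorPow_ne_zero {A : (V →L[ℝ] ℝ) →L[ℝ] V} (hA : IsSkewSharp A) (hs : Surjective A)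
    {n : ℕ} (hn : Module.finrank ℝ V = 2 * n) : bivectorPow (bivector A) n ≠ 0 := fun h =>
  bivector_pow_ne_zero hA hs hn (congrArg Subtype.val h)

/-- The top exterior power is a line spanned by the nonzero power, so a functional that kills this
power is zero. -/
theorem functional_bivectorPow_ne_zero {A : (V →L[ℝ] ℝ) →L[ℝ] V} (hA : IsSkewSharp A)
    (hs : Surjective A) {n : ℕ} (hn : Module.finrank ℝ V = 2 * n) {l : ⋀[ℝ]^(2 * n) V →ₗ[ℝ] ℝ}
    (hl : l ≠ 0) : l (bivectorPow (bivector A) n) ≠ 0 := fun h => by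
  apply hl
  have h1 : Module.finrank ℝ (⋀[ℝ]^(2 * n) V) = 1 := by
    rw [exteriorPower.finrank_eq, hn, Nat.choose_self]
  ext1
  ext v
  obtain ⟨c, hc⟩ := (finrank_eq_one_iff_of_nonzero' _ (bivectorPow_ne_zero hA hs hn)).1 h1
    (exteriorPower.ιMulti ℝ (2 * n) v)
  simp [← hc, h]

theorem contDiffOn_functional_bivectorPow {X : Type*} [NormedAddCommGroup X] [NormedSpace ℝ X]
    {A : X → (V →L[ℝ] ℝ) →L[ℝ] V} {s : Set X}
    {k : WithTop ℕ∞} (hA : ContDiffOn ℝ k A s) (n : ℕ) (l : ⋀[ℝ]^(2 * n) V →ₗ[ℝ] ℝ) :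
    ContDiffOn ℝ k (fun y => l (bivectorPow (bivector (A y)) n)) s := by
  obtain ⟨L, rfl⟩ := l.exists_extend
  exact contDiffOn_functional_bivector_pow hA n L

theorem contDiffOn_functional_bivector {X : Type*} [NormedAddCommGroup X] [NormedSpace ℝ X]
    {A : X → (V →L[ℝ] ℝ) →L[ℝ] V} {s : Set X}
    {k : WithTop ℕ∞} (hA : ContDiffOn ℝ k A s) (l : ⋀[ℝ]^2 V →ₗ[ℝ] ℝ) :
    ContDiffOn ℝ k (fun y => l (bivector (A y))) s := by
  obtain ⟨L, rfl⟩ := l.exists_extend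
  simpa using contDiffOn_functional_bivector_pow hA 1 L

end TopPower

/-! ### Local b-symplectic models and closedness of l ∧ a + β. -/

section LocalModel

variable {E : Type*} [NormedAddCommGroup E] [NormedSpace ℝ E] [FiniteDimensional ℝ E]
  {V : Type*} [NormedAddCommGroup V] [NormedSpace ℝ V]

/-- A field `A` of maps `E* → E` on the open set `s` whose bivector field is smooth, Poisson and
has `n`-th power transverse to zero. -/
structure IsLocalBSymplectic (n : ℕ) (A : E → (E →L[ℝ] ℝ) →L[ℝ] E) (s : Set E) : Prop where
  contDiffOn : ContDiffOn ℝ ∞ A s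
  skew : ∀ y ∈ s, IsSkewSharp (A y)
  jacobi : ∀ f g h : E → ℝ, ContDiffOn ℝ ∞ f s → ContDiffOn ℝ ∞ g s → ContDiffOn ℝ ∞ h s →
    ∀ y ∈ s, localBracket A f (localBracket A g h) y + localBracket A g (localBracket A h f) y
        + localBracket A h (localBracket A f g) y = 0
  transverse : ∀ y ∈ s, bivectorPow (bivector (A y)) n = 0 → ∀ l : ⋀[ℝ]^(2 * n) E →ₗ[ℝ] ℝ,
    l ≠ 0 → fderiv ℝ (fun z => l (bivectorPow (bivector (A z)) n)) y ≠ 0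

/-- The inverse of a symplectic form is a local model. -/
theorem isLocalBSymplectic_sharpForm {n : ℕ} (hn : Module.finrank ℝ E = 2 * n)
    {σ : E → E [⋀^Fin 2]→L[ℝ] ℝ} {s : Set E} (hs : IsOpen s) (hσ : ContDiffOn ℝ ∞ σ s)
    (hnd : ∀ y ∈ s, FormNondeg (σ y)) (hcl : ∀ y ∈ s, extDeriv σ y = 0) :
    IsLocalBSymplectic n (fun y => sharpForm (σ y)) s where
  contDiffOn y hy := (contDiffAt_sharpForm (contDiff_flatForm.contDiffAt.comp y
    (hσ.contDiffAt (hs.mem_nhds hy))) (hnd y hy)).contDiffWithinAt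
  skew y hy := (hnd y hy).isSkewSharp
  jacobi f g h hf hg hh y hy := by
    have hsy := hs.mem_nhds hy
    have hσy := hσ.contDiffAt hsy
    have hfl : ContDiffAt ℝ ∞ (fun y => flatForm (σ y)) y :=
      contDiff_flatForm.contDiffAt.comp y hσy
    refine localBracket_jacobi (β := fun z => flatForm (σ z))
      ((contDiffAt_sharpForm hfl (hnd y hy)).differentiableAt (by simp))
      (hfl.differentiableAt (by simp)) (.of_forall fun z v w => ?_) ?_
      (cyclicClosedAt_flatForm (hσy.differentiableAt (by simp)) (hcl y hy))
      ((hf.contDiffAt hsy).of_le (by norm_cast))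
      ((hg.contDiffAt hsy).of_le (by norm_cast))
      ((hh.contDiffAt hsy).of_le (by norm_cast))
    · rw [flatForm_apply, flatForm_apply, alternating_swap]
    · filter_upwards [hsy] with z hz ξ v
      rw [flatForm_apply, (hnd z hz).apply_sharpForm]
  transverse y hy h0 :=
    absurd h0 (bivectorPow_ne_zero (hnd y hy).isSkewSharp (hnd y hy).surjective_sharpForm hn)

omit [FiniteDimensional ℝ E] in
theorem CyclicClosedAt.comp_linear {β : V → V →L[ℝ] V →L[ℝ] ℝ} (L : E →L[ℝ] V) {y : E}
    (hβ : DifferentiableAt ℝ β (L y)) (h : CyclicClosedAt β (L y)) :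
    CyclicClosedAt (fun z => (β (L z)).bilinearComp L L) y := by
  have hd : DifferentiableAt ℝ (fun z => β (L z)) y :=
    DifferentiableAt.comp (g := β) (f := L) y hβ L.differentiableAt
  have hd' : DifferentiableAt ℝ (fun z => (β (L z)).bilinearComp L L) y := by
    have : (fun z => (β (L z)).bilinearComp L L) = fun z =>
        ((ContinuousLinearMap.compL ℝ E V ℝ).flip L) ∘L ((β (L z)) ∘L L) := rfl
    rw [this]
    exact (differentiableAt_const _).clm_comp (hd.clm_comp (differentiableAt_const _))
  have key : ∀ u v w, fderiv ℝ (fun z => (β (L z)).bilinearComp L L) y u v w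
      = fderiv ℝ β (L y) (L u) (L v) (L w) := by
    intro u v w
    rw [← fderiv_apply_apply hd', ← fderiv_apply_apply hβ]
    have hb : DifferentiableAt ℝ (fun z => β z (L v) (L w)) (L y) :=
      (hβ.clm_apply (differentiableAt_const _)).clm_apply (differentiableAt_const _)
    have := (hb.hasFDerivAt.comp y L.hasFDerivAt).fderiv
    have e : (fun z => (β (L z)).bilinearComp L L v w) = (fun z => β z (L v) (L w)) ∘ L := rfl
    rw [e, this]
    rfl
  intro u v w
  rw [key, key, key]
  exact h _ _ _

omit [FiniteDimensional ℝ E] in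
/-- `l ∧ a + β` is closed if `l`, `a` and `β` are. -/
theorem CyclicClosedAt.wedge_add {l a : E → E →L[ℝ] ℝ} {β : E → E →L[ℝ] E →L[ℝ] ℝ} {y : E}
    (hl : DifferentiableAt ℝ l y) (ha : DifferentiableAt ℝ a y) (hβ : DifferentiableAt ℝ β y)
    (hlc : ∀ u v, fderiv ℝ l y u v = fderiv ℝ l y v u)
    (hac : ∀ u v, fderiv ℝ a y u v = fderiv ℝ a y v u) (h : CyclicClosedAt β y) :
    CyclicClosedAt (fun z => (l z).smulRight (a z) - (a z).smulRight (l z) + β z) y := by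
  have hr : ∀ {l a : E → E →L[ℝ] ℝ}, DifferentiableAt ℝ l y → DifferentiableAt ℝ a y →
      DifferentiableAt ℝ (fun z => (l z).smulRight (a z)) y := fun {l a} hl ha => by
    exact DifferentiableAt.comp (g := fun p : (E →L[ℝ] ℝ) × (E →L[ℝ] ℝ) => p.1.smulRight p.2)
      (f := fun z => (l z, a z)) y (isBoundedBilinearMap_smulRight.differentiableAt _)
      (hl.prodMk ha)
  have hd : DifferentiableAt ℝ
      (fun z => (l z).smulRight (a z) - (a z).smulRight (l z) + β z) y := by
    have e1 := hr hl ha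
    have e2 := hr ha hl
    have e3 := DifferentiableAt.fun_sub (𝕜 := ℝ) (E := E) (F := E →L[ℝ] E →L[ℝ] ℝ) (x := y)
      (f := fun z => (l z).smulRight (a z)) (g := fun z => (a z).smulRight (l z)) e1 e2
    exact DifferentiableAt.fun_add (𝕜 := ℝ) (E := E) (F := E →L[ℝ] E →L[ℝ] ℝ) (x := y)
      (g := β) e3 hβ
  have key : ∀ u v w,
      fderiv ℝ (fun z => (l z).smulRight (a z) - (a z).smulRight (l z) + β z) y u v w
      = fderiv ℝ l y u v * a y w + l y v * fderiv ℝ a y u w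
        - (fderiv ℝ a y u v * l y w + a y v * fderiv ℝ l y u w) + fderiv ℝ β y u v w := by
    intro u v w
    rw [← fderiv_apply_apply hd]
    have h1 : ∀ {c : E → E →L[ℝ] ℝ}, DifferentiableAt ℝ c y → ∀ v,
        HasFDerivAt (fun z => c z v) ((fderiv ℝ c y).flip v) y := fun hc v => by
      simpa using hc.hasFDerivAt.clm_apply (hasFDerivAt_const v y)
    have h2 : HasFDerivAt (fun z => β z v w) (((fderiv ℝ β y).flip v).flip w) y := by
      have := (hβ.hasFDerivAt.clm_apply (hasFDerivAt_const v y)).clm_apply (hasFDerivAt_const w y)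
      simpa using this
    have := ((((h1 hl v).mul (h1 ha w)).sub ((h1 ha v).mul (h1 hl w))).add h2).fderiv
    have e : (fun z => ((l z).smulRight (a z) - (a z).smulRight (l z) + β z) v w)
        = fun z => l z v * a z w - a z v * l z w + β z v w := by
      ext z; simp
    rw [e]
    erw [this]
    simp
    ring
  intro u v w
  rw [key, key, key]
  have := h u v w
  -- Once the derivatives of l and a are brought to a common order of arguments, the mixed terms
  -- cancel in pairs and only the cyclic sum of β is left.
  rw [hlc v u, hlc w u, hlc w v, hac v u, hac w u, hac w v]
  linarith

end LocalModel

/-! ### The sheared inverse of p ∧ q^*a + q^*θ as a local model. -/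

section Cylinder

variable {E : Type*} [NormedAddCommGroup E] [NormedSpace ℝ E]
  {V : Type*} [NormedAddCommGroup V] [NormedSpace ℝ V]

theorem pushSharp_pushSharp {E' E'' : Type*} [NormedAddCommGroup E'] [NormedSpace ℝ E']
    [NormedAddCommGroup E''] [NormedSpace ℝ E''] (T' : E' →L[ℝ] E'') (T : E →L[ℝ] E')
    (A : (E →L[ℝ] ℝ) →L[ℝ] E) :
    pushSharp T' (pushSharp T A) = pushSharp (T' ∘L T) A := rfl

/-- The form `p ∧ q^* a + q^* θ`. -/
def cylForm (p : E →L[ℝ] ℝ) (q : E →L[ℝ] V) (a : V →L[ℝ] ℝ) (θ : V [⋀^Fin 2]→L[ℝ] ℝ) :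
    E [⋀^Fin 2]→L[ℝ] ℝ :=
  wedgeCovectors p (a ∘L q) + θ.compContinuousLinearMap q

theorem cylForm_apply (p : E →L[ℝ] ℝ) (q : E →L[ℝ] V) (a : V →L[ℝ] ℝ) (θ : V [⋀^Fin 2]→L[ℝ] ℝ)
    (v w : E) : cylForm p q a θ ![v, w] = p v * a (q w) - p w * a (q v) + θ ![q v, q w] := by
  rw [cylForm, ContinuousAlternatingMap.add_apply, wedgeCovectors_apply,
    compContinuousLinearMap_pair]
  rfl

theorem flatForm_cylForm (p : E →L[ℝ] ℝ) (q : E →L[ℝ] V) (a : V →L[ℝ] ℝ)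
    (θ : V [⋀^Fin 2]→L[ℝ] ℝ) :
    flatForm (cylForm p q a θ) = p.smulRight (a ∘L q) - (a ∘L q).smulRight p
      + (flatForm θ).bilinearComp q q := by
  ext v w
  rw [flatForm_apply, cylForm_apply]
  simp
  ring

/-- The endomorphism `v ↦ v + ((G - 1) p v + μ (q v)) e₀`. -/
def shear (p : E →L[ℝ] ℝ) (q : E →L[ℝ] V) (e₀ : E) (G : ℝ) (μ : V →L[ℝ] ℝ) : E →L[ℝ] E :=
  ContinuousLinearMap.id ℝ E + ((G - 1) • p + μ ∘L q).smulRight e₀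

theorem shear_apply (p : E →L[ℝ] ℝ) (q : E →L[ℝ] V) (e₀ : E) (G : ℝ) (μ : V →L[ℝ] ℝ) (v : E) :
    shear p q e₀ G μ v = v + ((G - 1) * p v + μ (q v)) • e₀ := by
  simp [shear]

variable {p : E →L[ℝ] ℝ} {q : E →L[ℝ] V} {e₀ : E}

/-- The shear is a transvection along e₀ by a functional taking the value G - 1 at e₀, so its
determinant is 1 + (G - 1). The functional μ ∘ q does not contribute because q e₀ = 0. -/
theorem det_shear [FiniteDimensional ℝ E] (hp : p e₀ = 1) (hq : q e₀ = 0) (G : ℝ)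
    (μ : V →L[ℝ] ℝ) :
    LinearMap.det (shear p q e₀ G μ : E →ₗ[ℝ] E) = G := by
  have : (shear p q e₀ G μ : E →ₗ[ℝ] E)
      = LinearMap.transvection (((G - 1) • p + μ ∘L q : E →L[ℝ] ℝ) : E →ₗ[ℝ] ℝ) e₀ := rfl
  rw [this, LinearMap.transvection.det]
  simp [hp, hq]

theorem surjective_shear [FiniteDimensional ℝ E] (hp : p e₀ = 1) (hq : q e₀ = 0) {G : ℝ}
    (hG : G ≠ 0) (μ : V →L[ℝ] ℝ) : Surjective (shear p q e₀ G μ) := by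
  have h : IsUnit (LinearMap.det (shear p q e₀ G μ : E →ₗ[ℝ] E)) := by
    rw [det_shear hp hq]; exact hG.isUnit
  exact (LinearMap.equivOfDetNeZero _ h.ne_zero).surjective

variable [FiniteDimensional ℝ E]

theorem contDiffAt_of_clm_apply {X F : Type*} [NormedAddCommGroup X] [NormedSpace ℝ X]
    [NormedAddCommGroup F] [NormedSpace ℝ F] {β : X → E →L[ℝ] F} {x : X} {k : WithTop ℕ∞}
    (h : ∀ v, ContDiffAt ℝ k (fun z => β z v) x) : ContDiffAt ℝ k β x := by
  let b := Module.finBasis ℝ E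
  have e : β = fun z => ∑ i, (dualCoord E i).smulRight (β z (b i)) := by
    ext z v
    conv_lhs => rw [← sum_dualCoord_smul v, map_sum]
    simp [b]
  rw [e]
  exact ContDiffAt.sum fun i _ =>
    (ContinuousLinearMap.smulRightL ℝ E F (dualCoord E i)).contDiff.contDiffAt.comp x (h (b i))

theorem contDiffAt_flatForm_cylForm {y : E} {k : WithTop ℕ∞} {a : V → V →L[ℝ] ℝ}
    {θ : V → V [⋀^Fin 2]→L[ℝ] ℝ} {l : E → E →L[ℝ] ℝ} (hl : ContDiffAt ℝ k l y)
    (ha : ContDiffAt ℝ k a (q y)) (hθ : ContDiffAt ℝ k θ (q y)) :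
    ContDiffAt ℝ k (fun z => flatForm (cylForm (l z) q (a (q z)) (θ (q z)))) y := by
  have h1 : ContDiffAt ℝ k (fun z => a (q z)) y := ha.comp y q.contDiff.contDiffAt
  have h2 : ContDiffAt ℝ k (fun z => flatForm (θ (q z))) y :=
    contDiff_flatForm.contDiffAt.comp y (hθ.comp y q.contDiff.contDiffAt)
  refine contDiffAt_of_clm_apply fun v => contDiffAt_of_clm_apply fun w => ?_
  simp only [flatForm_apply, cylForm_apply]
  simp only [← flatForm_apply]
  exact (((hl.clm_apply contDiffAt_const).mul (h1.clm_apply contDiffAt_const)).sub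
    ((hl.clm_apply contDiffAt_const).mul (h1.clm_apply contDiffAt_const))).add
    ((h2.clm_apply contDiffAt_const).clm_apply contDiffAt_const)

/-- The degenerate field obtained from a cylindrical form and a shear is a local model. -/
theorem isLocalBSymplectic_cylinder {n : ℕ} (hn : Module.finrank ℝ E = 2 * n)
    (hp : p e₀ = 1) (hq : q e₀ = 0) {s : Set E} (hs : IsOpen s) {t : Set V} (ht : IsOpen t)
    (hst : MapsTo q s t) {a : V → V →L[ℝ] ℝ} (ha : ContDiffOn ℝ ∞ a t)
    (hac : ∀ x ∈ t, ∀ u v, fderiv ℝ a x u v = fderiv ℝ a x v u)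
    {θ : V → V [⋀^Fin 2]→L[ℝ] ℝ} (hθ : ContDiffOn ℝ ∞ θ t) (hθc : ∀ x ∈ t, extDeriv θ x = 0)
    (hnd : ∀ y ∈ s, FormNondeg (cylForm p q (a (q y)) (θ (q y))))
    {G F : E → ℝ} {μ : E → V →L[ℝ] ℝ} (hG : ContDiffOn ℝ ∞ G s) (hμ : ContDiffOn ℝ ∞ μ s)
    (hF : ∀ y ∈ s, p y ≠ 0 → ContDiffAt ℝ ∞ F y)
    (hFG : ∀ y ∈ s, p y ≠ 0 → ∀ v, fderiv ℝ F y (shear p q e₀ (G y) (μ y) v) = p v)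
    (hG0 : ∀ y ∈ s, G y = 0 → p y = 0) (hG' : ∀ y ∈ s, p y = 0 → fderiv ℝ G y e₀ ≠ 0) :
    IsLocalBSymplectic n (fun y => pushSharp (shear p q e₀ (G y) (μ y))
      (sharpForm (cylForm p q (a (q y)) (θ (q y))))) s := by
  have haAt : ∀ {y}, y ∈ s → ContDiffAt ℝ ∞ a (q y) := fun hy =>
    ha.contDiffAt (ht.mem_nhds (hst hy))
  have hθAt : ∀ {y}, y ∈ s → ContDiffAt ℝ ∞ θ (q y) := fun hy =>
    hθ.contDiffAt (ht.mem_nhds (hst hy))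
  set A₁ : E → (E →L[ℝ] ℝ) →L[ℝ] E := fun y => sharpForm (cylForm p q (a (q y)) (θ (q y))) with hA₁
  have hA₁s : ContDiffOn ℝ ∞ A₁ s := fun y hy =>
    (contDiffAt_sharpForm (contDiffAt_flatForm_cylForm (l := fun _ => p) contDiffAt_const
      (haAt hy) (hθAt hy)) (hnd y hy)).contDiffWithinAt
  have hB : ContDiffOn ℝ ∞ (fun y => shear p q e₀ (G y) (μ y)) s := by
    rw [contDiffOn_clm_apply]
    intro v
    simp only [shear_apply]
    exact contDiffOn_const.add ((((hG.sub contDiffOn_const).mul contDiffOn_const).add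
      (hμ.clm_apply contDiffOn_const)).smul contDiffOn_const)
  have hA : ContDiffOn ℝ ∞ (fun y => pushSharp (shear p q e₀ (G y) (μ y)) (A₁ y)) s := by
    rw [contDiffOn_clm_apply]
    intro ξ
    simp only [pushSharp_apply]
    exact hB.clm_apply (hA₁s.clm_apply (contDiffOn_const.clm_comp hB))
  have hskew : ∀ y ∈ s, IsSkewSharp (pushSharp (shear p q e₀ (G y) (μ y)) (A₁ y)) := fun y hy =>
    (hnd y hy).isSkewSharp.pushSharp _
  -- The shear acts on top degree by its determinant G, so the power is G times a power that
  -- vanishes nowhere on s.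
  have hpow : ∀ y (l : ⋀[ℝ]^(2 * n) E →ₗ[ℝ] ℝ),
      l (bivectorPow (bivector (pushSharp (shear p q e₀ (G y) (μ y)) (A₁ y))) n)
        = G y * l (bivectorPow (bivector (A₁ y)) n) := by
    intro y l
    rw [← map_bivector, ← map_bivectorPow, map_top_eq_det_smul hn, det_shear hp hq, map_smul,
      smul_eq_mul]
  have hc : ∀ y ∈ s, ∀ l : ⋀[ℝ]^(2 * n) E →ₗ[ℝ] ℝ, l ≠ 0 →
      l (bivectorPow (bivector (A₁ y)) n) ≠ 0 := fun y hy l hl =>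
    functional_bivectorPow_ne_zero (hnd y hy).isSkewSharp (hnd y hy).surjective_sharpForm hn hl
  refine ⟨hA, hskew, fun f g h hf hg hh y hy => ?_, fun y hy h0 l hl h => ?_⟩
  · refine localBracket_jacobi_of_dense hs hA (t := {y | p y ≠ 0}) ?_ hf hg hh ?_ y hy
    · intro z hz
      by_cases hpz : p z = 0
      -- Moving along e₀ leaves the hyperplane p = 0 at once, since p e₀ = 1; hence the points with
      -- p ≠ 0 are dense in s.
      · have hcont : Continuous fun r : ℝ => z + r • e₀ := by fun_prop
        have h0 : (fun r : ℝ => z + r • e₀) 0 = z := by simp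
        have hev : ∀ᶠ r in nhds (0 : ℝ), z + r • e₀ ∈ s :=
          hcont.continuousAt.eventually (by rw [h0]; exact hs.mem_nhds hz)
        have hlim : Filter.Tendsto (fun r : ℝ => z + r • e₀) (nhdsWithin 0 {0}ᶜ) (nhds z) := by
          have := hcont.tendsto 0
          simp only [zero_smul, add_zero] at this
          exact this.mono_left nhdsWithin_le_nhds
        refine mem_closure_of_tendsto hlim ?_
        filter_upwards [nhdsWithin_le_nhds hev, self_mem_nhdsWithin] with r hr hr0
        refine ⟨hr, ?_⟩
        simpa [hpz, hp] using hr0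
      · exact subset_closure ⟨hz, hpz⟩
    · rintro z ⟨hz, hpz⟩
      have hpz : p z ≠ 0 := hpz
      have hsz := hs.mem_nhds hz
      have hpn : ∀ᶠ w in nhds z, p w ≠ 0 := p.continuous.continuousAt.eventually_ne hpz
      have hFd : ContDiffAt ℝ ∞ (fderiv ℝ F) z := (hF z hz hpz).fderiv_right (by simp)
      -- Off the hyperplane the sheared field is the inverse of dF ∧ q^*a + q^*θ, which is smooth
      -- there.
      have hβ : ContDiffAt ℝ ∞ (fun w => flatForm (cylForm (fderiv ℝ F w) q (a (q w)) (θ (q w)))) z :=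
        contDiffAt_flatForm_cylForm hFd (haAt hz) (hθAt hz)
      refine localBracket_jacobi (β := fun w => flatForm (cylForm (fderiv ℝ F w) q (a (q w))
        (θ (q w)))) ((hA.contDiffAt hsz).differentiableAt (by simp))
        (hβ.differentiableAt (by simp)) (.of_forall fun w u v => ?_) ?_ ?_
        ((hf.contDiffAt hsz).of_le (by norm_cast))
        ((hg.contDiffAt hsz).of_le (by norm_cast))
        ((hh.contDiffAt hsz).of_le (by norm_cast))
      · rw [flatForm_apply, flatForm_apply, alternating_swap]
      · filter_upwards [hsz, hpn] with w hw hpw ξ v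
        -- With G ≠ 0 the shear is onto, so the test vector may be taken of the form B u. As dF ∘ B
        -- = p and q ∘ B = q, the form evaluated on B-images is p ∧ q^*a + q^*θ, which A₁ inverts.
        have hGw : G w ≠ 0 := fun h => hpw (hG0 w hw h)
        obtain ⟨u, rfl⟩ := surjective_shear hp hq hGw (μ w) v
        have hqs : ∀ v, q (shear p q e₀ (G w) (μ w) v) = q v := fun v => by
          simp [shear_apply, hq]
        rw [flatForm_apply, pushSharp_apply, cylForm_apply, hFG w hw hpw, hFG w hw hpw, hqs, hqs,
          ← cylForm_apply, (hnd w hw).apply_sharpForm]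
        rfl
      · simp only [flatForm_cylForm]
        have hal : DifferentiableAt ℝ (fun w => a (q w)) z :=
          DifferentiableAt.comp (g := a) (f := q) z ((haAt hz).differentiableAt (by simp))
            q.differentiableAt
        have hd : ∀ u v, fderiv ℝ (fun w => a (q w) ∘L q) z u v = fderiv ℝ a (q z) (q u) (q v) := by
          intro u v
          have e := (((haAt hz).differentiableAt (by simp)).hasFDerivAt.comp z
            q.hasFDerivAt).clm_comp (hasFDerivAt_const q z)
          have e2 : (fun w => a (q w) ∘L q) = fun w => (a ∘ q) w ∘L q := rfl
          rw [e2, e.fderiv]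
          simp
        have hθf : DifferentiableAt ℝ (fun x => flatForm (θ x)) (q z) :=
          (contDiff_flatForm.contDiffAt.comp (q z) (hθAt hz)).differentiableAt
            (n := ∞) (by simp)
        have hcl := CyclicClosedAt.comp_linear (y := z) q hθf
          (cyclicClosedAt_flatForm ((hθAt hz).differentiableAt (by simp)) (hθc _ (hst hz)))
        refine CyclicClosedAt.wedge_add (hFd.differentiableAt (by simp))
          (hal.clm_comp (differentiableAt_const _)) ?_ ?_ ?_ hcl
        · have : (fun w => (flatForm (θ (q w))).bilinearComp q q) = fun w =>
            ((ContinuousLinearMap.compL ℝ E V ℝ).flip q) ∘L ((flatForm (θ (q w))) ∘L q) := rfl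
          rw [this]
          have hd1 : DifferentiableAt ℝ (fun w => flatForm (θ (q w))) z :=
            DifferentiableAt.comp (g := fun x => flatForm (θ x)) (f := q) z hθf q.differentiableAt
          exact (differentiableAt_const _).clm_comp (hd1.clm_comp (differentiableAt_const _))
        · exact fun u v => (hF z hz hpz).isSymmSndFDerivAt
            (by rw [minSmoothness_of_isRCLikeNormedField]; norm_cast) u v
        · intro u v
          rw [hd, hd, hac _ (hst hz)]
  · have hGy : G y = 0 := by
      have := hpow y l
      rw [h0, map_zero] at this
      exact (mul_eq_zero.1 this.symm).resolve_right (hc y hy l hl)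
    have hsy := hs.mem_nhds hy
    have hcd : ContDiffAt ℝ ∞ (fun y => l (bivectorPow (bivector (A₁ y)) n)) y :=
      (contDiffOn_functional_bivectorPow hA₁s n l).contDiffAt hsy
    have hGd := ((hG.contDiffAt hsy).differentiableAt (by simp)).hasFDerivAt
    have := (hGd.mul (hcd.differentiableAt (by simp)).hasFDerivAt).fderiv
    have e1 : (fun z => l (bivectorPow (bivector (pushSharp (shear p q e₀ (G z) (μ z)) (A₁ z))) n))
      = fun z => G z * l (bivectorPow (bivector (A₁ z)) n) := funext fun z => hpow z l
    have e : (fun z => G z * l (bivectorPow (bivector (A₁ z)) n))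
      = G * fun z => l (bivectorPow (bivector (A₁ z)) n) := rfl
    rw [show fderiv ℝ _ y = fderiv ℝ _ y from congrArg (fderiv ℝ · y) (e1.trans e), this] at h
    -- At a zero of G the product rule leaves only dG times the nonvanishing factor. Testing it on
    -- e₀ contradicts `hG'`.
    have h' := DFunLike.congr_fun h e₀
    simp [hGy] at h'
    rcases h' with h' | h'
    · exact hc y hy l hl h'
    · exact hG' y hy (hG0 y hy hGy) h'

end Cylinder

/-! ### The explicit profile F(τ, r) between log|τ| - log r and |τ|. -/

section LogProfile

/-- A cutoff in the ratio of the two coordinates: it is `0` near the axis `z.1 = 0` and `1` where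
`z.2 ≤ |z.1|`. -/
def ratioCutoff (z : ℝ × ℝ) : ℝ := Real.smoothTransition (2 * (z.1 / z.2) ^ 2 - 1)

/-- The logarithmic derivative of `ratioCutoff` in the first coordinate. -/
def ratioCutoffDeriv (z : ℝ × ℝ) : ℝ :=
  4 * (z.1 / z.2) ^ 2 * deriv Real.smoothTransition (2 * (z.1 / z.2) ^ 2 - 1)

/-- A function interpolating between `log |τ| - log r` near `τ = 0` and `|τ|` for `r ≤ |τ|`. -/
def logProfile (z : ℝ × ℝ) : ℝ :=
  |z.1| * ratioCutoff z + (1 - ratioCutoff z) * (Real.log z.1 - Real.log z.2)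

/-- The function `τ ∂_τ F` for `F = logProfile`. -/
def logProfileEuler (z : ℝ × ℝ) : ℝ :=
  |z.1| * ratioCutoff z + (1 - ratioCutoff z)
    + ratioCutoffDeriv z * (|z.1| - (Real.log z.1 - Real.log z.2))

/-- The function `1 / ∂_τ F` for `F = logProfile`, extended by `0`. -/
def logProfileG (z : ℝ × ℝ) : ℝ := z.1 / logProfileEuler z

/-- The function `-∂_r F / ∂_τ F` for `F = logProfile`, extended by `0`. -/
def logProfileB (z : ℝ × ℝ) : ℝ := z.1 / z.2 * (1 - |z.1| * ratioCutoff z / logProfileEuler z)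

variable {z : ℝ × ℝ}

theorem contDiffAt_ratio (hz : 0 < z.2) : ContDiffAt ℝ ∞ (fun z : ℝ × ℝ => z.1 / z.2) z :=
  contDiffAt_fst.div contDiffAt_snd hz.ne'

theorem contDiffAt_ratioCutoff (hz : 0 < z.2) : ContDiffAt ℝ ∞ ratioCutoff z :=
  Real.smoothTransition.contDiff.contDiffAt.comp z
    ((contDiffAt_const.mul ((contDiffAt_ratio hz).pow 2)).sub contDiffAt_const)

theorem contDiff_deriv_smoothTransition : ContDiff ℝ ∞ (deriv Real.smoothTransition) :=
  (contDiff_infty_iff_deriv.1 Real.smoothTransition.contDiff).2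

theorem contDiffAt_ratioCutoffDeriv (hz : 0 < z.2) : ContDiffAt ℝ ∞ ratioCutoffDeriv z :=
  (contDiffAt_const.mul ((contDiffAt_ratio hz).pow 2)).mul
    (contDiff_deriv_smoothTransition.contDiffAt.comp z
      ((contDiffAt_const.mul ((contDiffAt_ratio hz).pow 2)).sub contDiffAt_const))

theorem ratioCutoff_eq_zero_of_lt (hz : 2 * (z.1 / z.2) ^ 2 < 1) : ratioCutoff z = 0 :=
  Real.smoothTransition.zero_of_nonpos (by linarith)

theorem deriv_smoothTransition_of_neg {x : ℝ} (hx : x < 0) : deriv Real.smoothTransition x = 0 := by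
  have : Real.smoothTransition =ᶠ[nhds x] fun _ => 0 := by
    filter_upwards [Iio_mem_nhds hx] with y hy
    exact Real.smoothTransition.zero_of_nonpos (le_of_lt hy)
  rw [this.deriv_eq, deriv_const]

theorem deriv_smoothTransition_of_one_lt {x : ℝ} (hx : 1 < x) :
    deriv Real.smoothTransition x = 0 := by
  have : Real.smoothTransition =ᶠ[nhds x] fun _ => 1 := by
    filter_upwards [Ioi_mem_nhds hx] with y hy
    exact Real.smoothTransition.one_of_one_le (le_of_lt hy)
  rw [this.deriv_eq, deriv_const]

theorem one_lt_ratio_sq (hz : 0 < z.2) (h : z.2 < |z.1|) : 1 < (z.1 / z.2) ^ 2 := by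
  rw [← sq_abs, abs_div, abs_of_pos hz]
  have : 1 < |z.1| / z.2 := (one_lt_div hz).2 h
  nlinarith

theorem ratioCutoff_eq_one (hz : 0 < z.2) (h : z.2 < |z.1|) : ratioCutoff z = 1 :=
  Real.smoothTransition.one_of_one_le (by linarith [one_lt_ratio_sq hz h])

theorem ratioCutoffDeriv_eq_zero (hz : 0 < z.2) (h : z.2 < |z.1|) : ratioCutoffDeriv z = 0 := by
  rw [ratioCutoffDeriv, deriv_smoothTransition_of_one_lt (by linarith [one_lt_ratio_sq hz h]),
    mul_zero]

theorem ratioCutoffDeriv_nonneg : 0 ≤ ratioCutoffDeriv z :=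
  mul_nonneg (by positivity) Real.smoothTransition.monotone.deriv_nonneg

theorem logProfileEuler_of_lt (hz : 0 < z.2) (h : z.2 < |z.1|) : logProfileEuler z = |z.1| := by
  rw [logProfileEuler, ratioCutoff_eq_one hz h, ratioCutoffDeriv_eq_zero hz h]
  ring

theorem logProfileEuler_eq_one (h : 2 * (z.1 / z.2) ^ 2 < 1) : logProfileEuler z = 1 := by
  rw [logProfileEuler, ratioCutoff_eq_zero_of_lt h, ratioCutoffDeriv,
    deriv_smoothTransition_of_neg (by linarith)]
  ring

theorem eventually_ratio_lt (hz : 0 < z.2) (h : z.1 = 0) :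
    ∀ᶠ w : ℝ × ℝ in nhds z, 2 * (w.1 / w.2) ^ 2 < 1 := by
  have hc : ContinuousAt (fun w : ℝ × ℝ => 2 * (w.1 / w.2) ^ 2) z :=
    (contDiffAt_const.mul ((contDiffAt_ratio hz).pow 2)).continuousAt
  exact hc.eventually_lt continuousAt_const (by simp [h])

/-- For 0 < |τ| ≤ r one has log|τ| - log r ≤ 0 < |τ|, so the term carrying the derivative of the
cutoff is nonnegative. The rest is a convex combination of |τ| and 1. Normalising the logarithm by
log r is what places it below |τ| throughout the transition region. -/
theorem logProfileEuler_pos (hz : 0 < z.2) : 0 < logProfileEuler z := by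
  by_cases h0 : z.1 = 0
  · rw [logProfileEuler_eq_one (eventually_ratio_lt hz h0).self_of_nhds]
    exact one_pos
  rcases lt_or_ge z.2 |z.1| with h | h
  · rw [logProfileEuler_of_lt hz h]
    exact abs_pos.2 h0
  · have hlog : Real.log z.1 ≤ Real.log z.2 := by
      rw [← Real.log_abs]
      exact Real.log_le_log (abs_pos.2 h0) h
    have h1 : 0 ≤ ratioCutoffDeriv z * (|z.1| - (Real.log z.1 - Real.log z.2)) :=
      mul_nonneg ratioCutoffDeriv_nonneg (by linarith [abs_nonneg z.1])
    have h2 : 0 ≤ ratioCutoff z := Real.smoothTransition.nonneg _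
    have h3 : ratioCutoff z ≤ 1 := Real.smoothTransition.le_one _
    have h4 : 0 < |z.1| := abs_pos.2 h0
    rw [logProfileEuler]
    rcases h2.eq_or_lt with h5 | h5
    · rw [← h5]; linarith
    · nlinarith

theorem contDiffAt_log_sub (hz : 0 < z.2) (h : z.1 ≠ 0) :
    ContDiffAt ℝ ∞ (fun z : ℝ × ℝ => Real.log z.1 - Real.log z.2) z :=
  (contDiffAt_fst.log h).sub (contDiffAt_snd.log hz.ne')

theorem contDiffAt_abs_fst (h : z.1 ≠ 0) : ContDiffAt ℝ ∞ (fun z : ℝ × ℝ => |z.1|) z :=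
  (contDiffAt_abs h).comp z contDiffAt_fst

theorem contDiffAt_logProfile (hz : 0 < z.2) (h : z.1 ≠ 0) : ContDiffAt ℝ ∞ logProfile z :=
  ((contDiffAt_abs_fst h).mul (contDiffAt_ratioCutoff hz)).add
    ((contDiffAt_const.sub (contDiffAt_ratioCutoff hz)).mul (contDiffAt_log_sub hz h))

/-- The singularity of |τ| at τ = 0 is harmless because the cutoff vanishes on a neighbourhood of
that axis. -/
theorem contDiffAt_abs_mul_ratioCutoff (hz : 0 < z.2) :
    ContDiffAt ℝ ∞ (fun z => |z.1| * ratioCutoff z) z := by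
  by_cases h : z.1 = 0
  · refine (contDiffAt_const (c := (0 : ℝ))).congr_of_eventuallyEq ?_
    filter_upwards [eventually_ratio_lt hz h] with w hw
    rw [ratioCutoff_eq_zero_of_lt hw, mul_zero]
  · exact (contDiffAt_abs_fst h).mul (contDiffAt_ratioCutoff hz)

theorem contDiffAt_logProfileEuler (hz : 0 < z.2) : ContDiffAt ℝ ∞ logProfileEuler z := by
  by_cases h : z.1 = 0
  · refine (contDiffAt_const (c := (1 : ℝ))).congr_of_eventuallyEq ?_
    filter_upwards [eventually_ratio_lt hz h] with w hw
    exact logProfileEuler_eq_one hw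
  · exact ((contDiffAt_abs_mul_ratioCutoff hz).add (contDiffAt_const.sub
      (contDiffAt_ratioCutoff hz))).add ((contDiffAt_ratioCutoffDeriv hz).mul
        ((contDiffAt_abs_fst h).sub (contDiffAt_log_sub hz h)))

theorem contDiffAt_logProfileG (hz : 0 < z.2) : ContDiffAt ℝ ∞ logProfileG z :=
  contDiffAt_fst.div (contDiffAt_logProfileEuler hz) (logProfileEuler_pos hz).ne'

theorem contDiffAt_logProfileB (hz : 0 < z.2) : ContDiffAt ℝ ∞ logProfileB z :=
  (contDiffAt_ratio hz).mul (contDiffAt_const.sub ((contDiffAt_abs_mul_ratioCutoff hz).div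
    (contDiffAt_logProfileEuler hz) (logProfileEuler_pos hz).ne'))

theorem logProfileG_eq_zero_iff (hz : 0 < z.2) : logProfileG z = 0 ↔ z.1 = 0 := by
  rw [logProfileG, div_eq_zero_iff]
  simp [(logProfileEuler_pos hz).ne']

theorem logProfileG_of_lt (hz : 0 < z.2) (h : z.2 < |z.1|) : logProfileG z = z.1 / |z.1| := by
  rw [logProfileG, logProfileEuler_of_lt hz h]

theorem logProfileB_of_lt (hz : 0 < z.2) (h : z.2 < |z.1|) : logProfileB z = 0 := by
  rw [logProfileB, logProfileEuler_of_lt hz h, ratioCutoff_eq_one hz h, mul_one,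
    div_self (hz.trans h).ne', sub_self, mul_zero]

theorem fderiv_logProfileG (hz : 0 < z.2) (h : z.1 = 0) : fderiv ℝ logProfileG z = .fst ℝ ℝ ℝ := by
  have : logProfileG =ᶠ[nhds z] Prod.fst := by
    filter_upwards [eventually_ratio_lt hz h] with w hw
    rw [logProfileG, logProfileEuler_eq_one hw, div_one]
  rw [this.fderiv_eq, fderiv_fst]

/-- The vector (G a + B c, c) is chosen with G = 1/∂_τF and B = -∂_rF/∂_τF, so that the two
contributions of c cancel. The derivative is computed along the straight line in this direction. -/
theorem fderiv_logProfile (hz : 0 < z.2) (h : z.1 ≠ 0) (a c : ℝ) :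
    fderiv ℝ logProfile z (logProfileG z * a + logProfileB z * c, c) = a := by
  set x := logProfileG z * a + logProfileB z * c with hx
  have hγ : HasDerivAt (fun t : ℝ => ((z.1 + t * x, z.2 + t * c) : ℝ × ℝ)) (x, c) 0 := by
    have h1 : HasDerivAt (fun t : ℝ => z.1 + t * x) x 0 := by
      simpa using ((hasDerivAt_id (0 : ℝ)).mul_const x).const_add z.1
    have h2 : HasDerivAt (fun t : ℝ => z.2 + t * c) c 0 := by
      simpa using ((hasDerivAt_id (0 : ℝ)).mul_const c).const_add z.2
    exact h1.prodMk h2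
  have hF : HasFDerivAt logProfile (fderiv ℝ logProfile z) (z.1 + 0 * x, z.2 + 0 * c) := by
    simpa using ((contDiffAt_logProfile hz h).differentiableAt (by simp)).hasFDerivAt
  have hd := hF.comp_hasDerivAt (0 : ℝ) hγ
  have h1 : HasDerivAt (fun t : ℝ => z.1 + t * x) x 0 := by
    simpa using ((hasDerivAt_id (0 : ℝ)).mul_const x).const_add z.1
  have h2 : HasDerivAt (fun t : ℝ => z.2 + t * c) c 0 := by
    simpa using ((hasDerivAt_id (0 : ℝ)).mul_const c).const_add z.2
  have habs : HasDerivAt (fun t : ℝ => |z.1 + t * x|) (|z.1| / z.1 * x) 0 := by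
    have h3 : HasDerivAt (fun y : ℝ => |y|) (SignType.sign z.1 : ℝ) (z.1 + 0 * x) := by
      simpa using hasDerivAt_abs h
    have h4 := h3.comp (0 : ℝ) h1
    have e : (SignType.sign z.1 : ℝ) = |z.1| / z.1 := by
      rw [eq_div_iff h, sign_mul_self]
    rwa [e] at h4
  have hl1 : HasDerivAt (fun t : ℝ => Real.log (z.1 + t * x)) (x / z.1) 0 := by
    simpa using h1.log (by simpa using h)
  have hl2 : HasDerivAt (fun t : ℝ => Real.log (z.2 + t * c)) (c / z.2) 0 := by
    simpa using h2.log (by simpa using hz.ne')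
  have hq : HasDerivAt (fun t : ℝ => 2 * ((z.1 + t * x) / (z.2 + t * c)) ^ 2 - 1)
      (2 * (2 * (z.1 / z.2) * ((x * z.2 - z.1 * c) / z.2 ^ 2))) 0 := by
    have := (((h1.div h2 (by simpa using hz.ne')).pow 2).const_mul 2).sub_const 1
    simpa using this
  have hS : HasDerivAt (fun t : ℝ => ratioCutoff (z.1 + t * x, z.2 + t * c))
      (ratioCutoffDeriv z * (x / z.1 - c / z.2)) 0 := by
    have h3 : HasDerivAt Real.smoothTransition (deriv Real.smoothTransition
        (2 * (z.1 / z.2) ^ 2 - 1)) (2 * ((z.1 + 0 * x) / (z.2 + 0 * c)) ^ 2 - 1) := by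
      simpa using ((Real.smoothTransition.contDiff (n := 1)).differentiable
        (by norm_num) (2 * (z.1 / z.2) ^ 2 - 1)).hasDerivAt
    have h4 := h3.comp (0 : ℝ) hq
    have e : deriv Real.smoothTransition (2 * (z.1 / z.2) ^ 2 - 1)
        * (2 * (2 * (z.1 / z.2) * ((x * z.2 - z.1 * c) / z.2 ^ 2)))
        = ratioCutoffDeriv z * (x / z.1 - c / z.2) := by
      rw [ratioCutoffDeriv]
      have := hz.ne'
      field_simp
      ring
    rw [e] at h4
    exact h4
  have hd2 := (habs.mul hS).add (((hasDerivAt_const (0 : ℝ) (1 : ℝ)).sub hS).mul (hl1.sub hl2))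
  have hval := hd.unique hd2
  rw [hval]
  have hE := (logProfileEuler_pos hz).ne'
  have hz' := hz.ne'
  simp only [zero_mul, add_zero, Pi.sub_apply]
  have hEd : logProfileEuler z = |z.1| * ratioCutoff z + (1 - ratioCutoff z)
    + ratioCutoffDeriv z * (|z.1| - (Real.log z.1 - Real.log z.2)) := rfl
  -- Since the cutoff depends only on τ/r, one has τ ∂_τF = E and r ∂_rF = -(E - |τ|S), where E is
  -- `logProfileEuler` and S the cutoff. The derivative along (x, c) is thus (x/τ) E - (c/r)(E -
  -- |τ|S), and this identity evaluates its first term.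
  have hxE : x / z.1 * logProfileEuler z
      = a + c / z.2 * (logProfileEuler z - |z.1| * ratioCutoff z) := by
    rw [hx, logProfileG, logProfileB]
    field_simp
  have : ∀ s : ℝ, s = x / z.1 * logProfileEuler z
      - c / z.2 * (logProfileEuler z - |z.1| * ratioCutoff z) → s = a := fun s hs => by
    rw [hs, hxE]; ring
  apply this
  rw [hEd]
  field_simp
  ring

end LogProfile

/-! ### Topology of the glued space and of its two-sided collar. -/

section GluingTopology

variable {N A B X : Type*} [TopologicalSpace N] [TopologicalSpace A] [TopologicalSpace B]
  [TopologicalSpace X]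

theorem secondCountableTopology_image {Y Z : Type*} [TopologicalSpace Y] [TopologicalSpace Z]
    [SecondCountableTopology Y] {f : Y → Z} {s : Set Y} (h1 : ContinuousOn f s) (h2 : InjOn f s)
    (h3 : IsOpen s) (h4 : ∀ V ⊆ s, IsOpen V → IsOpen (f '' V)) :
    SecondCountableTopology (f '' s) := by
  have he : Topology.IsOpenEmbedding (s.domRestrict f) := by
    refine .of_continuous_injective_isOpenMap h1.domRestrict h2.injective fun V hV => ?_
    have : s.domRestrict f '' V = f '' ((↑) '' V) := by rw [image_image]; rfl
    rw [this]
    exact h4 _ (by rintro _ ⟨v, -, rfl⟩; exact v.2) (h3.isOpenMap_subtype_val _ hV)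
  have : SecondCountableTopology (range (s.domRestrict f)) :=
    he.toHomeomorph.symm.isEmbedding.secondCountableTopology
  rwa [range_domRestrict] at this

/-- `X` is the space obtained from `A` and `B` by identifying `bA x` with `bB x`. -/
structure IsGluing (jA : A → X) (jB : B → X) (bA : N → A) (bB : N → B) : Prop where
  isOpen_iff : ∀ U : Set X, IsOpen U ↔ IsOpen (jA ⁻¹' U) ∧ IsOpen (jB ⁻¹' U)
  left_injective : Injective jA
  right_injective : Injective jB
  eq_iff : ∀ a b, jA a = jB b ↔ ∃ x, a = bA x ∧ b = bB x
  cover : ∀ z, (∃ a, jA a = z) ∨ ∃ b, jB b = z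

omit [TopologicalSpace N] in
theorem IsGluing.symm {jA : A → X} {jB : B → X} {bA : N → A} {bB : N → B}
    (G : IsGluing jA jB bA bB) : IsGluing jB jA bB bA where
  isOpen_iff U := (G.isOpen_iff U).trans and_comm
  left_injective := G.right_injective
  right_injective := G.left_injective
  eq_iff b a := by
    rw [eq_comm, G.eq_iff]
    exact exists_congr fun x => and_comm
  cover z := (G.cover z).symm

-- The quotient is by the equivalence relation generated by the gluing relation. To see that nothing
-- else is identified, the predicate "represents the class of a" is written on each summand and
-- checked to descend. It descends because the boundary parametrisations are injective.
omit [TopologicalSpace N] in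
theorem isGluing_glued {bA : N → A} {bB : N → B} (hA : Injective bA) (hB : Injective bB) :
    IsGluing (Glued.inl bA bB) (Glued.inr bA bB) bA bB where
  isOpen_iff U := by
    change IsOpen (Quot.mk (GlueRel bA bB) ⁻¹' U) ↔ _
    rw [isOpen_sum_iff]
    rfl
  left_injective a a' h := by
    let P : Glued bA bB → Prop := Quot.lift
      (Sum.elim (fun u => u = a) fun v => ∃ x, v = bB x ∧ bA x = a) (by
        rintro _ _ ⟨x⟩
        refine propext ⟨fun h => ⟨x, rfl, h⟩, ?_⟩
        rintro ⟨x', h1, h2⟩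
        rwa [hB h1])
    have : P (Glued.inl bA bB a') := by rw [← h]; exact (rfl : a = a)
    exact (this : a' = a).symm
  right_injective b b' h := by
    let P : Glued bA bB → Prop := Quot.lift
      (Sum.elim (fun u => ∃ x, u = bA x ∧ bB x = b) fun v => v = b) (by
        rintro _ _ ⟨x⟩
        refine propext ⟨?_, fun h => ⟨x, rfl, h⟩⟩
        rintro ⟨x', h1, h2⟩
        rwa [← hA h1] at h2)
    have : P (Glued.inr bA bB b') := by rw [← h]; exact (rfl : b = b)
    exact (this : b' = b).symm
  eq_iff a b := by
    constructor
    · intro h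
      let P : Glued bA bB → Prop := Quot.lift
        (Sum.elim (fun u => u = a) fun v => ∃ x, v = bB x ∧ bA x = a) (by
          rintro _ _ ⟨x⟩
          refine propext ⟨fun h => ⟨x, rfl, h⟩, ?_⟩
          rintro ⟨x', h1, h2⟩
          rwa [hB h1])
      have : P (Glued.inr bA bB b) := by rw [← h]; exact (rfl : a = a)
      obtain ⟨x, h1, h2⟩ := this
      exact ⟨x, h2.symm, h1⟩
    · rintro ⟨x, rfl, rfl⟩
      exact Quot.sound ⟨x⟩
  cover := by
    rintro ⟨a | b⟩
    · exact .inl ⟨a, rfl⟩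
    · exact .inr ⟨b, rfl⟩

/-- `c` is a homeomorphism of `[0, 2) × N` onto an open subset of `A`, with closed image of
`{0} × N`. -/
structure IsTopCollar (c : PartialEquiv (ℝ × N) A) : Prop where
  source_eq : c.source = Ico (0 : ℝ) 2 ×ˢ univ
  isOpen_target : IsOpen c.target
  continuousOn : ContinuousOn c c.source
  continuousOn_symm : ContinuousOn c.symm c.target
  isClosed_range : IsClosed (range fun x : N => c (0, x))

/-- Reflection of the first coordinate. -/
def reflectFst (p : ℝ × N) : ℝ × N := (-p.1, p.2)

omit [TopologicalSpace N] in
@[simp]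
theorem reflectFst_reflectFst (p : ℝ × N) : reflectFst (reflectFst p) = p := by simp [reflectFst]

theorem continuous_reflectFst : Continuous (reflectFst : ℝ × N → ℝ × N) :=
  (continuous_fst.neg).prodMk continuous_snd

namespace IsTopCollar

variable {c : PartialEquiv (ℝ × N) A} (hc : IsTopCollar c)
include hc

theorem mem_source {p : ℝ × N} : p ∈ c.source ↔ 0 ≤ p.1 ∧ p.1 < 2 := by
  rw [hc.source_eq]; simp

theorem zero_mem (x : N) : ((0 : ℝ), x) ∈ c.source := hc.mem_source.2 ⟨le_rfl, two_pos⟩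

theorem injective_zero : Injective fun x : N => c (0, x) := fun x y h =>
  congrArg Prod.snd (c.injOn (hc.zero_mem x) (hc.zero_mem y) h)

theorem symm_nonneg {a : A} (ha : a ∈ c.target) : 0 ≤ (c.symm a).1 :=
  (hc.mem_source.1 (c.map_target ha)).1

theorem symm_lt_two {a : A} (ha : a ∈ c.target) : (c.symm a).1 < 2 :=
  (hc.mem_source.1 (c.map_target ha)).2

theorem isOpen_target_inter {V : Set (ℝ × N)} (hV : IsOpen V) :
    IsOpen (c.target ∩ c.symm ⁻¹' V) :=
  hc.continuousOn_symm.isOpen_inter_preimage hc.isOpen_target hV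

end IsTopCollar

/-- The two-sided collar in a glued space. -/
def twoSided (jA : A → X) (jB : B → X) (cA : PartialEquiv (ℝ × N) A) (cB : PartialEquiv (ℝ × N) B)
    (p : ℝ × N) : X :=
  if 0 ≤ p.1 then jB (cB p) else jA (cA (reflectFst p))

namespace IsGluing

variable {jA : A → X} {jB : B → X} {cA : PartialEquiv (ℝ × N) A} {cB : PartialEquiv (ℝ × N) B}
  (G : IsGluing jA jB (fun x => cA (0, x)) (fun x => cB (0, x)))
  (hA : IsTopCollar cA) (hB : IsTopCollar cB)

section
include G

theorem twoSided_of_nonneg {p : ℝ × N} (hp : 0 ≤ p.1) : twoSided jA jB cA cB p = jB (cB p) :=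
  if_pos hp

theorem twoSided_of_nonpos {p : ℝ × N} (hp : p.1 ≤ 0) :
    twoSided jA jB cA cB p = jA (cA (reflectFst p)) := by
  rcases hp.eq_or_lt with h | h
  · rw [G.twoSided_of_nonneg h.ge, eq_comm, G.eq_iff]
    refine ⟨p.2, ?_, ?_⟩
    · simp [reflectFst, h]
    · rw [← h]
  · exact if_neg (not_le.2 h)

theorem twoSided_symm (p : ℝ × N) :
    twoSided jB jA cB cA p = twoSided jA jB cA cB (reflectFst p) := by
  rcases le_total 0 p.1 with h | h
  · rw [G.symm.twoSided_of_nonneg h, G.twoSided_of_nonpos (by simpa [reflectFst] using h),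
      reflectFst_reflectFst]
  · rw [G.symm.twoSided_of_nonpos h, G.twoSided_of_nonneg (by simpa [reflectFst] using h)]

theorem continuous_right : Continuous jB :=
  continuous_def.2 fun U hU => ((G.isOpen_iff U).1 hU).2

end

section
include G hA hB

/-- A point of B can equal a point of the collar of A only on the seam t = 0, so the negative half
contributes nothing new. Openness, injectivity and the overlap formulas for the two-sided collar all
come from this description and its mirror image. -/
theorem right_mem_image_iff {V : Set (ℝ × N)} (hV : V ⊆ Ioo (-2 : ℝ) 2 ×ˢ univ) (b : B) :
    jB b ∈ twoSided jA jB cA cB '' V ↔ b ∈ cB.target ∧ cB.symm b ∈ V := by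
  constructor
  · rintro ⟨p, hp, h⟩
    have hp2 := (hV hp).1
    rcases le_or_gt 0 p.1 with h0 | h0
    · rw [G.twoSided_of_nonneg h0] at h
      have hs : p ∈ cB.source := hB.mem_source.2 ⟨h0, hp2.2⟩
      rw [← G.right_injective h]
      exact ⟨cB.map_source hs, by rwa [cB.left_inv hs]⟩
    · rw [G.twoSided_of_nonpos h0.le, G.eq_iff] at h
      obtain ⟨x, h1, -⟩ := h
      have hs : reflectFst p ∈ cA.source :=
        hA.mem_source.2 ⟨by simpa [reflectFst] using h0.le, by simpa [reflectFst] using neg_lt.1 hp2.1⟩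
      have := congrArg Prod.fst (cA.injOn hs (hA.zero_mem x) h1)
      simp [reflectFst] at this
      exact absurd this h0.ne
  · rintro ⟨h1, h2⟩
    refine ⟨_, h2, ?_⟩
    rw [G.twoSided_of_nonneg (hB.symm_nonneg h1), cB.right_inv h1]

theorem left_mem_image_iff {V : Set (ℝ × N)} (hV : V ⊆ Ioo (-2 : ℝ) 2 ×ˢ univ) (a : A) :
    jA a ∈ twoSided jA jB cA cB '' V ↔ a ∈ cA.target ∧ reflectFst (cA.symm a) ∈ V := by
  have hV' : reflectFst ⁻¹' V ⊆ Ioo (-2 : ℝ) 2 ×ˢ univ := by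
    intro p hp
    have := (hV hp).1
    simp only [reflectFst, mem_Ioo] at this
    exact ⟨⟨by linarith, by linarith⟩, mem_univ _⟩
  rw [← mem_preimage (f := reflectFst), ← G.symm.right_mem_image_iff hB hA hV']
  have : twoSided jB jA cB cA = twoSided jA jB cA cB ∘ reflectFst := funext G.twoSided_symm
  rw [this, image_comp, image_preimage_eq _ fun p => ⟨reflectFst p, by simp⟩]

theorem isOpen_image_twoSided {V : Set (ℝ × N)} (hV : V ⊆ Ioo (-2 : ℝ) 2 ×ˢ univ)
    (hVo : IsOpen V) : IsOpen (twoSided jA jB cA cB '' V) := by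
  rw [G.isOpen_iff]
  constructor
  · have : jA ⁻¹' (twoSided jA jB cA cB '' V) = cA.target ∩ cA.symm ⁻¹' (reflectFst ⁻¹' V) :=
      Set.ext fun a => G.left_mem_image_iff hA hB hV a
    rw [this]
    exact hA.isOpen_target_inter (hVo.preimage continuous_reflectFst)
  · have : jB ⁻¹' (twoSided jA jB cA cB '' V) = cB.target ∩ cB.symm ⁻¹' V :=
      Set.ext fun a => G.right_mem_image_iff hA hB hV a
    rw [this]
    exact hB.isOpen_target_inter hVo

theorem injOn_twoSided : InjOn (twoSided jA jB cA cB) (Ioo (-2 : ℝ) 2 ×ˢ univ) := by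
  intro p hp p' hp' h
  -- Injectivity is the description of images applied to the one-point set {p}.
  have hs : ({p} : Set (ℝ × N)) ⊆ Ioo (-2 : ℝ) 2 ×ˢ univ := singleton_subset_iff.2 hp
  have hmem : twoSided jA jB cA cB p' ∈ twoSided jA jB cA cB '' {p} := ⟨p, rfl, h⟩
  rcases le_total 0 p'.1 with h0 | h0
  · rw [G.twoSided_of_nonneg h0, G.right_mem_image_iff hA hB hs,
      cB.left_inv (hB.mem_source.2 ⟨h0, hp'.1.2⟩)] at hmem
    exact hmem.2.symm
  · rw [G.twoSided_of_nonpos h0, G.left_mem_image_iff hA hB hs, cA.left_inv (hA.mem_source.2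
      ⟨by simpa [reflectFst] using h0, by simpa [reflectFst] using neg_lt.1 hp'.1.1⟩),
      reflectFst_reflectFst] at hmem
    exact hmem.2.symm

/-- Both defining formulas hold at t = 0, so continuity can be pasted from the closed halves t ≥ 0
and t ≤ 0. -/
theorem continuousOn_twoSided : ContinuousOn (twoSided jA jB cA cB) (Ioo (-2 : ℝ) 2 ×ˢ univ) := by
  have h1 : ContinuousOn (twoSided jA jB cA cB) (Ioo (-2 : ℝ) 2 ×ˢ univ ∩ {p | 0 ≤ p.1}) := by
    refine (G.continuous_right.comp_continuousOn (hB.continuousOn.mono fun p hp =>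
      hB.mem_source.2 ⟨hp.2, hp.1.1.2⟩)).congr fun p hp => G.twoSided_of_nonneg hp.2
  have h2 : ContinuousOn (twoSided jA jB cA cB) (Ioo (-2 : ℝ) 2 ×ˢ univ ∩ {p | p.1 ≤ 0}) := by
    refine (G.symm.continuous_right.comp_continuousOn (hA.continuousOn.comp
      continuous_reflectFst.continuousOn fun p hp =>
      hA.mem_source.2 ⟨?_, ?_⟩)).congr fun p hp => G.twoSided_of_nonpos hp.2
    · simpa [reflectFst] using hp.2
    · simpa [reflectFst] using neg_lt.1 hp.1.1.1
  intro p hp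
  have hu : Ioo (-2 : ℝ) 2 ×ˢ (univ : Set N) = (Ioo (-2 : ℝ) 2 ×ˢ univ ∩ {p | 0 ≤ p.1})
      ∪ (Ioo (-2 : ℝ) 2 ×ˢ univ ∩ {p | p.1 ≤ 0}) := by
    rw [← inter_union_distrib_left, eq_comm, inter_eq_left]
    exact fun p _ => le_total 0 p.1
  have key : ∀ {S : Set (ℝ × N)}, IsClosed S →
      ContinuousOn (twoSided jA jB cA cB) (Ioo (-2 : ℝ) 2 ×ˢ univ ∩ S) →
      ContinuousWithinAt (twoSided jA jB cA cB) (Ioo (-2 : ℝ) 2 ×ˢ univ ∩ S) p := by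
    intro S hS hcS
    by_cases hpS : p ∈ S
    · exact hcS p ⟨hp, hpS⟩
    · exact continuousWithinAt_of_notMem_closure fun h =>
        hpS (hS.closure_subset_iff.2 inter_subset_right h)
  rw [hu]
  exact (key (isClosed_le continuous_const continuous_fst) h1).union
    (key (isClosed_le continuous_fst continuous_const) h2)

end

section
include G

theorem isOpen_image_right {V : Set B} (hV : V ⊆ (range fun x => cB (0, x))ᶜ)
    (hVo : IsOpen V) : IsOpen (jB '' V) := by
  rw [G.isOpen_iff, preimage_image_eq _ G.right_injective]
  refine ⟨?_, hVo⟩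
  have : jA ⁻¹' (jB '' V) = ∅ := by
    rw [eq_empty_iff_forall_notMem]
    rintro a ⟨b, hb, h⟩
    obtain ⟨x, -, rfl⟩ := (G.eq_iff a b).1 h.symm
    exact hV hb ⟨x, rfl⟩
  rw [this]
  exact isOpen_empty

end

section
include G hA hB

/-- Distinct points of one side can be separated in the glued space. -/
theorem separated_right [T2Space B] {b b' : B} (h : b ≠ b') :
    ∃ U U' : Set X, IsOpen U ∧ IsOpen U' ∧ jB b ∈ U ∧ jB b' ∈ U' ∧ Disjoint U U' := by
  obtain ⟨U, U', hU, hU', hb, hb', hd⟩ := t2_separation h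
  -- An open set of B is thickened into A by retracting the collar of A onto the seam. Disjoint sets
  -- stay disjoint, and the thickening is open in the glued space.
  let ext : Set B → Set X := fun U => jB '' U ∪
    jA '' {a | a ∈ cA.target ∧ cB (0, (cA.symm a).2) ∈ U}
  have hBpre : ∀ U, jB ⁻¹' ext U = U := by
    intro U
    ext u
    constructor
    · rintro (⟨v, hv, h⟩ | ⟨a, ha, h⟩)
      · rwa [← G.right_injective h]
      · obtain ⟨x, rfl, rfl⟩ := (G.eq_iff a u).1 h
        have := ha.2
        rwa [cA.left_inv (hA.zero_mem x)] at this
    · exact fun h => .inl ⟨u, h, rfl⟩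
  have hApre : ∀ U, jA ⁻¹' ext U = {a | a ∈ cA.target ∧ cB (0, (cA.symm a).2) ∈ U} := by
    intro U
    ext a
    constructor
    · rintro (⟨v, hv, h⟩ | ⟨a, ha, h⟩)
      · obtain ⟨x, rfl, rfl⟩ := (G.eq_iff a v).1 h.symm
        refine ⟨cA.map_source (hA.zero_mem x), ?_⟩
        rwa [cA.left_inv (hA.zero_mem x)]
      · rwa [← G.left_injective h]
    · exact fun h => .inr ⟨a, h, rfl⟩
  have hopen : ∀ U, IsOpen U → IsOpen (ext U) := by
    intro U hU
    rw [G.isOpen_iff, hBpre, hApre]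
    refine ⟨?_, hU⟩
    have hc : ContinuousOn (fun a => cB (0, (cA.symm a).2)) cA.target :=
      hB.continuousOn.comp (continuousOn_const.prodMk
        (continuous_snd.comp_continuousOn hA.continuousOn_symm)) fun a _ => hB.zero_mem _
    exact hc.isOpen_inter_preimage hA.isOpen_target hU
  refine ⟨ext U, ext U', hopen U hU, hopen U' hU', .inl ⟨b, hb, rfl⟩, .inl ⟨b', hb', rfl⟩, ?_⟩
  rw [Set.disjoint_left] at hd ⊢
  intro z hz hz'
  rcases G.cover z with ⟨a, rfl⟩ | ⟨u, rfl⟩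
  · rw [← mem_preimage, hApre] at hz hz'
    exact hd hz.2 hz'.2
  · rw [← mem_preimage, hBpre] at hz hz'
    exact hd hz hz'

theorem t2Space [T2Space A] [T2Space B] : T2Space X := by
  have hmixed : ∀ a b, jA a ≠ jB b →
      ∃ U U' : Set X, IsOpen U ∧ IsOpen U' ∧ jA a ∈ U ∧ jB b ∈ U' ∧ Disjoint U U' := by
    intro a b hab
    -- If either point lies on the seam, both can be represented on one side, where
    -- `separated_right` applies. Otherwise the two open interiors separate them.
    by_cases hb : b ∈ range fun x => cB (0, x)
    · obtain ⟨x, rfl⟩ := hb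
      have e : jA (cA (0, x)) = jB (cB (0, x)) := (G.eq_iff _ _).2 ⟨x, rfl, rfl⟩
      simp only [← e] at hab ⊢
      exact G.symm.separated_right hB hA fun h => hab (congrArg jA h)
    by_cases ha : a ∈ range fun x => cA (0, x)
    · obtain ⟨x, rfl⟩ := ha
      have e : jA (cA (0, x)) = jB (cB (0, x)) := (G.eq_iff _ _).2 ⟨x, rfl, rfl⟩
      simp only [e] at hab ⊢
      exact G.separated_right hA hB fun h => hab (congrArg jB h)
    refine ⟨_, _, G.symm.isOpen_image_right le_rfl hA.isClosed_range.isOpen_compl,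
      G.isOpen_image_right le_rfl hB.isClosed_range.isOpen_compl, ⟨a, ha, rfl⟩, ⟨b, hb, rfl⟩, ?_⟩
    rw [Set.disjoint_left]
    rintro _ ⟨a', ha', rfl⟩ ⟨b', hb', h⟩
    obtain ⟨x, rfl, -⟩ := (G.eq_iff a' b').1 h.symm
    exact ha' ⟨x, rfl⟩
  refine ⟨fun z z' hz => ?_⟩
  rcases G.cover z with ⟨a, rfl⟩ | ⟨b, rfl⟩ <;> rcases G.cover z' with ⟨a', rfl⟩ | ⟨b', rfl⟩
  · exact G.symm.separated_right hB hA fun h => hz (congrArg jA h)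
  · exact hmixed a b' hz
  · obtain ⟨U, U', h1, h2, h3, h4, h5⟩ := hmixed a' b hz.symm
    exact ⟨U', U, h2, h1, h4, h3, h5.symm⟩
  · exact G.separated_right hA hB fun h => hz (congrArg jB h)

theorem secondCountableTopology [SecondCountableTopology A] [SecondCountableTopology B]
    [SecondCountableTopology N] : SecondCountableTopology X := by
  have hsA := secondCountableTopology_image G.symm.continuous_right.continuousOn G.left_injective.injOn
    hA.isClosed_range.isOpen_compl fun V hV => G.symm.isOpen_image_right hV
  have hsB := secondCountableTopology_image G.continuous_right.continuousOn G.right_injective.injOn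
    hB.isClosed_range.isOpen_compl fun V hV => G.isOpen_image_right hV
  have hoC : IsOpen (Ioo (-2 : ℝ) 2 ×ˢ (univ : Set N)) := isOpen_Ioo.prod isOpen_univ
  have hsC := secondCountableTopology_image (G.continuousOn_twoSided hA hB) (G.injOn_twoSided hA hB) hoC
    fun V hV => G.isOpen_image_twoSided hA hB hV
  let U : Option Bool → Set X := fun i => i.elim (twoSided jA jB cA cB '' (Ioo (-2 : ℝ) 2 ×ˢ univ))
    fun i => if i then jA '' (range fun x => cA (0, x))ᶜ else jB '' (range fun x => cB (0, x))ᶜ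
  have hU : ∀ i, SecondCountableTopology (U i) := by
    rintro (_ | _ | _)
    exacts [hsC, hsB, hsA]
  refine TopologicalSpace.secondCountableTopology_of_countable_cover (U := U) ?_ ?_
  · rintro (_ | _ | _)
    exacts [G.isOpen_image_twoSided hA hB le_rfl hoC,
      G.isOpen_image_right le_rfl hB.isClosed_range.isOpen_compl,
      G.symm.isOpen_image_right le_rfl hA.isClosed_range.isOpen_compl]
  · rw [eq_univ_iff_forall]
    intro z
    rw [mem_iUnion]
    have h0 : ∀ x : N, ((0 : ℝ), x) ∈ Ioo (-2 : ℝ) 2 ×ˢ (univ : Set N) := fun x => by simp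
    rcases G.cover z with ⟨a, rfl⟩ | ⟨b, rfl⟩
    · by_cases ha : a ∈ range fun x => cA (0, x)
      · obtain ⟨x, rfl⟩ := ha
        refine ⟨none, (0, x), h0 x, ?_⟩
        rw [G.twoSided_of_nonpos le_rfl]
        simp [reflectFst]
      · exact ⟨some true, a, ha, rfl⟩
    · by_cases hb : b ∈ range fun x => cB (0, x)
      · obtain ⟨x, rfl⟩ := hb
        exact ⟨none, (0, x), h0 x, G.twoSided_of_nonneg le_rfl⟩
      · exact ⟨some false, b, hb, rfl⟩

end

end IsGluing

/-- An injective continuous open map on an open set, as an open partial homeomorphism. -/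
def homeoOfInjOn {Y Z : Type*} [TopologicalSpace Y] [TopologicalSpace Z] [Nonempty Y] (f : Y → Z)
    (s : Set Y) (hs : IsOpen s) (hinj : InjOn f s) (hc : ContinuousOn f s)
    (ho : ∀ V ⊆ s, IsOpen V → IsOpen (f '' V)) : OpenPartialHomeomorph Y Z where
  toPartialEquiv := hinj.toPartialEquiv f s
  open_source := hs
  open_target := ho s le_rfl hs
  continuousOn_toFun := hc
  continuousOn_invFun := by
    change ContinuousOn (hinj.toPartialEquiv f s).symm (f '' s)
    rw [continuousOn_open_iff (ho s le_rfl hs)]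
    intro t ht
    have : f '' s ∩ (hinj.toPartialEquiv f s).symm ⁻¹' t = f '' (s ∩ t) := by
      ext z
      constructor
      · rintro ⟨⟨y, hy, rfl⟩, h⟩
        have : (hinj.toPartialEquiv f s).symm (f y) = y := (hinj.toPartialEquiv f s).left_inv hy
        rw [mem_preimage, this] at h
        exact ⟨y, ⟨hy, h⟩, rfl⟩
      · rintro ⟨y, ⟨hy, h⟩, rfl⟩
        have : (hinj.toPartialEquiv f s).symm (f y) = y := (hinj.toPartialEquiv f s).left_inv hy
        exact ⟨⟨y, hy, rfl⟩, by rwa [mem_preimage, this]⟩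
    exact this ▸ ho _ inter_subset_left (hs.inter ht)

/-- The part `{t ≤ ρ x}` of the collar is closed if it stays in a set whose closure is contained
in the collar. -/
theorem IsTopCollar.isClosed_sublevel {c : PartialEquiv (ℝ × N) A} (hc : IsTopCollar c) {U : Set A}
    (hU : closure U ⊆ c.target) {ρ : N → ℝ} (hρ : Continuous ρ)
    (hρU : ∀ x, ∀ t ∈ Icc 0 (ρ x), c (t, x) ∈ U) :
    IsClosed {a | a ∈ c.target ∧ (c.symm a).1 ≤ ρ (c.symm a).2} := by
  rw [← isOpen_compl_iff]
  -- Off the closure of U the sublevel has no points, and near the closure the collar coordinates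
  -- are available; closedness could fail only where one leaves the collar.
  have e : {a | a ∈ c.target ∧ (c.symm a).1 ≤ ρ (c.symm a).2}ᶜ
      = (closure U)ᶜ ∪ (c.target ∩ c.symm ⁻¹' {p | ρ p.2 < p.1}) := by
    ext a
    simp only [mem_compl_iff, mem_ofPred_eq, mem_union, mem_inter_iff, mem_preimage, not_and, not_le]
    constructor
    · intro h
      by_cases ha : a ∈ closure U
      · exact .inr ⟨hU ha, h (hU ha)⟩
      · exact .inl ha
    · rintro (h | h) ha
      · by_contra hle
        rw [not_lt] at hle
        apply h
        have := hρU (c.symm a).2 (c.symm a).1 ⟨hc.symm_nonneg ha, hle⟩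
        rw [Prod.mk.eta, c.right_inv ha] at this
        exact subset_closure this
      · exact h.2
  rw [e]
  exact isClosed_closure.isOpen_compl.union (hc.isOpen_target_inter
    (isOpen_lt (hρ.comp continuous_snd) continuous_fst))

theorem IsTopCollar.exists_closure_subset {c : PartialEquiv (ℝ × N) A} (hc : IsTopCollar c)
    [NormalSpace A] :
    ∃ U : Set A, IsOpen U ∧ (∀ x, c (0, x) ∈ U) ∧ closure U ⊆ c.target := by
  obtain ⟨U, h1, h2, h3⟩ := normal_exists_closure_subset hc.isClosed_range hc.isOpen_target
    (by rintro _ ⟨x, rfl⟩; exact c.map_source (hc.zero_mem x))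
  exact ⟨U, h1, fun x => h2 ⟨x, rfl⟩, h3⟩

theorem IsTopCollar.eventually_forall_Icc_mem {c : PartialEquiv (ℝ × N) A} (hc : IsTopCollar c)
    {U : Set A} (hU : IsOpen U) (hcU : ∀ x, c (0, x) ∈ U) (x : N) :
    ∃ ε > 0, ∀ᶠ y in nhds x, ∀ t ∈ Ico 0 ε, c (t, y) ∈ U := by
  have h := (hc.continuousOn _ (hc.zero_mem x)).eventually_mem (hU.mem_nhds (hcU x))
  rw [hc.source_eq, nhdsWithin_prod_eq, nhdsWithin_univ] at h
  obtain ⟨P, hP, Q, hQ, hPQ⟩ := Filter.eventually_prod_iff.1 h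
  have h0 : nhdsWithin (0 : ℝ) (Ico 0 2) = nhdsWithin 0 (Ici 0) :=
    nhdsWithin_Ico_eq_nhdsGE two_pos
  rw [h0] at hP
  obtain ⟨ε, hε, hεP⟩ := (mem_nhdsGE_iff_exists_Ico_subset).1 hP
  refine ⟨ε, hε, ?_⟩
  filter_upwards [hQ] with y hy t ht
  exact hPQ (hεP ht) hy

end GluingTopology

/-! ### Charts induced by open pieces of manifolds with boundary. -/

section PieceCharts

variable {E : Type*} [NormedAddCommGroup E] [NormedSpace ℝ E]
  {H : Type*} [TopologicalSpace H] {E₀ : Type*} [NormedAddCommGroup E₀] [NormedSpace ℝ E₀]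
  {X : Type*} [TopologicalSpace X]

/-- The model with corners, restricted to the interior of its range. -/
def interiorHomeo (I : ModelWithCorners ℝ E H) : OpenPartialHomeomorph H E where
  toFun := I
  invFun := I.symm
  source := I ⁻¹' interior (range I)
  target := interior (range I)
  map_source' _ h := h
  map_target' y h := by
    rw [mem_preimage, I.right_inv (interior_subset h)]; exact h
  left_inv' x _ := I.left_inv x
  right_inv' y h := I.right_inv (interior_subset h)
  open_source := isOpen_interior.preimage I.continuous
  open_target := isOpen_interior
  continuousOn_toFun := I.continuous.continuousOn
  continuousOn_invFun := I.continuous_symm.continuousOn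

variable {M : Type*} [TopologicalSpace M] [ChartedSpace H M]

/-- The chart of `X` induced by an open embedding of a part of the interior of the manifold `M`,
a chart of `M` and a linear identification of the model spaces. -/
def pieceChart (e : OpenPartialHomeomorph M X) (I : ModelWithCorners ℝ E H) (m : M)
    (J : E ≃L[ℝ] E₀) : OpenPartialHomeomorph X E₀ :=
  ((e.symm.trans (chartAt H m)).trans (interiorHomeo I)).trans
    J.toHomeomorph.toOpenPartialHomeomorph

variable {e : OpenPartialHomeomorph M X} {I : ModelWithCorners ℝ E H} {m : M} {J : E ≃L[ℝ] E₀}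

theorem pieceChart_apply (z : X) : pieceChart e I m J z = J (extChartAt I m (e.symm z)) := rfl

theorem pieceChart_symm_apply (y : E₀) :
    (pieceChart e I m J).symm y = e ((extChartAt I m).symm (J.symm y)) := rfl

theorem mem_pieceChart_source {z : X} : z ∈ (pieceChart e I m J).source ↔
    z ∈ e.target ∧ e.symm z ∈ (chartAt H m).source
      ∧ extChartAt I m (e.symm z) ∈ interior (range I) := by
  simp [pieceChart, interiorHomeo, and_assoc]

theorem mem_pieceChart_target {y : E₀} : y ∈ (pieceChart e I m J).target ↔
    J.symm y ∈ interior (range I) ∧ J.symm y ∈ (extChartAt I m).target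
      ∧ (extChartAt I m).symm (J.symm y) ∈ e.source := by
  have h : J.symm y ∈ interior (range I) → J.symm y ∈ range I := fun h => interior_subset h
  simp only [pieceChart, interiorHomeo, OpenPartialHomeomorph.trans_target,
    OpenPartialHomeomorph.symm_target, mem_inter_iff, mem_preimage, extChartAt_target]
  constructor
  · rintro ⟨-, h1, h2, h3⟩
    exact ⟨h1, ⟨h2, h h1⟩, h3⟩
  · rintro ⟨h1, ⟨h2, -⟩, h3⟩
    exact ⟨trivial, h1, h2, h3⟩

theorem extChartAt_target_mem_nhds_of_interior {y : E} (hy : y ∈ interior (range I))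
    (hyt : y ∈ (extChartAt I m).target) : (extChartAt I m).target ∈ nhds y := by
  rw [extChartAt_target] at hyt ⊢
  exact Filter.inter_mem ((I.continuous_symm.isOpen_preimage _
    (chartAt H m).open_target).mem_nhds hyt.1) (mem_interior_iff_mem_nhds.1 hy)

section

variable {E' : Type*} [NormedAddCommGroup E'] [NormedSpace ℝ E']
  {H' : Type*} [TopologicalSpace H'] {M' : Type*} [TopologicalSpace M'] [ChartedSpace H' M']
  {e' : OpenPartialHomeomorph M' X} {I' : ModelWithCorners ℝ E' H'} {m' : M'} {J' : E' ≃L[ℝ] E₀}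
  [IsManifold I ∞ M] [IsManifold I' ∞ M']

theorem contMDiffAt_extChartAt_symm_of_interior {y : E} (hy : y ∈ interior (range I))
    (hyt : y ∈ (extChartAt I m).target) :
    ContMDiffAt 𝓘(ℝ, E) I ∞ (extChartAt I m).symm y :=
  (contMDiffOn_extChartAt_symm m y hyt).contMDiffAt
    (extChartAt_target_mem_nhds_of_interior hy hyt)

/-- A transition is a chart of M', after e'⁻¹ ∘ e, after an inverse chart of M. Restricting to the
interior of the model range makes the inverse chart smooth in the unrestricted sense, so only e'⁻¹ ∘
e has to be controlled. -/
theorem contDiffOn_pieceChart_transition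
    (h : ContMDiffOn I I' ∞ (e'.symm ∘ e) (e.source ∩ e ⁻¹' e'.target)) :
    ContDiffOn ℝ ∞ (pieceChart e' I' m' J' ∘ (pieceChart e I m J).symm)
      ((pieceChart e I m J).symm.trans (pieceChart e' I' m' J')).source := by
  intro y hy
  rw [OpenPartialHomeomorph.trans_source, OpenPartialHomeomorph.symm_source, mem_inter_iff,
    mem_preimage, mem_pieceChart_target, mem_pieceChart_source, pieceChart_symm_apply] at hy
  obtain ⟨⟨h1, h2, h3⟩, h4, h5, h6⟩ := hy
  refine ContDiffAt.contDiffWithinAt ?_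
  rw [← contMDiffAt_iff_contDiffAt]
  have s1 : ContMDiffAt 𝓘(ℝ, E₀) 𝓘(ℝ, E) ∞ J.symm y := J.symm.contDiff.contMDiff.contMDiffAt
  have s2 : ContMDiffAt 𝓘(ℝ, E) I ∞ (extChartAt I m).symm (J.symm y) :=
    contMDiffAt_extChartAt_symm_of_interior h1 h2
  have s3 : ContMDiffAt I I' ∞ (e'.symm ∘ e) ((extChartAt I m).symm (J.symm y)) :=
    (h _ ⟨h3, h4⟩).contMDiffAt ((e.isOpen_inter_preimage e'.open_target).mem_nhds ⟨h3, h4⟩)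
  have s4 : ContMDiffAt I' 𝓘(ℝ, E') ∞ (extChartAt I' m')
      ((e'.symm ∘ e) ((extChartAt I m).symm (J.symm y))) := contMDiffAt_extChartAt' h5
  have t2 := s2.comp y s1
  have t3 := ContMDiffAt.comp (g := e'.symm ∘ e) y s3 t2
  have t4 := ContMDiffAt.comp (g := extChartAt I' m') y s4 t3
  exact ContMDiffAt.comp (g := J') (I' := 𝓘(ℝ, E')) y J'.contDiff.contMDiff.contMDiffAt t4

end

section Smooth

variable [ChartedSpace E₀ X] [IsManifold I ∞ M]

theorem contMDiffOn_of_pieceChart_mem (J : E ≃L[ℝ] E₀)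
    (h : ∀ p ∈ e.source, ∃ m, e p ∈ (pieceChart e I m J).source ∧
      pieceChart e I m J ∈ IsManifold.maximalAtlas 𝓘(ℝ, E₀) ∞ X) :
    ContMDiffOn I 𝓘(ℝ, E₀) ∞ e e.source := by
  intro p hp
  obtain ⟨m, hm, hat⟩ := h p hp
  have hm' := mem_pieceChart_source.1 hm
  rw [e.left_inv hp] at hm'
  have s1 : ContMDiffAt I 𝓘(ℝ, E) ∞ (extChartAt I m) p := contMDiffAt_extChartAt' hm'.2.1
  have s2 : ContMDiffAt 𝓘(ℝ, E) 𝓘(ℝ, E₀) ∞ J (extChartAt I m p) :=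
    J.contDiff.contMDiff.contMDiffAt
  have ht : J (extChartAt I m p) ∈ (pieceChart e I m J).target := by
    have := (pieceChart e I m J).map_source hm
    rwa [pieceChart_apply, e.left_inv hp] at this
  have s3 : ContMDiffAt 𝓘(ℝ, E₀) 𝓘(ℝ, E₀) ∞ (pieceChart e I m J).symm (J (extChartAt I m p)) :=
    (contMDiffOn_symm_of_mem_maximalAtlas hat _ ht).contMDiffAt
      ((pieceChart e I m J).open_target.mem_nhds ht)
  have s4 := s3.comp p (s2.comp p s1)
  refine (s4.congr_of_eventuallyEq ?_).contMDiffWithinAt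
  filter_upwards [extChartAt_source_mem_nhds' (I := I) ((extChartAt_source I m).symm ▸ hm'.2.1)]
    with p' hp'
  simp only [comp_apply, pieceChart_symm_apply, J.symm_apply_apply,
    (extChartAt I m).left_inv hp']

theorem contMDiffOn_symm_of_pieceChart_mem (J : E ≃L[ℝ] E₀)
    (h : ∀ p ∈ e.source, ∃ m, e p ∈ (pieceChart e I m J).source ∧
      pieceChart e I m J ∈ IsManifold.maximalAtlas 𝓘(ℝ, E₀) ∞ X) :
    ContMDiffOn 𝓘(ℝ, E₀) I ∞ e.symm e.target := by
  intro z hz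
  obtain ⟨m, hm, hat⟩ := h _ (e.map_target hz)
  rw [e.right_inv hz] at hm
  have hm' := mem_pieceChart_source.1 hm
  have s1 : ContMDiffAt 𝓘(ℝ, E₀) 𝓘(ℝ, E₀) ∞ (pieceChart e I m J) z :=
    (contMDiffOn_of_mem_maximalAtlas hat z hm).contMDiffAt
      ((pieceChart e I m J).open_source.mem_nhds hm)
  have s2 : ContMDiffAt 𝓘(ℝ, E₀) 𝓘(ℝ, E) ∞ J.symm (pieceChart e I m J z) :=
    J.symm.contDiff.contMDiff.contMDiffAt
  have hJ : J.symm (pieceChart e I m J z) = extChartAt I m (e.symm z) := by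
    rw [pieceChart_apply, J.symm_apply_apply]
  have s3 : ContMDiffAt 𝓘(ℝ, E) I ∞ (extChartAt I m).symm (J.symm (pieceChart e I m J z)) := by
    rw [hJ]
    exact contMDiffAt_extChartAt_symm_of_interior hm'.2.2
      ((extChartAt I m).map_source ((extChartAt_source I m).symm ▸ hm'.2.1))
  have s4 := s3.comp z (s2.comp z s1)
  refine (s4.congr_of_eventuallyEq ?_).contMDiffWithinAt
  filter_upwards [(pieceChart e I m J).open_source.mem_nhds hm] with z' hz'
  have hz'' := mem_pieceChart_source.1 hz'
  simp only [comp_apply, pieceChart_apply, J.symm_apply_apply,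
    (extChartAt I m).left_inv ((extChartAt_source I m).symm ▸ hz''.2.1)]

end Smooth

end PieceCharts

/-! ### Charted spaces with prescribed preferred charts. -/

section ChartsOfIndex

variable {E : Type*} [NormedAddCommGroup E] [NormedSpace ℝ E] {X : Type*} [TopologicalSpace X]
  {ι : Type*}

/-- The charted space structure given by a family of charts and a choice of preferred charts. -/
@[reducible]
def chartedSpaceOfIndex (φ : ι → OpenPartialHomeomorph X E) (κ : X → ι)
    (h : ∀ z, z ∈ (φ (κ z)).source) : ChartedSpace E X where
  atlas := range φ
  chartAt z := φ (κ z)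
  mem_chart_source := h
  chart_mem_atlas _ := ⟨_, rfl⟩

theorem isManifold_chartedSpaceOfIndex (φ : ι → OpenPartialHomeomorph X E) (κ : X → ι)
    (h : ∀ z, z ∈ (φ (κ z)).source)
    (hφ : ∀ i j, ContDiffOn ℝ ∞ (φ j ∘ (φ i).symm) ((φ i).symm.trans (φ j)).source) :
    @IsManifold ℝ _ E _ _ E _ 𝓘(ℝ, E) ∞ X _ (chartedSpaceOfIndex φ κ h) := by
  let := chartedSpaceOfIndex φ κ h
  refine isManifold_of_contDiffOn _ _ _ ?_
  rintro _ _ ⟨i, rfl⟩ ⟨j, rfl⟩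
  simpa using hφ i j

end ChartsOfIndex

/-! ### Reflection and identity of the collar coordinate, treated uniformly by ε = ±1. -/

section ScaleFst

variable {N : Type*}

/-- Multiplication of the first coordinate by a constant. -/
def scaleFst (ε : ℝ) (p : ℝ × N) : ℝ × N := (ε * p.1, p.2)

theorem scaleFst_scaleFst {ε : ℝ} (h : ε * ε = 1) (p : ℝ × N) :
    scaleFst ε (scaleFst ε p) = p := by
  simp [scaleFst, ← mul_assoc, h]

variable {V : Type*} [NormedAddCommGroup V] [NormedSpace ℝ V] [TopologicalSpace N]
  [ChartedSpace V N]

theorem contMDiff_scaleFst (ε : ℝ) : ContMDiff (𝓘(ℝ, ℝ).prod 𝓘(ℝ, V)) (𝓘(ℝ, ℝ).prod 𝓘(ℝ, V)) ∞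
    (scaleFst ε : ℝ × N → ℝ × N) := by
  have h : ContMDiff 𝓘(ℝ, ℝ) 𝓘(ℝ, ℝ) ∞ (fun t : ℝ => ε * t) :=
    (contDiff_const.mul contDiff_id).contMDiff
  exact (h.comp contMDiff_fst).prodMk contMDiff_snd

end ScaleFst

/-! ### Transitions between a side and the two-sided collar. -/

section Sides

variable {E : Type*} [NormedAddCommGroup E] [NormedSpace ℝ E]
  {H : Type*} [TopologicalSpace H] (I : ModelWithCorners ℝ E H)
  (V : Type*) [NormedAddCommGroup V] [NormedSpace ℝ V]
  {N M X : Type*} [TopologicalSpace N] [TopologicalSpace M] [TopologicalSpace X]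
  [ChartedSpace V N] [ChartedSpace H M]

/-- `c` is a smooth collar of the boundary of `M`. -/
structure IsSmoothCollar (c : PartialEquiv (ℝ × N) M) : Prop extends IsTopCollar c where
  contMDiffOn_toFun : ContMDiffOn (𝓘(ℝ, ℝ).prod 𝓘(ℝ, V)) I ∞ c c.source
  contMDiffOn_symm : ContMDiffOn I (𝓘(ℝ, ℝ).prod 𝓘(ℝ, V)) ∞ c.symm c.target
  range_eq : range (fun x : N => c (0, x)) = I.boundary M

/-- The map `f` on `(-2, 2) × N` agrees with `j` on one of the two halves, in the coordinates given
by the collar `c`, and the image of `j` meets the image of `f` only there. -/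
structure IsSideOf (f : ℝ × N → X) (j : M → X) (c : PartialEquiv (ℝ × N) M) (ε : ℝ) : Prop where
  mul_self : ε * ε = 1
  apply_scale : ∀ p ∈ c.source, f (scaleFst ε p) = j (c p)
  of_eq : ∀ a, ∀ p ∈ Ioo (-2 : ℝ) 2 ×ˢ (univ : Set N), j a = f p →
    a ∈ c.target ∧ p = scaleFst ε (c.symm a)

variable {I V} {f : ℝ × N → X} {j : M → X} {c : PartialEquiv (ℝ × N) M} {ε : ℝ}
  {eC : OpenPartialHomeomorph (ℝ × N) X} {e : OpenPartialHomeomorph M X}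

namespace IsSideOf

variable (S : IsSideOf eC e c ε) (hs : eC.source = Ioo (-2 : ℝ) 2 ×ˢ univ)
include S hs

/-- On the overlap the transition is the inverse collar up to the sign ε of the first coordinate, so
its smoothness is that of the given collar. -/
theorem center_symm_eq {a : M} (ha : a ∈ e.source ∩ e ⁻¹' eC.target) :
    a ∈ c.target ∧ (eC.symm ∘ e) a = scaleFst ε (c.symm a) :=
  S.of_eq a _ (hs ▸ eC.map_target ha.2) (eC.right_inv ha.2).symm

theorem side_symm_eq {p : ℝ × N} (hp : p ∈ eC.source ∩ eC ⁻¹' e.target) :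
    scaleFst ε p ∈ c.source ∧ (e.symm ∘ eC) p = c (scaleFst ε p) := by
  obtain ⟨h1, h2⟩ := S.of_eq (e.symm (eC p)) p (hs ▸ hp.1) (e.right_inv hp.2)
  have h3 : scaleFst ε p = c.symm (e.symm (eC p)) := by
    conv_lhs => rw [h2]
    rw [scaleFst_scaleFst S.mul_self]
  rw [h3]
  exact ⟨c.map_target h1, (c.right_inv h1).symm⟩

theorem contMDiffOn_center_symm (hc : IsSmoothCollar I V c) :
    ContMDiffOn I (𝓘(ℝ, ℝ).prod 𝓘(ℝ, V)) ∞ (eC.symm ∘ e) (e.source ∩ e ⁻¹' eC.target) :=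
  (((contMDiff_scaleFst ε).comp_contMDiffOn hc.contMDiffOn_symm).mono
    fun _ ha => (S.center_symm_eq hs ha).1).congr fun _ ha => (S.center_symm_eq hs ha).2

theorem contMDiffOn_side_symm (hc : IsSmoothCollar I V c) :
    ContMDiffOn (𝓘(ℝ, ℝ).prod 𝓘(ℝ, V)) I ∞ (e.symm ∘ eC) (eC.source ∩ eC ⁻¹' e.target) :=
  (hc.contMDiffOn_toFun.comp (contMDiff_scaleFst ε).contMDiffOn
    fun _ hp => (S.side_symm_eq hs hp).1).congr fun _ hp => (S.side_symm_eq hs hp).2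

end IsSideOf

/-- Two parametrizations by the same map have identity transition. -/
theorem contMDiffOn_symm_comp_of_coe_eq {e e' : OpenPartialHomeomorph M X}
    (h : ∀ a ∈ e.source, ∀ a' ∈ e'.source, e a = e' a' → a = a') :
    ContMDiffOn I I ∞ (e'.symm ∘ e) (e.source ∩ e ⁻¹' e'.target) :=
  contMDiffOn_id.congr fun a ha => (h a ha.1 _ (e'.map_target ha.2) (e'.right_inv ha.2).symm).symm

theorem contMDiffOn_symm_comp_of_disjoint {M' : Type*} [TopologicalSpace M'] [ChartedSpace H M']
    {e' : OpenPartialHomeomorph M' X} (h : ∀ z ∈ e.target, z ∉ e'.target) :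
    ContMDiffOn I I ∞ (e'.symm ∘ e) (e.source ∩ e ⁻¹' e'.target) :=
  fun _ ha => absurd ha.2 (h _ (e.map_source ha.1))

theorem isLocalDiffeomorphOn_of_contMDiffOn {H' E' : Type*} [NormedAddCommGroup E']
    [NormedSpace ℝ E'] [TopologicalSpace H'] {I' : ModelWithCorners ℝ E' H'} [ChartedSpace H' X]
    (h1 : ContMDiffOn I I' ∞ e e.source) (h2 : ContMDiffOn I' I ∞ e.symm e.target) :
    IsLocalDiffeomorphOn I I' ∞ e e.source := fun a =>
  ⟨{ toPartialEquiv := e.toPartialEquiv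
     open_source := e.open_source
     open_target := e.open_target
     contMDiffOn_toFun := h1
     contMDiffOn_invFun := h2 }, a.2, fun _ _ => rfl⟩

end Sides

/-! ### The smooth structure on the glued space. -/

section CollarGluing

variable {E : Type*} [NormedAddCommGroup E] [NormedSpace ℝ E]
  {H : Type*} [TopologicalSpace H] (I : ModelWithCorners ℝ E H)
  (V : Type*) [NormedAddCommGroup V] [NormedSpace ℝ V]
  {N A B X : Type*} [TopologicalSpace N] [TopologicalSpace A] [TopologicalSpace B]
  [TopologicalSpace X] [ChartedSpace V N] [ChartedSpace H A] [ChartedSpace H B]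

/-- `X` is obtained by gluing `A` and `B` along smooth collars of their boundaries. -/
structure IsCollarGluing (jA : A → X) (jB : B → X) (cA : PartialEquiv (ℝ × N) A)
    (cB : PartialEquiv (ℝ × N) B) : Prop where
  gluing : IsGluing jA jB (fun x => cA (0, x)) (fun x => cB (0, x))
  left : IsSmoothCollar I V cA
  right : IsSmoothCollar I V cB

variable {I V} {jA : A → X} {jB : B → X} {cA : PartialEquiv (ℝ × N) A} {cB : PartialEquiv (ℝ × N) B}

namespace IsCollarGluing

theorem symm (G : IsCollarGluing I V jA jB cA cB) : IsCollarGluing I V jB jA cB cA :=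
  ⟨G.gluing.symm, G.right, G.left⟩

variable (G : IsCollarGluing I V jA jB cA cB)

/-- The right-hand manifold, restricted to an open part of its interior, as a part of the glued
space. -/
def rightPiece (u : B) (U : TopologicalSpace.Opens B) (hU : (U : Set B) ⊆ I.interior B) :
    OpenPartialHomeomorph B X :=
  haveI : Nonempty B := ⟨u⟩
  homeoOfInjOn jB U U.isOpen G.gluing.right_injective.injOn G.gluing.continuous_right.continuousOn
    fun _ hV => G.gluing.isOpen_image_right
      ((hV.trans hU).trans (by rw [G.right.range_eq, I.compl_boundary]))

/-- The left-hand manifold, restricted to an open part of its interior, as a part of the glued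
space. -/
def leftPiece (u : A) (U : TopologicalSpace.Opens A) (hU : (U : Set A) ⊆ I.interior A) :
    OpenPartialHomeomorph A X :=
  G.symm.rightPiece u U hU

/-- The two-sided collar as a part of the glued space. -/
def centerPiece (x : N) : OpenPartialHomeomorph (ℝ × N) X :=
  haveI : Nonempty (ℝ × N) := ⟨(0, x)⟩
  homeoOfInjOn (twoSided jA jB cA cB) (Ioo (-2 : ℝ) 2 ×ˢ univ) (isOpen_Ioo.prod isOpen_univ)
    (G.gluing.injOn_twoSided G.left.toIsTopCollar G.right.toIsTopCollar)
    (G.gluing.continuousOn_twoSided G.left.toIsTopCollar G.right.toIsTopCollar)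
    fun _ hV => G.gluing.isOpen_image_twoSided G.left.toIsTopCollar G.right.toIsTopCollar hV

include G in
theorem isSideOf_right : IsSideOf (twoSided jA jB cA cB) jB cB 1 where
  mul_self := by simp
  apply_scale p hp := by
    have : scaleFst 1 p = p := by simp [scaleFst]
    rw [this, G.gluing.twoSided_of_nonneg (G.right.mem_source.1 hp).1]
  of_eq b p hp h := by
    have := (G.gluing.right_mem_image_iff G.left.toIsTopCollar G.right.toIsTopCollar
      (singleton_subset_iff.2 hp) b).1 ⟨p, rfl, h.symm⟩
    exact ⟨this.1, by rw [this.2]; simp [scaleFst]⟩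

include G in
theorem isSideOf_left : IsSideOf (twoSided jA jB cA cB) jA cA (-1) where
  mul_self := by simp
  apply_scale p hp := by
    have : scaleFst (-1) p = reflectFst p := by simp [scaleFst, reflectFst]
    rw [this, ← G.gluing.twoSided_symm,
      G.gluing.symm.twoSided_of_nonneg (G.left.mem_source.1 hp).1]
  of_eq a p hp h := by
    have := (G.gluing.left_mem_image_iff G.left.toIsTopCollar G.right.toIsTopCollar
      (singleton_subset_iff.2 hp) a).1 ⟨p, rfl, h.symm⟩
    exact ⟨this.1, by rw [← mem_singleton_iff.1 this.2]; simp [scaleFst, reflectFst]⟩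

theorem rightPiece_ne_leftPiece {u : B} {U : TopologicalSpace.Opens B}
    {hU : (U : Set B) ⊆ I.interior B} {u' : A} {U' : TopologicalSpace.Opens A}
    {hU' : (U' : Set A) ⊆ I.interior A} {z : X} (h : z ∈ (G.rightPiece u U hU).target) :
    z ∉ (G.leftPiece u' U' hU').target := by
  rintro ⟨a, ha, rfl⟩
  obtain ⟨b, hb, h⟩ := h
  obtain ⟨x, -, rfl⟩ := (G.gluing.eq_iff a b).1 h.symm
  have := hU hb
  rw [← I.compl_boundary, ← G.right.range_eq] at this
  exact this ⟨x, rfl⟩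

/-- The indices of the charts of the glued space. -/
abbrev ChartIndex (_ : IsCollarGluing I V jA jB cA cB) : Type _ :=
  (A × {U : TopologicalSpace.Opens A // (U : Set A) ⊆ I.interior A}) ⊕
    (B × {U : TopologicalSpace.Opens B // (U : Set B) ⊆ I.interior B}) ⊕ N

/-- The charts of the glued space. -/
def chart (J : (ℝ × V) ≃L[ℝ] E) : G.ChartIndex → OpenPartialHomeomorph X E
  | .inl (u, U) => pieceChart (G.leftPiece u U.1 U.2) I u (.refl ℝ E)
  | .inr (.inl (u, U)) => pieceChart (G.rightPiece u U.1 U.2) I u (.refl ℝ E)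
  | .inr (.inr x) => pieceChart (G.centerPiece x) (𝓘(ℝ, ℝ).prod 𝓘(ℝ, V)) (0, x) J

variable [IsManifold I ∞ A] [IsManifold I ∞ B] [IsManifold 𝓘(ℝ, V) ∞ N]

/-- Two pieces of the same kind overlap through the identity, and interiors of opposite sides do not
meet. The remaining transitions are the collars or their inverses, up to reflection. -/
theorem contDiffOn_chart_transition (J : (ℝ × V) ≃L[ℝ] E) (k l : G.ChartIndex) :
    ContDiffOn ℝ ∞ (G.chart J l ∘ (G.chart J k).symm)
      ((G.chart J k).symm.trans (G.chart J l)).source := by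
  rcases k with ⟨u, U⟩ | ⟨u, U⟩ | x <;> rcases l with ⟨u', U'⟩ | ⟨u', U'⟩ | x'
  · exact contDiffOn_pieceChart_transition
      (contMDiffOn_symm_comp_of_coe_eq fun a _ a' _ h => G.gluing.left_injective h)
  · exact contDiffOn_pieceChart_transition (contMDiffOn_symm_comp_of_disjoint
      fun z h h' => G.rightPiece_ne_leftPiece h' h)
  · exact contDiffOn_pieceChart_transition
      (IsSideOf.contMDiffOn_center_symm (c := cA) (ε := -1) G.isSideOf_left rfl G.left)
  · exact contDiffOn_pieceChart_transition (contMDiffOn_symm_comp_of_disjoint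
      fun z h h' => G.rightPiece_ne_leftPiece h h')
  · exact contDiffOn_pieceChart_transition
      (contMDiffOn_symm_comp_of_coe_eq fun a _ a' _ h => G.gluing.right_injective h)
  · exact contDiffOn_pieceChart_transition
      (IsSideOf.contMDiffOn_center_symm (c := cB) (ε := 1) G.isSideOf_right rfl G.right)
  · exact contDiffOn_pieceChart_transition
      (IsSideOf.contMDiffOn_side_symm (c := cA) (ε := -1) G.isSideOf_left rfl G.left)
  · exact contDiffOn_pieceChart_transition
      (IsSideOf.contMDiffOn_side_symm (c := cB) (ε := 1) G.isSideOf_right rfl G.right)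
  · exact contDiffOn_pieceChart_transition
      (contMDiffOn_symm_comp_of_coe_eq fun p hp p' hp' h =>
      G.gluing.injOn_twoSided G.left.toIsTopCollar G.right.toIsTopCollar hp hp' h)

section LocalDiffeomorph

variable [ChartedSpace E X] (J : (ℝ × V) ≃L[ℝ] E)
  (hat : ∀ k : G.ChartIndex, G.chart J k ∈ IsManifold.maximalAtlas 𝓘(ℝ, E) ∞ X)
include hat

theorem exists_chart_leftPiece {u : A} {U : TopologicalSpace.Opens A} {hU} :
    ∀ a ∈ (G.leftPiece u U hU).source, ∃ m, G.leftPiece u U hU a ∈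
      (pieceChart (G.leftPiece u U hU) I m (.refl ℝ E)).source ∧
      pieceChart (G.leftPiece u U hU) I m (.refl ℝ E) ∈ IsManifold.maximalAtlas 𝓘(ℝ, E) ∞ X := by
  intro a ha
  refine ⟨a, mem_pieceChart_source.2 ⟨(G.leftPiece u U hU).map_source ha, ?_⟩,
    hat (.inl (a, ⟨U, hU⟩))⟩
  rw [(G.leftPiece u U hU).left_inv ha]
  exact ⟨mem_chart_source H a, hU ha⟩

theorem exists_chart_rightPiece {u : B} {U : TopologicalSpace.Opens B} {hU} :
    ∀ b ∈ (G.rightPiece u U hU).source, ∃ m, G.rightPiece u U hU b ∈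
      (pieceChart (G.rightPiece u U hU) I m (.refl ℝ E)).source ∧
      pieceChart (G.rightPiece u U hU) I m (.refl ℝ E) ∈ IsManifold.maximalAtlas 𝓘(ℝ, E) ∞ X := by
  intro b hb
  refine ⟨b, mem_pieceChart_source.2 ⟨(G.rightPiece u U hU).map_source hb, ?_⟩,
    hat (.inr (.inl (b, ⟨U, hU⟩)))⟩
  rw [(G.rightPiece u U hU).left_inv hb]
  exact ⟨mem_chart_source H b, hU hb⟩

theorem exists_chart_centerPiece {x : N} :
    ∀ p ∈ (G.centerPiece x).source, ∃ m, G.centerPiece x p ∈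
      (pieceChart (G.centerPiece x) (𝓘(ℝ, ℝ).prod 𝓘(ℝ, V)) m J).source ∧
      pieceChart (G.centerPiece x) (𝓘(ℝ, ℝ).prod 𝓘(ℝ, V)) m J
        ∈ IsManifold.maximalAtlas 𝓘(ℝ, E) ∞ X := by
  intro p hp
  refine ⟨(0, p.2), mem_pieceChart_source.2 ⟨(G.centerPiece x).map_source hp, ?_⟩,
    hat (.inr (.inr p.2))⟩
  rw [(G.centerPiece x).left_inv hp]
  refine ⟨⟨trivial, mem_chart_source V p.2⟩, ?_⟩
  · rw [ModelWithCorners.Boundaryless.range_eq_univ, interior_univ]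
    trivial

theorem contMDiffOn_leftPiece {u : A} {U : TopologicalSpace.Opens A} {hU} :
    ContMDiffOn I 𝓘(ℝ, E) ∞ (G.leftPiece u U hU) (G.leftPiece u U hU).source :=
  contMDiffOn_of_pieceChart_mem _ (G.exists_chart_leftPiece J hat)

theorem contMDiffOn_rightPiece {u : B} {U : TopologicalSpace.Opens B} {hU} :
    ContMDiffOn I 𝓘(ℝ, E) ∞ (G.rightPiece u U hU) (G.rightPiece u U hU).source :=
  contMDiffOn_of_pieceChart_mem _ (G.exists_chart_rightPiece J hat)

theorem contMDiffOn_centerPiece {x : N} :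
    ContMDiffOn (𝓘(ℝ, ℝ).prod 𝓘(ℝ, V)) 𝓘(ℝ, E) ∞ (G.centerPiece x) (G.centerPiece x).source :=
  contMDiffOn_of_pieceChart_mem _ (G.exists_chart_centerPiece J hat)

/-- The atlas has charts over every open part of the interior, so here the whole interior may be
taken, although preferred charts see only the complement of a thin collar. -/
theorem isLocalDiffeomorphOn_left : IsLocalDiffeomorphOn I 𝓘(ℝ, E) ∞ jA (I.interior A) := by
  intro a
  let U : TopologicalSpace.Opens A := ⟨I.interior A, I.isOpen_interior (n := ∞) (by simp)⟩
  exact isLocalDiffeomorphOn_of_contMDiffOn (e := G.leftPiece a.1 U le_rfl)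
    (G.contMDiffOn_leftPiece J hat)
    (contMDiffOn_symm_of_pieceChart_mem _ (G.exists_chart_leftPiece J hat)) a

theorem isLocalDiffeomorphOn_right : IsLocalDiffeomorphOn I 𝓘(ℝ, E) ∞ jB (I.interior B) := by
  intro b
  let U : TopologicalSpace.Opens B := ⟨I.interior B, I.isOpen_interior (n := ∞) (by simp)⟩
  exact isLocalDiffeomorphOn_of_contMDiffOn (e := G.rightPiece b.1 U le_rfl)
    (G.contMDiffOn_rightPiece J hat)
    (contMDiffOn_symm_of_pieceChart_mem _ (G.exists_chart_rightPiece J hat)) b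

theorem isLocalDiffeomorphOn_twoSided : IsLocalDiffeomorphOn (𝓘(ℝ, ℝ).prod 𝓘(ℝ, V)) 𝓘(ℝ, E) ∞
    (twoSided jA jB cA cB) (Ioo (-2 : ℝ) 2 ×ˢ univ) := fun p =>
  isLocalDiffeomorphOn_of_contMDiffOn (e := G.centerPiece p.1.2)
    (G.contMDiffOn_centerPiece J hat)
    (contMDiffOn_symm_of_pieceChart_mem _ (G.exists_chart_centerPiece J hat)) p

end LocalDiffeomorph

/-- The part `{t ≤ ρ x}` of a collar. -/
def _root_.thinCollar {N M : Type*} (c : PartialEquiv (ℝ × N) M) (ρ : N → ℝ) : Set M :=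
  {a | a ∈ c.target ∧ (c.symm a).1 ≤ ρ (c.symm a).2}

theorem _root_.IsSmoothCollar.compl_thinCollar_subset {N M : Type*} [TopologicalSpace N]
    [TopologicalSpace M] [ChartedSpace V N] [ChartedSpace H M] {c : PartialEquiv (ℝ × N) M}
    (hc : IsSmoothCollar I V c) {ρ : N → ℝ} (hρ : ∀ x, 0 < ρ x) :
    (thinCollar c ρ)ᶜ ⊆ I.interior M := by
  rw [← I.compl_boundary, compl_subset_compl, ← hc.range_eq]
  rintro _ ⟨x, rfl⟩
  refine ⟨c.map_source (hc.zero_mem x), ?_⟩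
  rw [c.left_inv (hc.zero_mem x)]
  exact (hρ x).le

/-- A cut-off width: the part `{t ≤ ρ x}` of the collars is closed. -/
structure IsWidth (_ : IsCollarGluing I V jA jB cA cB) (ρ : N → ℝ) : Prop where
  pos : ∀ x, 0 < ρ x
  contMDiff : ContMDiff 𝓘(ℝ, V) 𝓘(ℝ, ℝ) ∞ ρ
  isClosed_left : IsClosed (thinCollar cA ρ)
  isClosed_right : IsClosed (thinCollar cB ρ)

variable {ρ : N → ℝ} (hρ : G.IsWidth ρ)

/-- The complement of the thin collar on the left. -/
def leftOpen : {U : TopologicalSpace.Opens A // (U : Set A) ⊆ I.interior A} :=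
  ⟨⟨(thinCollar cA ρ)ᶜ, hρ.isClosed_left.isOpen_compl⟩, G.left.compl_thinCollar_subset hρ.pos⟩

/-- The complement of the thin collar on the right. -/
def rightOpen : {U : TopologicalSpace.Opens B // (U : Set B) ⊆ I.interior B} :=
  ⟨⟨(thinCollar cB ρ)ᶜ, hρ.isClosed_right.isOpen_compl⟩, G.right.compl_thinCollar_subset hρ.pos⟩

/-- The indices of the charts of the glued space with a given width. -/
def preferredIndex : A ⊕ B ⊕ N → G.ChartIndex
  | .inl u => .inl (u, G.leftOpen hρ)
  | .inr (.inl u) => .inr (.inl (u, G.rightOpen hρ))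
  | .inr (.inr x) => .inr (.inr x)

include G in
theorem mem_image_twoSided_left {a : A} (ha : a ∈ cA.target) :
    jA a ∈ twoSided jA jB cA cB '' (Ioo (-2 : ℝ) 2 ×ˢ univ) := by
  rw [G.gluing.left_mem_image_iff G.left.toIsTopCollar G.right.toIsTopCollar le_rfl]
  have h1 := G.left.symm_nonneg ha
  have h2 := G.left.symm_lt_two ha
  refine ⟨ha, ⟨?_, ?_⟩, trivial⟩ <;> simp only [reflectFst] <;> linarith

include G in
theorem mem_image_twoSided_right {b : B} (hb : b ∈ cB.target) :
    jB b ∈ twoSided jA jB cA cB '' (Ioo (-2 : ℝ) 2 ×ˢ univ) := by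
  rw [G.gluing.right_mem_image_iff G.left.toIsTopCollar G.right.toIsTopCollar le_rfl]
  have h1 := G.right.symm_nonneg hb
  have h2 := G.right.symm_lt_two hb
  exact ⟨hb, ⟨by linarith, h2⟩, trivial⟩

theorem exists_mem_chart_of_mem_image (J : (ℝ × V) ≃L[ℝ] E) {z : X}
    (hz : z ∈ twoSided jA jB cA cB '' (Ioo (-2 : ℝ) 2 ×ˢ univ)) :
    ∃ i, z ∈ (G.chart J (G.preferredIndex hρ i)).source := by
  obtain ⟨p, hp, rfl⟩ := hz
  refine ⟨.inr (.inr p.2), mem_pieceChart_source.2 ⟨⟨p, hp, rfl⟩, ?_⟩⟩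
  have : (G.centerPiece p.2).symm (twoSided jA jB cA cB p) = p := (G.centerPiece p.2).left_inv hp
  rw [this]
  refine ⟨⟨trivial, mem_chart_source V p.2⟩, ?_⟩
  rw [ModelWithCorners.Boundaryless.range_eq_univ, interior_univ]
  trivial

theorem exists_mem_chart (J : (ℝ × V) ≃L[ℝ] E) (z : X) :
    ∃ i, z ∈ (G.chart J (G.preferredIndex hρ i)).source := by
  rcases G.gluing.cover z with ⟨a, rfl⟩ | ⟨b, rfl⟩
  · by_cases ha : a ∈ thinCollar cA ρ
    · exact G.exists_mem_chart_of_mem_image hρ J (G.mem_image_twoSided_left ha.1)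
    · refine ⟨.inl a, mem_pieceChart_source.2 ⟨⟨a, ha, rfl⟩, ?_⟩⟩
      have : (G.leftPiece a (G.leftOpen hρ).1 (G.leftOpen hρ).2).symm (jA a) = a :=
        (G.leftPiece a (G.leftOpen hρ).1 (G.leftOpen hρ).2).left_inv ha
      rw [this]
      exact ⟨mem_chart_source H a, (G.leftOpen hρ).2 ha⟩
  · by_cases hb : b ∈ thinCollar cB ρ
    · exact G.exists_mem_chart_of_mem_image hρ J (G.mem_image_twoSided_right hb.1)
    · refine ⟨.inr (.inl b), mem_pieceChart_source.2 ⟨⟨b, hb, rfl⟩, ?_⟩⟩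
      have : (G.rightPiece b (G.rightOpen hρ).1 (G.rightOpen hρ).2).symm (jB b) = b :=
        (G.rightPiece b (G.rightOpen hρ).1 (G.rightOpen hρ).2).left_inv hb
      rw [this]
      exact ⟨mem_chart_source H b, (G.rightOpen hρ).2 hb⟩

/-- The glued space carries a smooth structure whose preferred charts are those with a given
width. -/
theorem exists_chartedSpace (J : (ℝ × V) ≃L[ℝ] E) :
    ∃ _ : ChartedSpace E X, IsManifold 𝓘(ℝ, E) ∞ X ∧
      (∀ k : G.ChartIndex, G.chart J k ∈ IsManifold.maximalAtlas 𝓘(ℝ, E) ∞ X) ∧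
      ∀ z : X, ∃ i, chartAt E z = G.chart J (G.preferredIndex hρ i) := by
  -- The atlas ranges over all indices, but the preferred charts are drawn only from those attached
  -- to the width ρ. The bivector field will be defined by one formula on each of these.
  let κ : X → G.ChartIndex := fun z => G.preferredIndex hρ (G.exists_mem_chart hρ J z).choose
  have hκ : ∀ z, z ∈ (G.chart J (κ z)).source := fun z => (G.exists_mem_chart hρ J z).choose_spec
  let := chartedSpaceOfIndex (G.chart J) κ hκ
  have hM : IsManifold 𝓘(ℝ, E) ∞ X :=
    isManifold_chartedSpaceOfIndex (G.chart J) κ hκ (G.contDiffOn_chart_transition J)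
  exact ⟨this, hM, fun k => IsManifold.subset_maximalAtlas ⟨k, rfl⟩, fun z => ⟨_, rfl⟩⟩

end IsCollarGluing

end CollarGluing

/-! ### Existence of a smooth width function. -/

section Width

variable {E : Type*} [NormedAddCommGroup E] [NormedSpace ℝ E]
  {H : Type*} [TopologicalSpace H] {I : ModelWithCorners ℝ E H}
  {V : Type*} [NormedAddCommGroup V] [NormedSpace ℝ V] [FiniteDimensional ℝ V]
  {N A B X : Type*} [TopologicalSpace N] [TopologicalSpace A] [TopologicalSpace B]
  [TopologicalSpace X] [ChartedSpace V N] [ChartedSpace H A] [ChartedSpace H B]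
  [IsManifold 𝓘(ℝ, V) ∞ N] [T2Space N] [SigmaCompactSpace N] [NormalSpace A] [NormalSpace B]
  {jA : A → X} {jB : B → X} {cA : PartialEquiv (ℝ × N) A} {cB : PartialEquiv (ℝ × N) B}

/-- By normality each boundary has a neighbourhood whose closure stays inside its collar. Near each
x some constant width keeps both collars in these neighbourhoods. The admissible widths at a point
form an interval, so the local constants are averaged by a smooth partition of unity. -/
theorem IsCollarGluing.exists_isWidth (G : IsCollarGluing I V jA jB cA cB) :
    ∃ ρ : N → ℝ, G.IsWidth ρ := by
  obtain ⟨U, hU, hcU, hUt⟩ := G.left.exists_closure_subset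
  obtain ⟨U', hU', hcU', hUt'⟩ := G.right.exists_closure_subset
  let t : N → Set ℝ := fun x =>
    {r | 0 < r ∧ ∀ s ∈ Icc 0 r, cA (s, x) ∈ U ∧ cB (s, x) ∈ U'}
  have ht : ∀ x, Convex ℝ (t x) := fun x => by
    refine OrdConnected.convex ⟨?_⟩
    rintro r ⟨hr, -⟩ r' ⟨-, hr'⟩ r'' ⟨h1, h2⟩
    exact ⟨hr.trans_le h1, fun s hs => hr' s ⟨hs.1, hs.2.trans h2⟩⟩
  obtain ⟨ρ, hρ⟩ := exists_contMDiffMap_forall_mem_convex_of_local_const 𝓘(ℝ, V) (n := (⊤ : ℕ∞)) ht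
    (fun x => by
      obtain ⟨ε, hε, h⟩ := G.left.eventually_forall_Icc_mem hU hcU x
      obtain ⟨ε', hε', h'⟩ := G.right.eventually_forall_Icc_mem hU' hcU' x
      -- The local estimates hold for t in a half-open interval; halving gives room for the closed
      -- interval [0, r] required of a width.
      refine ⟨min ε ε' / 2, ?_⟩
      filter_upwards [h, h'] with y hy hy'
      have hm : 0 < min ε ε' := lt_min hε hε'
      exact ⟨half_pos hm, fun s hs =>
        ⟨hy s ⟨hs.1, (hs.2.trans_lt (half_lt_self hm)).trans_le (min_le_left _ _)⟩,
          hy' s ⟨hs.1, (hs.2.trans_lt (half_lt_self hm)).trans_le (min_le_right _ _)⟩⟩⟩)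
  exact ⟨ρ, fun x => (hρ x).1, ρ.contMDiff,
    G.left.isClosed_sublevel hUt ρ.contMDiff.continuous fun x s hs => ((hρ x).2 s hs).1,
    G.right.isClosed_sublevel hUt' ρ.contMDiff.continuous fun x s hs => ((hρ x).2 s hs).2⟩

end Width

/-! ### Reduction of the b-symplectic conditions to preferred charts. -/

section FromCharts

theorem pairingDual_comp {V V' : Type*} [AddCommGroup V] [Module ℝ V] [AddCommGroup V']
    [Module ℝ V'] (ξ η : V' →ₗ[ℝ] ℝ) (T : V →ₗ[ℝ] V') (z : ⋀[ℝ]^2 V) :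
    exteriorPower.pairingDual ℝ V 2 (exteriorPower.ιMulti ℝ 2 ![ξ ∘ₗ T, η ∘ₗ T]) z
      = exteriorPower.pairingDual ℝ V' 2 (exteriorPower.ιMulti ℝ 2 ![ξ, η])
        (exteriorPower.map 2 T z) := by
  have h : exteriorPower.pairingDual ℝ V 2 (exteriorPower.ιMulti ℝ 2 ![ξ ∘ₗ T, η ∘ₗ T])
      = exteriorPower.pairingDual ℝ V' 2 (exteriorPower.ιMulti ℝ 2 ![ξ, η])
        ∘ₗ exteriorPower.map 2 T := by
    apply exteriorPower.linearMap_ext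
    ext v
    simp [exteriorPower.pairingDual_ιMulti_ιMulti, Matrix.det_fin_two]
  rw [h]
  rfl

variable {E : Type*} [NormedAddCommGroup E] [NormedSpace ℝ E] [FiniteDimensional ℝ E]
  {X : Type*} [TopologicalSpace X] [ChartedSpace E X]

theorem inChart_wedgePow (P : MultivectorField 𝓘(ℝ, E) X 2) (n : ℕ) (x₀ : X) (y : E) :
    (P.wedgePow n).inChart x₀ y = bivectorPow (P.inChart x₀ y) n :=
  map_bivectorPow _ _ _

theorem bracket_eq_of_mfderiv {P : MultivectorField 𝓘(ℝ, E) X 2} {x₀ : X} {y : E}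
    {A : (E →L[ℝ] ℝ) →L[ℝ] E} (hA : IsSkewSharp A) (hP : P.inChart x₀ y = bivector A)
    {f g : X → ℝ} {ξ η : E →L[ℝ] ℝ}
    (hf : HasMFDerivAt 𝓘(ℝ, E) 𝓘(ℝ, ℝ) f ((extChartAt 𝓘(ℝ, E) x₀).symm y)
      (ξ ∘L mfderiv 𝓘(ℝ, E) 𝓘(ℝ, E) (extChartAt 𝓘(ℝ, E) x₀) ((extChartAt 𝓘(ℝ, E) x₀).symm y)))
    (hg : HasMFDerivAt 𝓘(ℝ, E) 𝓘(ℝ, ℝ) g ((extChartAt 𝓘(ℝ, E) x₀).symm y)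
      (η ∘L mfderiv 𝓘(ℝ, E) 𝓘(ℝ, E) (extChartAt 𝓘(ℝ, E) x₀) ((extChartAt 𝓘(ℝ, E) x₀).symm y))) :
    P.bracket f g ((extChartAt 𝓘(ℝ, E) x₀).symm y) = η (A ξ) := by
  rw [MultivectorField.bracket, hf.mfderiv, hg.mfderiv, ← pairingDual_bivector hA, ← hP]
  exact pairingDual_comp _ _ _ _

variable [IsManifold 𝓘(ℝ, E) ∞ X]

theorem hasMFDerivAt_of_chart {x₀ : X} {y : E} (hy : y ∈ (extChartAt 𝓘(ℝ, E) x₀).target)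
    {f : X → ℝ} {u : E → ℝ} (hu : DifferentiableAt ℝ u y)
    (hfu : ∀ z ∈ (extChartAt 𝓘(ℝ, E) x₀).target, f ((extChartAt 𝓘(ℝ, E) x₀).symm z) = u z) :
    HasMFDerivAt 𝓘(ℝ, E) 𝓘(ℝ, ℝ) f ((extChartAt 𝓘(ℝ, E) x₀).symm y)
      (fderiv ℝ u y ∘L
        mfderiv 𝓘(ℝ, E) 𝓘(ℝ, E) (extChartAt 𝓘(ℝ, E) x₀) ((extChartAt 𝓘(ℝ, E) x₀).symm y)) := by
  have hx : (extChartAt 𝓘(ℝ, E) x₀).symm y ∈ (extChartAt 𝓘(ℝ, E) x₀).source :=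
    (extChartAt 𝓘(ℝ, E) x₀).map_target hy
  have hφ : MDifferentiableAt 𝓘(ℝ, E) 𝓘(ℝ, E) (extChartAt 𝓘(ℝ, E) x₀)
      ((extChartAt 𝓘(ℝ, E) x₀).symm y) :=
    mdifferentiableAt_extChartAt (extChartAt_source 𝓘(ℝ, E) x₀ ▸ hx)
  have hu' : HasMFDerivAt 𝓘(ℝ, E) 𝓘(ℝ, ℝ) u
      (extChartAt 𝓘(ℝ, E) x₀ ((extChartAt 𝓘(ℝ, E) x₀).symm y)) (fderiv ℝ u y) := by
    rw [(extChartAt 𝓘(ℝ, E) x₀).right_inv hy]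
    exact hu.hasFDerivAt.hasMFDerivAt
  refine (hu'.comp _ hφ.hasMFDerivAt).congr_of_eventuallyEq ?_
  filter_upwards [(isOpen_extChartAt_source (I := 𝓘(ℝ, E)) x₀).mem_nhds hx] with z hz
  have := hfu _ ((extChartAt 𝓘(ℝ, E) x₀).map_source hz)
  rwa [(extChartAt 𝓘(ℝ, E) x₀).left_inv hz] at this

/-- A bivector field is `b`-symplectic if it is in every preferred chart. -/
theorem isBSymplectic_of_inChart {n : ℕ} {P : MultivectorField 𝓘(ℝ, E) X 2}
    (h : ∀ x₀ : X, ∃ A : E → (E →L[ℝ] ℝ) →L[ℝ] E,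
      IsLocalBSymplectic n A (extChartAt 𝓘(ℝ, E) x₀).target ∧
      ∀ y ∈ (extChartAt 𝓘(ℝ, E) x₀).target, P.inChart x₀ y = bivector (A y)) :
    P.IsBSymplectic n := by
  refine ⟨⟨fun x₀ l => ?_, fun f g k hf hg hk x => ?_⟩, fun x₀ y hy h0 l hl => ?_⟩
  · obtain ⟨A, hA, hP⟩ := h x₀
    exact (contDiffOn_functional_bivector hA.contDiffOn l).congr fun y hy => by rw [hP y hy]
  · obtain ⟨A, hA, hP⟩ := h x
    set φ := extChartAt 𝓘(ℝ, E) x with hφ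
    have ht : IsOpen φ.target := isOpen_extChartAt_target x
    have hc : ∀ {u : X → ℝ}, ContMDiff 𝓘(ℝ, E) 𝓘(ℝ, ℝ) ∞ u →
        ContDiffOn ℝ ∞ (u ∘ φ.symm) φ.target := fun hu =>
      (hu.comp_contMDiffOn (contMDiffOn_extChartAt_symm x)).contDiffOn
    -- The local representatives u', v' are kept separate from u, v so that the same identity also
    -- applies when v is itself a bracket, known only through its expression in the chart.
    have hb : ∀ {u v : X → ℝ} {u' v' : E → ℝ}, ContDiffOn ℝ ∞ u' φ.target →
        ContDiffOn ℝ ∞ v' φ.target → (∀ z ∈ φ.target, u (φ.symm z) = u' z) →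
        (∀ z ∈ φ.target, v (φ.symm z) = v' z) →
        ∀ y ∈ φ.target, P.bracket u v (φ.symm y) = localBracket A u' v' y :=
      fun hu' hv' hu hv y hy => bracket_eq_of_mfderiv (hA.skew y hy) (hP y hy)
        (hasMFDerivAt_of_chart hy ((hu'.contDiffAt (ht.mem_nhds hy)).differentiableAt (by simp)) hu)
        (hasMFDerivAt_of_chart hy ((hv'.contDiffAt (ht.mem_nhds hy)).differentiableAt (by simp)) hv)
    have hbs : ∀ {u' v' : E → ℝ}, ContDiffOn ℝ ∞ u' φ.target →
        ContDiffOn ℝ ∞ v' φ.target → ContDiffOn ℝ ∞ (localBracket A u' v') φ.target :=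
      fun hu hv => contDiffOn_localBracket ht hA.contDiffOn hu hv
    have hx : φ x ∈ φ.target := φ.map_source (mem_extChartAt_source x)
    have hJ := hA.jacobi _ _ _ (hc hf) (hc hg) (hc hk) (φ x) hx
    have e := fun z (_ : z ∈ φ.target) => rfl (a := (f ∘ φ.symm) z)
    have e' := fun z (_ : z ∈ φ.target) => rfl (a := (g ∘ φ.symm) z)
    have e'' := fun z (_ : z ∈ φ.target) => rfl (a := (k ∘ φ.symm) z)
    rw [← hb (hc hf) (hbs (hc hg) (hc hk)) e (hb (hc hg) (hc hk) e' e'') _ hx,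
      ← hb (hc hg) (hbs (hc hk) (hc hf)) e' (hb (hc hk) (hc hf) e'' e) _ hx,
      ← hb (hc hk) (hbs (hc hf) (hc hg)) e'' (hb (hc hf) (hc hg) e e') _ hx,
      φ.left_inv (mem_extChartAt_source x)] at hJ
    exact hJ
  · obtain ⟨A, hA, hP⟩ := h x₀
    have ht : IsOpen (extChartAt 𝓘(ℝ, E) x₀).target := isOpen_extChartAt_target x₀
    have heq : ∀ z ∈ (extChartAt 𝓘(ℝ, E) x₀).target,
        (P.wedgePow n).inChart x₀ z = bivectorPow (bivector (A z)) n := fun z hz => by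
      rw [inChart_wedgePow, hP z hz]
    rw [fderivWithin_of_isOpen ht hy]
    have : (fun z => l ((P.wedgePow n).inChart x₀ z))
        =ᶠ[nhds y] fun z => l (bivectorPow (bivector (A z)) n) := by
      filter_upwards [ht.mem_nhds hy] with z hz
      rw [heq z hz]
    rw [this.fderiv_eq]
    exact hA.transverse y hy (heq y hy ▸ h0) l hl

end FromCharts

/-! ### Manifold derivatives as maps between the model spaces. -/

section LocalInverse

variable {E : Type*} [NormedAddCommGroup E] [NormedSpace ℝ E]
  {H : Type*} [TopologicalSpace H] {I : ModelWithCorners ℝ E H}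
  {M : Type*} [TopologicalSpace M] [ChartedSpace H M]
  {E' : Type*} [NormedAddCommGroup E'] [NormedSpace ℝ E']
  {H' : Type*} [TopologicalSpace H'] {I' : ModelWithCorners ℝ E' H'}
  {M' : Type*} [TopologicalSpace M'] [ChartedSpace H' M']

/-- The manifold derivative as a map between model spaces. -/
def modelDeriv (I : ModelWithCorners ℝ E H) (I' : ModelWithCorners ℝ E' H') (f : M → M') (p : M) :
    E →L[ℝ] E' :=
  mfderiv I I' f p

theorem HasMFDerivAt.modelDeriv_eq {f : M → M'} {p : M} {T : E →L[ℝ] E'}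
    (h : HasMFDerivAt I I' f p T) : modelDeriv I I' f p = T := h.mfderiv

theorem HasMFDerivAt.comp_model {E'' : Type*} [NormedAddCommGroup E''] [NormedSpace ℝ E'']
    {H'' : Type*} [TopologicalSpace H''] {I'' : ModelWithCorners ℝ E'' H''}
    {M'' : Type*} [TopologicalSpace M''] [ChartedSpace H'' M''] {g : M' → M''} {f : M → M'} {p : M}
    {T' : E' →L[ℝ] E''} {T : E →L[ℝ] E'} (hg : HasMFDerivAt I' I'' g (f p) T')
    (hf : HasMFDerivAt I I' f p T) : HasMFDerivAt I I'' (g ∘ f) p (T' ∘L T) :=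
  hg.comp p hf

/-- The derivative of a differentiable map, as a map between model spaces. -/
theorem MDifferentiableAt.exists_model {f : M → M'} {p : M} (h : MDifferentiableAt I I' f p) :
    ∃ T : E →L[ℝ] E', HasMFDerivAt I I' f p T ∧ modelDeriv I I' f p = T :=
  ⟨mfderiv I I' f p, h.hasMFDerivAt, rfl⟩

/-- The value of a form as a form on the model space. -/
def DiffForm.model {k : ℕ} (Ω : DiffForm I M k) (p : M) : E [⋀^Fin k]→L[ℝ] ℝ := Ω p

/-- The derivatives of local inverses, as mutually inverse equivalences. -/
theorem exists_equiv_hasMFDerivAt {f : M → M'} {g : M' → M} {p : M} {p' : M'} (hp : f p = p')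
    (hf : MDifferentiableAt I I' f p) (hg : MDifferentiableAt I' I g p')
    (hgf : ∀ᶠ x in nhds p, g (f x) = x) (hfg : ∀ᶠ x in nhds p', f (g x) = x) :
    ∃ T : E ≃L[ℝ] E', HasMFDerivAt I I' f p (T : E →L[ℝ] E') ∧
      HasMFDerivAt I' I g p' (T.symm : E' →L[ℝ] E) := by
  subst hp
  have hp : g (f p) = p := hgf.self_of_nhds
  have hf' : HasMFDerivAt I I' f (g (f p)) (mfderiv I I' f p) := by
    rw [hp]; exact hf.hasMFDerivAt
  have h1 : (mfderiv I' I g (f p) : E' →L[ℝ] E) ∘L (mfderiv I I' f p : E →L[ℝ] E')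
      = .id ℝ E := by
    have h2 : HasMFDerivAt I I (g ∘ f) p (ContinuousLinearMap.id ℝ E) :=
      (hasMFDerivAt_id p).congr_of_eventuallyEq hgf
    exact hasMFDerivAt_unique (hg.hasMFDerivAt.comp p hf.hasMFDerivAt) h2
  have h2 : (mfderiv I I' f p : E →L[ℝ] E') ∘L (mfderiv I' I g (f p) : E' →L[ℝ] E)
      = .id ℝ E' := by
    have h2 : HasMFDerivAt I' I' (f ∘ g) (f p) (ContinuousLinearMap.id ℝ E') :=
      (hasMFDerivAt_id (f p)).congr_of_eventuallyEq hfg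
    exact hasMFDerivAt_unique (hf'.comp (f p) hg.hasMFDerivAt) h2
  refine ⟨ContinuousLinearEquiv.equivOfInverse (mfderiv I I' f p : E →L[ℝ] E')
    (mfderiv I' I g (f p) : E' →L[ℝ] E) (fun v => DFunLike.congr_fun h1 v)
    (fun v => DFunLike.congr_fun h2 v), hf.hasMFDerivAt, hg.hasMFDerivAt⟩

end LocalInverse

/-! ### A symplectic form and its inverse in interior charts. -/

section SideChart

variable {E : Type*} [NormedAddCommGroup E] [NormedSpace ℝ E]
  {H : Type*} [TopologicalSpace H] {I : ModelWithCorners ℝ E H}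
  {M : Type*} [TopologicalSpace M] [ChartedSpace H M] [IsManifold I ∞ M]

/-- The derivative of a chart and of its inverse at an interior point. -/
theorem exists_equiv_chart {m : M} {y : E} (hy : y ∈ interior (range I))
    (hyt : y ∈ (extChartAt I m).target) :
    ∃ T : E ≃L[ℝ] E,
      HasMFDerivAt 𝓘(ℝ, E) I (extChartAt I m).symm y (T : E →L[ℝ] E) ∧
      HasMFDerivAt I 𝓘(ℝ, E) (extChartAt I m) ((extChartAt I m).symm y) (T.symm : E →L[ℝ] E) := by
  have hm := (extChartAt I m).map_target hyt
  refine exists_equiv_hasMFDerivAt rfl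
    ((contMDiffAt_extChartAt_symm_of_interior hy hyt).mdifferentiableAt (by simp))
    (mdifferentiableAt_extChartAt (extChartAt_source I m ▸ hm)) ?_ ?_
  · filter_upwards [extChartAt_target_mem_nhds_of_interior hy hyt] with z hz
    exact (extChartAt I m).right_inv hz
  · filter_upwards [(isOpen_extChartAt_source (I := I) m).mem_nhds hm] with z hz
    exact (extChartAt I m).left_inv hz

theorem inChart_eq_of_hasMFDerivAt {k : ℕ} (Ω : DiffForm I M k) {m : M} {y : E}
    (hy : y ∈ interior (range I)) (hyt : y ∈ (extChartAt I m).target) {T : E →L[ℝ] E}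
    (hT : HasMFDerivAt 𝓘(ℝ, E) I (extChartAt I m).symm y T) :
    Ω.inChart m y = (Ω.model ((extChartAt I m).symm y)).compContinuousLinearMap T := by
  have h : mfderivWithin 𝓘(ℝ, E) I (extChartAt I m).symm (extChartAt I m).target y = T := by
    rw [mfderivWithin_of_mem_nhds (extChartAt_target_mem_nhds_of_interior hy hyt), hT.mfderiv]
  unfold DiffForm.inChart DiffForm.pullback
  rw [h]
  rfl

variable [FiniteDimensional ℝ E]

theorem formNondeg_inChart {Ω : DiffForm I M 2} (hΩ : Ω.IsSymplectic) {m : M} {y : E}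
    (hy : y ∈ interior (range I)) (hyt : y ∈ (extChartAt I m).target) :
    FormNondeg (Ω.inChart m y) := by
  obtain ⟨T, hT, -⟩ := exists_equiv_chart hy hyt
  rw [inChart_eq_of_hasMFDerivAt Ω hy hyt hT]
  exact FormNondeg.comp_equiv (V := E) (V' := E) (σ' := Ω.model _) (hΩ.nondegenerate _) T

theorem pushSharp_mfderiv_sharpForm {Ω : DiffForm I M 2} (hΩ : Ω.IsSymplectic) {m : M} {y : E}
    (hy : y ∈ interior (range I)) (hyt : y ∈ (extChartAt I m).target) :
    pushSharp (modelDeriv I 𝓘(ℝ, E) (extChartAt I m) ((extChartAt I m).symm y))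
      (sharpForm (Ω.model ((extChartAt I m).symm y))) = sharpForm (Ω.inChart m y) := by
  have hnd := formNondeg_inChart hΩ hy hyt
  obtain ⟨T, hT, hT'⟩ := exists_equiv_chart hy hyt
  have h : ContinuousAlternatingMap.compContinuousLinearMap (Ω.inChart m y) (T.symm : E →L[ℝ] E)
      = Ω.model ((extChartAt I m).symm y) := by
    rw [inChart_eq_of_hasMFDerivAt Ω hy hyt hT]
    ext v
    simp only [ContinuousAlternatingMap.compContinuousLinearMap_apply]
    congr 1
    funext i
    exact T.apply_symm_apply (v i)
  rw [hT'.modelDeriv_eq, ← pushSharp_sharpForm hnd T.symm, h]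

/-- At interior points the chart target is a neighbourhood, so the derivative within it is the
ordinary one. Closedness in the sense of manifolds with boundary then gives the hypothesis of
`isLocalBSymplectic_sharpForm`. -/
theorem isLocalBSymplectic_inChart {n : ℕ} (hn : Module.finrank ℝ E = 2 * n)
    {Ω : DiffForm I M 2} (hΩ : Ω.IsSymplectic) {m : M} {s : Set E} (hs : IsOpen s)
    (h : s ⊆ interior (range I) ∩ (extChartAt I m).target) :
    IsLocalBSymplectic n (fun y => sharpForm (Ω.inChart m y)) s := by
  refine isLocalBSymplectic_sharpForm hn hs ((hΩ.smooth m).mono fun y hy => (h hy).2)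
    (fun y hy => formNondeg_inChart hΩ (h hy).1 (h hy).2) fun y hy => ?_
  rw [← hΩ.closed m y (h hy).2]
  rw [extDeriv, extDerivWithin, fderivWithin_of_mem_nhds
    (extChartAt_target_mem_nhds_of_interior (h hy).1 (h hy).2)]

end SideChart

/-! ### Pushing fields from a piece to the glued space. -/

section PieceField

variable {E : Type*} [NormedAddCommGroup E] [NormedSpace ℝ E]
  {H : Type*} [TopologicalSpace H] {I : ModelWithCorners ℝ E H}
  {M : Type*} [TopologicalSpace M] [ChartedSpace H M]
  {E₀ : Type*} [NormedAddCommGroup E₀] [NormedSpace ℝ E₀]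
  {X : Type*} [TopologicalSpace X] [ChartedSpace E₀ X]

/-- The field on `X` obtained from a field `A` on `M` by pushing forward along `e`. -/
def pushField (I : ModelWithCorners ℝ E H) (e : OpenPartialHomeomorph M X)
    (A : M → (E →L[ℝ] ℝ) →L[ℝ] E) (w : X) : (E₀ →L[ℝ] ℝ) →L[ℝ] E₀ :=
  pushSharp (modelDeriv I 𝓘(ℝ, E₀) e (e.symm w)) (A (e.symm w))

theorem pushField_apply {e : OpenPartialHomeomorph M X} {A : M → (E →L[ℝ] ℝ) →L[ℝ] E} {m : M}
    (hm : m ∈ e.source) : pushField I e A (e m)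
      = pushSharp (modelDeriv I 𝓘(ℝ, E₀) e m) (A m) := by
  rw [pushField, e.left_inv hm]

/-- On an overlap e = e' ∘ (e'⁻¹ ∘ e), so by the chain rule the two push-forwards agree as soon as
the transition carries one field to the other. -/
theorem pushField_eq_pushField {E' : Type*} [NormedAddCommGroup E'] [NormedSpace ℝ E']
    {H' : Type*} [TopologicalSpace H'] {I' : ModelWithCorners ℝ E' H'}
    {M' : Type*} [TopologicalSpace M'] [ChartedSpace H' M']
    {e : OpenPartialHomeomorph M X} {e' : OpenPartialHomeomorph M' X}
    (he' : ContMDiffOn I' 𝓘(ℝ, E₀) ∞ e' e'.source)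
    {A : M → (E →L[ℝ] ℝ) →L[ℝ] E} {A' : M' → (E' →L[ℝ] ℝ) →L[ℝ] E'} {m : M}
    (hm : m ∈ e.source) (hm' : e m ∈ e'.target) {T : E →L[ℝ] E'}
    (hT : HasMFDerivAt I I' (e'.symm ∘ e) m T) (hA : A' ((e'.symm ∘ e) m) = pushSharp T (A m)) :
    pushField I' e' A' (e m) = pushField (E₀ := E₀) I e A (e m) := by
  have hs : (e'.symm ∘ e) m ∈ e'.source := e'.map_target hm'
  have hd : MDifferentiableAt I' 𝓘(ℝ, E₀) e' ((e'.symm ∘ e) m) :=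
    ((he' _ hs).contMDiffAt (e'.open_source.mem_nhds hs)).mdifferentiableAt (by simp)
  obtain ⟨D, hD, hD'⟩ := hd.exists_model
  have hev : ⇑e =ᶠ[nhds m] e' ∘ (e'.symm ∘ e) := by
    filter_upwards [(e.isOpen_inter_preimage e'.open_target).mem_nhds ⟨hm, hm'⟩] with z hz
    exact (e'.right_inv hz.2).symm
  have hc := HasMFDerivAt.comp_model (g := e') (f := e'.symm ∘ e) hD hT
  have h : modelDeriv I 𝓘(ℝ, E₀) e m = D ∘L T := (hc.congr_of_eventuallyEq hev).mfderiv
  rw [pushField_apply hm, h, ← pushSharp_pushSharp, ← hA, ← hD']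
  rfl

variable [IsManifold I ∞ M] [IsManifold 𝓘(ℝ, E₀) ∞ X] [FiniteDimensional ℝ E₀]

omit [IsManifold 𝓘(ℝ, E₀) ∞ X] [FiniteDimensional ℝ E₀] in
theorem inChart_eq_map {k : ℕ} {P : MultivectorField 𝓘(ℝ, E₀) X k} {x₀ w : X} {y : E₀}
    (hw : (extChartAt 𝓘(ℝ, E₀) x₀).symm y = w) {D : E₀ →L[ℝ] E₀}
    (hD : HasMFDerivAt 𝓘(ℝ, E₀) 𝓘(ℝ, E₀) (extChartAt 𝓘(ℝ, E₀) x₀) w D) {Q : ⋀[ℝ]^k E₀}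
    (hQ : P w = Q) : P.inChart x₀ y = exteriorPower.map k (D : E₀ →ₗ[ℝ] E₀) Q := by
  subst hw hQ
  unfold MultivectorField.inChart
  rw [hD.mfderiv]
  rfl

/-- In a preferred chart built from the piece itself the parametrisation e cancels: the derivative
of the chart after that of e is J after the derivative of the original chart of M. The field on X is
thereby computed entirely on M. -/
theorem inChart_eq_of_chartAt_eq {e : OpenPartialHomeomorph M X}
    (he : ContMDiffOn I 𝓘(ℝ, E₀) ∞ e e.source) {m : M} {J : E ≃L[ℝ] E₀} {x₀ : X}
    (hx : chartAt E₀ x₀ = pieceChart e I m J) {P : MultivectorField 𝓘(ℝ, E₀) X 2}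
    {A : M → (E →L[ℝ] ℝ) →L[ℝ] E} (hP : ∀ w ∈ e.target, P w = (bivector (V := E₀) (pushField I e A w) : ⋀[ℝ]^2 E₀))
    {y : E₀} (hy : y ∈ (pieceChart e I m J).target) :
    P.inChart x₀ y = bivector (pushSharp ((J : E →L[ℝ] E₀) ∘L
        modelDeriv I 𝓘(ℝ, E) (extChartAt I m) ((extChartAt I m).symm (J.symm y)))
      (A ((extChartAt I m).symm (J.symm y)))) := by
  have hy' := mem_pieceChart_target.1 hy
  have hφ : ⇑(extChartAt 𝓘(ℝ, E₀) x₀) = pieceChart e I m J := by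
    rw [← hx]; rfl
  have hφs : ⇑(extChartAt 𝓘(ℝ, E₀) x₀).symm = (pieceChart e I m J).symm := by
    rw [← hx]; rfl
  set z := (extChartAt I m).symm (J.symm y) with hz
  have hw : (extChartAt 𝓘(ℝ, E₀) x₀).symm y = e z := by rw [hφs]; rfl
  have hzs : z ∈ (extChartAt I m).source := (extChartAt I m).map_target hy'.2.1
  have hws : e z ∈ (extChartAt 𝓘(ℝ, E₀) x₀).source := by
    rw [extChartAt_source, hx, ← hw, hφs]
    exact (pieceChart e I m J).map_target hy
  have h1 : MDifferentiableAt 𝓘(ℝ, E₀) 𝓘(ℝ, E₀) (extChartAt 𝓘(ℝ, E₀) x₀) (e z) :=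
    mdifferentiableAt_extChartAt (extChartAt_source 𝓘(ℝ, E₀) x₀ ▸ hws)
  have h2 : MDifferentiableAt I 𝓘(ℝ, E₀) e z :=
    ((he _ hy'.2.2).contMDiffAt (e.open_source.mem_nhds hy'.2.2)).mdifferentiableAt (by simp)
  have h3 : MDifferentiableAt I 𝓘(ℝ, E) (extChartAt I m) z :=
    mdifferentiableAt_extChartAt (extChartAt_source I m ▸ hzs)
  have h4 : HasMFDerivAt 𝓘(ℝ, E) 𝓘(ℝ, E₀) J (extChartAt I m z) (J : E →L[ℝ] E₀) :=
    J.hasFDerivAt.hasMFDerivAt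
  obtain ⟨D₁, hD₁, -⟩ := h1.exists_model
  obtain ⟨D₂, hD₂, hD₂'⟩ := h2.exists_model
  obtain ⟨D₃, hD₃, hD₃'⟩ := h3.exists_model
  have hev : extChartAt 𝓘(ℝ, E₀) x₀ ∘ e =ᶠ[nhds z] J ∘ extChartAt I m := by
    filter_upwards [e.open_source.mem_nhds hy'.2.2] with z' hz'
    rw [comp_apply, hφ, pieceChart_apply, e.left_inv hz']
    rfl
  have h5 := (HasMFDerivAt.comp_model (g := J) (f := extChartAt I m) h4 hD₃).congr_of_eventuallyEq
    hev
  have h6 : D₁ ∘L D₂ = (J : E →L[ℝ] E₀) ∘L D₃ := hasMFDerivAt_unique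
    (HasMFDerivAt.comp_model (g := extChartAt 𝓘(ℝ, E₀) x₀) (f := e) hD₁ hD₂) h5
  have h8 : P (e z) = (bivector (V := E₀) (pushSharp D₂ (A z)) : ⋀[ℝ]^2 E₀) := by
    have h7 : pushField I e A (e z) = pushSharp D₂ (A z) := by
      rw [pushField_apply hy'.2.2, hD₂']
    have h8 := hP _ (e.map_source hy'.2.2)
    rw [h7] at h8
    exact h8
  clear_value z
  have h9 : P.inChart x₀ y = exteriorPower.map 2 (D₁ : E₀ →ₗ[ℝ] E₀)
      (bivector (V := E₀) (pushSharp D₂ (A z))) :=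
    inChart_eq_map (P := P) (x₀ := x₀) (w := e z) (y := y) hw (D := D₁) hD₁
      (Q := bivector (V := E₀) (pushSharp D₂ (A z))) h8
  rw [h9, map_bivector, pushSharp_pushSharp, h6, hD₃']

end PieceField

/-! ### Linear changes of coordinates for the sheared cylinder, and the logarithmic model. -/

section Transport

variable {E : Type*} [NormedAddCommGroup E] [NormedSpace ℝ E]
  {V : Type*} [NormedAddCommGroup V] [NormedSpace ℝ V]
  {E' : Type*} [NormedAddCommGroup E'] [NormedSpace ℝ E']
  {V' : Type*} [NormedAddCommGroup V'] [NormedSpace ℝ V']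
  {p : E →L[ℝ] ℝ} {q : E →L[ℝ] V} {e₀ : E} {p' : E' →L[ℝ] ℝ} {q' : E' →L[ℝ] V'} {e₀' : E'}
  {S : E' ≃L[ℝ] E} {R : V' →L[ℝ] V}

theorem comp_shear_eq (hp : ∀ w, p (S w) = p' w) (hq : ∀ w, q (S w) = R (q' w)) (he : S e₀' = e₀)
    (G : ℝ) (μ : V →L[ℝ] ℝ) :
    (S : E' →L[ℝ] E) ∘L shear p' q' e₀' G (μ ∘L R)
      = shear p q e₀ G μ ∘L (S : E' →L[ℝ] E) := by
  ext w
  simp [shear_apply, hp, hq, he]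

theorem cylForm_comp_eq (hp : ∀ w, p (S w) = p' w) (hq : ∀ w, q (S w) = R (q' w))
    (a : V →L[ℝ] ℝ) (θ : V [⋀^Fin 2]→L[ℝ] ℝ) :
    (cylForm p q a θ).compContinuousLinearMap (S : E' →L[ℝ] E)
      = cylForm p' q' (a ∘L R) (θ.compContinuousLinearMap R) := by
  ext v
  have : v = ![v 0, v 1] := by ext i; fin_cases i <;> rfl
  rw [this, compContinuousLinearMap_pair, cylForm_apply, cylForm_apply,
    compContinuousLinearMap_pair]
  simp [hp, hq]

/-- A linear equivalence that respects p, q and e₀ intertwines the two shears and pulls one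
cylindrical form back to the other, so it carries one sheared inverse to the other. -/
theorem pushSharp_shear_cylForm [FiniteDimensional ℝ E] [FiniteDimensional ℝ E']
    (hp : ∀ w, p (S w) = p' w) (hq : ∀ w, q (S w) = R (q' w)) (he : S e₀' = e₀)
    (G : ℝ) (μ a : V →L[ℝ] ℝ) (θ : V [⋀^Fin 2]→L[ℝ] ℝ) (hnd : FormNondeg (cylForm p q a θ)) :
    pushSharp (S : E' →L[ℝ] E) (pushSharp (shear p' q' e₀' G (μ ∘L R))
        (sharpForm (cylForm p' q' (a ∘L R) (θ.compContinuousLinearMap R))))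
      = pushSharp (shear p q e₀ G μ) (sharpForm (cylForm p q a θ)) := by
  rw [pushSharp_pushSharp, comp_shear_eq hp hq he, ← pushSharp_pushSharp,
    ← cylForm_comp_eq hp hq, pushSharp_sharpForm hnd]

theorem isLocalBSymplectic_logProfile [FiniteDimensional ℝ E] {n : ℕ}
    (hn : Module.finrank ℝ E = 2 * n)
    (hp : p e₀ = 1) (hq : q e₀ = 0) {s : Set E} (hs : IsOpen s) {t : Set V} (ht : IsOpen t)
    (hst : MapsTo q s t) {a : V → V →L[ℝ] ℝ} (ha : ContDiffOn ℝ ∞ a t)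
    (hac : ∀ x ∈ t, ∀ u v, fderiv ℝ a x u v = fderiv ℝ a x v u)
    {θ : V → V [⋀^Fin 2]→L[ℝ] ℝ} (hθ : ContDiffOn ℝ ∞ θ t) (hθc : ∀ x ∈ t, extDeriv θ x = 0)
    (hnd : ∀ y ∈ s, FormNondeg (cylForm p q (a (q y)) (θ (q y))))
    {ρ : V → ℝ} (hρ : ContDiffOn ℝ ∞ ρ t) (hρ0 : ∀ x ∈ t, 0 < ρ x) :
    IsLocalBSymplectic n (fun y => pushSharp (shear p q e₀ (logProfileG (p y, ρ (q y)))
        (logProfileB (p y, ρ (q y)) • fderiv ℝ ρ (q y)))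
      (sharpForm (cylForm p q (a (q y)) (θ (q y))))) s := by
  have hρAt : ∀ y ∈ s, ContDiffAt ℝ ∞ ρ (q y) := fun y hy => hρ.contDiffAt (ht.mem_nhds (hst hy))
  have hL : ∀ y ∈ s, ContDiffAt ℝ ∞ (fun y => (p y, ρ (q y))) y := fun y hy =>
    p.contDiff.contDiffAt.prodMk
      (ContDiffAt.comp (g := ρ) (f := q) y (hρAt y hy) q.contDiff.contDiffAt)
  have hL' : ∀ y ∈ s, HasFDerivAt (fun y => (p y, ρ (q y))) (p.prod (fderiv ℝ ρ (q y) ∘L q)) y :=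
    fun y hy => p.hasFDerivAt.prodMk (HasFDerivAt.comp (g := ρ) (f := q) y
      ((hρAt y hy).differentiableAt (by simp)).hasFDerivAt q.hasFDerivAt)
  have hz : ∀ y ∈ s, 0 < ((p y, ρ (q y)) : ℝ × ℝ).2 := fun y hy => hρ0 _ (hst hy)
  have hG : ∀ y ∈ s, ContDiffAt ℝ ∞ (fun y => logProfileG (p y, ρ (q y))) y := fun y hy =>
    ContDiffAt.comp (g := logProfileG) (f := fun y => (p y, ρ (q y))) y
      (contDiffAt_logProfileG (hz y hy)) (hL y hy)
  refine isLocalBSymplectic_cylinder (F := fun y => logProfile (p y, ρ (q y))) hn hp hq hs ht hst ha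
    hac hθ hθc hnd (fun y hy => (hG y hy).contDiffWithinAt) (fun y hy => ?_) (fun y hy h0 => ?_)
    (fun y hy h0 v => ?_) (fun y hy h0 => ?_) fun y hy h0 => ?_
  · have h1 : ContDiffAt ℝ ∞ (fun y => logProfileB (p y, ρ (q y))) y :=
      ContDiffAt.comp (g := logProfileB) (f := fun y => (p y, ρ (q y))) y
        (contDiffAt_logProfileB (hz y hy)) (hL y hy)
    have h2 : ContDiffAt ℝ ∞ (fun y => fderiv ℝ ρ (q y)) y :=
      ContDiffAt.comp (g := fderiv ℝ ρ) (f := q) y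
        ((hρ.fderiv_of_isOpen ht (by simp)).contDiffAt (ht.mem_nhds (hst hy)))
        q.contDiff.contDiffAt
    exact (h1.smul h2).contDiffWithinAt
  · exact ContDiffAt.comp (g := logProfile) (f := fun y => (p y, ρ (q y))) y
      (contDiffAt_logProfile (hz y hy) h0) (hL y hy)
  · have h1 : HasFDerivAt (fun y => logProfile (p y, ρ (q y)))
        (fderiv ℝ logProfile (p y, ρ (q y)) ∘L (p.prod (fderiv ℝ ρ (q y) ∘L q))) y :=
      HasFDerivAt.comp (g := logProfile) (f := fun y => (p y, ρ (q y))) y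
        ((contDiffAt_logProfile (hz y hy) h0).differentiableAt (by simp)).hasFDerivAt (hL' y hy)
    -- The map (p, ρ ∘ q) sends the sheared vector to (G p v + B dρ(q v), dρ(q v)), which is the
    -- direction along which dF has value p v.
    rw [h1.fderiv, ← fderiv_logProfile (hz y hy) h0 (p v) (fderiv ℝ ρ (q y) (q v))]
    rw [ContinuousLinearMap.comp_apply]
    congr 1
    ext
    · simp [shear_apply, hp]; ring
    · simp [shear_apply, hq]
  · exact (logProfileG_eq_zero_iff (hz y hy)).1 h0
  · have h1 : HasFDerivAt (fun y => logProfileG (p y, ρ (q y)))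
        (fderiv ℝ logProfileG (p y, ρ (q y)) ∘L (p.prod (fderiv ℝ ρ (q y) ∘L q))) y :=
      HasFDerivAt.comp (g := logProfileG) (f := fun y => (p y, ρ (q y))) y
        ((contDiffAt_logProfileG (hz y hy)).differentiableAt (by simp)).hasFDerivAt (hL' y hy)
    rw [h1.fderiv, fderiv_logProfileG (hz y hy) h0]
    simp [hp]

end Transport

/-! ### One-forms as covector fields. -/

section OneForms

variable {V : Type*} [NormedAddCommGroup V] [NormedSpace ℝ V]

/-- A `1`-form as a covector. -/
def covector (a : V [⋀^Fin 1]→L[ℝ] ℝ) : V →L[ℝ] ℝ :=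
  (ContinuousAlternatingMap.ofSubsingleton ℝ V ℝ (0 : Fin 1)).symm a

theorem covector_apply (a : V [⋀^Fin 1]→L[ℝ] ℝ) (v : V) : covector a v = a fun _ => v := rfl

theorem contDiff_covector {k : WithTop ℕ∞} : ContDiff ℝ k (covector (V := V)) :=
  (ContinuousAlternatingMap.ofSubsingletonLIE (𝕜 := ℝ) (E := V) (F := ℝ)
    (0 : Fin 1)).symm.contDiff

/-- On a pair of vectors, dα is the antisymmetrised derivative of the coefficients; its vanishing is
symmetry of that derivative, the form of closedness the cylinder model uses. -/
theorem fderiv_covector_symm {α : V → V [⋀^Fin 1]→L[ℝ] ℝ} {x : V} (hα : DifferentiableAt ℝ α x)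
    (h : extDeriv α x = 0) (u v : V) :
    fderiv ℝ (fun z => covector (α z)) x u v = fderiv ℝ (fun z => covector (α z)) x v u := by
  have hd : ∀ w w' : V, fderiv ℝ (fun z => covector (α z)) x w w'
      = fderiv ℝ (fun z => α z fun _ => w') x w := by
    intro w w'
    have h1 : DifferentiableAt ℝ (fun z => covector (α z)) x :=
      (contDiff_covector.differentiable one_ne_zero _).comp x hα
    have h2 := h1.hasFDerivAt.clm_apply (hasFDerivAt_const w' x)
    have h3 := h2.fderiv
    simp only [covector_apply] at h3
    rw [h3]
    simp
  have h1 := extDeriv_apply hα ![u, v]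
  rw [h, Fin.sum_univ_two] at h1
  have e0 : Fin.removeNth 0 ![u, v] = fun _ => v := by ext i; fin_cases i; rfl
  have e1 : Fin.removeNth 1 ![u, v] = fun _ => u := by ext i; fin_cases i; rfl
  simp only [e0, e1] at h1
  rw [hd, hd]
  simp at h1
  linarith

end OneForms

/-! ### The degenerate field on the two-sided collar and its charts. -/

section CenterField

variable {V : Type*} [NormedAddCommGroup V] [NormedSpace ℝ V]
  {N : Type*} [TopologicalSpace N] [ChartedSpace V N]

/-- The form `dt ∧ α + Θ` on `ℝ × V`. -/
def cylModel (α : DiffForm 𝓘(ℝ, V) N 1) (Θ : DiffForm 𝓘(ℝ, V) N 2) (x : N) :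
    (ℝ × V) [⋀^Fin 2]→L[ℝ] ℝ :=
  cylForm (.fst ℝ ℝ V) (.snd ℝ ℝ V) (covector (α.model x)) (Θ.model x)

/-- The field on the two-sided collar: the inverse of `dt ∧ α + Θ`, pushed forward by a shear that
degenerates along `t = 0` and is the identity or a reflection for `ρ x < |t|`. -/
def centerField (ρ : N → ℝ) (α : DiffForm 𝓘(ℝ, V) N 1) (Θ : DiffForm 𝓘(ℝ, V) N 2) (p : ℝ × N) :
    ((ℝ × V) →L[ℝ] ℝ) →L[ℝ] ℝ × V :=
  pushSharp (shear (.fst ℝ ℝ V) (.snd ℝ ℝ V) (1, 0) (logProfileG (p.1, ρ p.2))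
    (logProfileB (p.1, ρ p.2) • modelDeriv 𝓘(ℝ, V) 𝓘(ℝ, ℝ) ρ p.2)) (sharpForm (cylModel α Θ p.2))

theorem extChartAt_prod_symm_apply (x₀ : N) (z : ℝ × V) :
    (extChartAt (𝓘(ℝ, ℝ).prod 𝓘(ℝ, V)) ((0 : ℝ), x₀)).symm z
      = (z.1, (extChartAt 𝓘(ℝ, V) x₀).symm z.2) := rfl

theorem HasMFDerivAt.prodMk_model {E F F' : Type*} [NormedAddCommGroup E] [NormedSpace ℝ E]
    [NormedAddCommGroup F] [NormedSpace ℝ F] [NormedAddCommGroup F'] [NormedSpace ℝ F']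
    {H M : Type*} [TopologicalSpace H] {I : ModelWithCorners ℝ E H} [TopologicalSpace M]
    [ChartedSpace H M] {f : M → F} {g : M → F'} {m : M} {D : E →L[ℝ] F} {D' : E →L[ℝ] F'}
    (hf : HasMFDerivAt I 𝓘(ℝ, F) f m D) (hg : HasMFDerivAt I 𝓘(ℝ, F') g m D') :
    HasMFDerivAt I 𝓘(ℝ, F × F') (fun m => (f m, g m)) m (D.prod D') :=
  ⟨hf.1.prodMk hg.1, hf.2.prodMk hg.2⟩

theorem hasMFDerivAt_extChartAt_prod {x₀ x : N} {t : ℝ} {T : V →L[ℝ] V}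
    (hT : HasMFDerivAt 𝓘(ℝ, V) 𝓘(ℝ, V) (extChartAt 𝓘(ℝ, V) x₀) x T) :
    HasMFDerivAt (𝓘(ℝ, ℝ).prod 𝓘(ℝ, V)) 𝓘(ℝ, ℝ × V)
      (extChartAt (𝓘(ℝ, ℝ).prod 𝓘(ℝ, V)) ((0 : ℝ), x₀)) (t, x)
      ((ContinuousLinearMap.fst ℝ ℝ V).prod (T ∘L .snd ℝ ℝ V)) :=
  HasMFDerivAt.prodMk_model (hasMFDerivAt_fst (I := 𝓘(ℝ, ℝ)) (I' := 𝓘(ℝ, V)) (t, x))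
    (HasMFDerivAt.comp_model (g := extChartAt 𝓘(ℝ, V) x₀) (f := Prod.snd) hT
      (hasMFDerivAt_snd (I := 𝓘(ℝ, ℝ)) (I' := 𝓘(ℝ, V)) (t, x)))

section

variable {E : Type*} [NormedAddCommGroup E] [NormedSpace ℝ E] [IsManifold 𝓘(ℝ, V) ∞ N]
  {ρ : N → ℝ} {α : DiffForm 𝓘(ℝ, V) N 1} {Θ : DiffForm 𝓘(ℝ, V) N 2}
  (J : (ℝ × V) ≃L[ℝ] E)

theorem formNondeg_cylForm_inChart (hnd : ∀ x, FormNondeg (cylModel α Θ x)) {x₀ : N} {y : E}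
    (hy : (J.symm y).2 ∈ (extChartAt 𝓘(ℝ, V) x₀).target) :
    FormNondeg (cylForm (.fst ℝ ℝ V ∘L (J.symm : E →L[ℝ] ℝ × V))
      (.snd ℝ ℝ V ∘L (J.symm : E →L[ℝ] ℝ × V)) (covector (α.inChart x₀ (J.symm y).2))
      (Θ.inChart x₀ (J.symm y).2)) := by
  obtain ⟨T, hT, hT'⟩ := exists_equiv_chart (I := 𝓘(ℝ, V)) (m := x₀) (y := (J.symm y).2)
    (by simp) hy
  let S : E ≃L[ℝ] ℝ × V := J.symm.trans ((ContinuousLinearEquiv.refl ℝ ℝ).prodCongr T)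
  have h := (hnd ((extChartAt 𝓘(ℝ, V) x₀).symm (J.symm y).2)).comp_equiv S
  rw [cylModel, cylForm_comp_eq (p' := .fst ℝ ℝ V ∘L (J.symm : E →L[ℝ] ℝ × V))
    (q' := .snd ℝ ℝ V ∘L (J.symm : E →L[ℝ] ℝ × V)) (R := (T : V →L[ℝ] V)) (S := S)
    (fun _ => rfl) (fun _ => rfl)] at h
  rw [inChart_eq_of_hasMFDerivAt α (by simp) hy hT, inChart_eq_of_hasMFDerivAt Θ (by simp) hy hT]
  exact h

variable [FiniteDimensional ℝ E] [FiniteDimensional ℝ V]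

/-- The chart of the collar is the identity on τ and a chart of N on the other factor, so its
derivative respects the shear direction. The transport lemma then replaces α, Θ and dρ by their
expressions in the chart of N. -/
theorem pushSharp_centerField (hnd : ∀ x, FormNondeg (cylModel α Θ x))
    (hρ : ContMDiff 𝓘(ℝ, V) 𝓘(ℝ, ℝ) ∞ ρ) {x₀ : N} {y : E}
    (hy : (J.symm y).2 ∈ (extChartAt 𝓘(ℝ, V) x₀).target) :
    pushSharp ((J : (ℝ × V) →L[ℝ] E) ∘L modelDeriv (𝓘(ℝ, ℝ).prod 𝓘(ℝ, V)) 𝓘(ℝ, ℝ × V)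
        (extChartAt (𝓘(ℝ, ℝ).prod 𝓘(ℝ, V)) ((0 : ℝ), x₀))
        ((extChartAt (𝓘(ℝ, ℝ).prod 𝓘(ℝ, V)) ((0 : ℝ), x₀)).symm (J.symm y)))
      (centerField ρ α Θ ((extChartAt (𝓘(ℝ, ℝ).prod 𝓘(ℝ, V)) ((0 : ℝ), x₀)).symm (J.symm y)))
    = pushSharp (shear (.fst ℝ ℝ V ∘L (J.symm : E →L[ℝ] ℝ × V))
        (.snd ℝ ℝ V ∘L (J.symm : E →L[ℝ] ℝ × V)) (J (1, 0))
        (logProfileG ((J.symm y).1, (ρ ∘ (extChartAt 𝓘(ℝ, V) x₀).symm) (J.symm y).2))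
        (logProfileB ((J.symm y).1, (ρ ∘ (extChartAt 𝓘(ℝ, V) x₀).symm) (J.symm y).2)
          • fderiv ℝ (ρ ∘ (extChartAt 𝓘(ℝ, V) x₀).symm) (J.symm y).2))
      (sharpForm (cylForm (.fst ℝ ℝ V ∘L (J.symm : E →L[ℝ] ℝ × V))
        (.snd ℝ ℝ V ∘L (J.symm : E →L[ℝ] ℝ × V)) (covector (α.inChart x₀ (J.symm y).2))
        (Θ.inChart x₀ (J.symm y).2))) := by
  obtain ⟨T, hT, hT'⟩ := exists_equiv_chart (I := 𝓘(ℝ, V)) (m := x₀) (y := (J.symm y).2)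
    (by simp) hy
  have hnd' := formNondeg_cylForm_inChart J hnd hy
  let S : (ℝ × V) ≃L[ℝ] E := ((ContinuousLinearEquiv.refl ℝ ℝ).prodCongr T.symm).trans J
  have hS : (J : (ℝ × V) →L[ℝ] E) ∘L ((ContinuousLinearMap.fst ℝ ℝ V).prod
      ((T.symm : V →L[ℝ] V) ∘L .snd ℝ ℝ V)) = (S : (ℝ × V) →L[ℝ] E) := rfl
  obtain ⟨D, hD, hD'⟩ := ((hρ ((extChartAt 𝓘(ℝ, V) x₀).symm (J.symm y).2)).mdifferentiableAt
    (by simp)).exists_model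
  have hd : modelDeriv 𝓘(ℝ, V) 𝓘(ℝ, ℝ) ρ ((extChartAt 𝓘(ℝ, V) x₀).symm (J.symm y).2)
      = fderiv ℝ (ρ ∘ (extChartAt 𝓘(ℝ, V) x₀).symm) (J.symm y).2 ∘L (T.symm : V →L[ℝ] V) := by
    have h1 : HasFDerivAt (ρ ∘ (extChartAt 𝓘(ℝ, V) x₀).symm) (D ∘L (T : V →L[ℝ] V))
        (J.symm y).2 := hasMFDerivAt_iff_hasFDerivAt.1 (HasMFDerivAt.comp_model (g := ρ)
      (f := (extChartAt 𝓘(ℝ, V) x₀).symm) hD hT)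
    rw [hD', h1.fderiv]
    ext v
    simp
  have hα : covector (α.model ((extChartAt 𝓘(ℝ, V) x₀).symm (J.symm y).2))
      = covector (α.inChart x₀ (J.symm y).2) ∘L (T.symm : V →L[ℝ] V) := by
    rw [inChart_eq_of_hasMFDerivAt α (by simp) hy hT]
    ext v
    simp [covector_apply, comp_def]
  have hΘ : Θ.model ((extChartAt 𝓘(ℝ, V) x₀).symm (J.symm y).2)
      = (Θ.inChart x₀ (J.symm y).2).compContinuousLinearMap (T.symm : V →L[ℝ] V) := by
    rw [inChart_eq_of_hasMFDerivAt Θ (by simp) hy hT]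
    ext v
    simp [comp_def]
  rw [← pushSharp_shear_cylForm (p' := .fst ℝ ℝ V) (q' := .snd ℝ ℝ V) (e₀' := (1, 0)) (S := S)
    (R := (T.symm : V →L[ℝ] V)) (fun w => by simp [S]) (fun w => by simp [S])
    (by simp [S]) _ _ _ _ hnd', ← hα, ← hΘ, ContinuousLinearMap.smul_comp, ← hd, ← hS]
  rw [extChartAt_prod_symm_apply, (hasMFDerivAt_extChartAt_prod hT').modelDeriv_eq]
  rfl

theorem isLocalBSymplectic_centerChart {n : ℕ} (hn : Module.finrank ℝ E = 2 * n)
    (hα : α.IsSmooth) (hαc : α.IsClosed) (hΘ : Θ.IsSmooth) (hΘc : Θ.IsClosed)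
    (hnd : ∀ x, FormNondeg (cylModel α Θ x))
    (hρ : ContMDiff 𝓘(ℝ, V) 𝓘(ℝ, ℝ) ∞ ρ) (hρ0 : ∀ x, 0 < ρ x) {x₀ : N} {s : Set E}
    (hs : IsOpen s) (hst : ∀ y ∈ s, (J.symm y).2 ∈ (extChartAt 𝓘(ℝ, V) x₀).target) :
    IsLocalBSymplectic n (fun y => pushSharp (shear (.fst ℝ ℝ V ∘L (J.symm : E →L[ℝ] ℝ × V))
        (.snd ℝ ℝ V ∘L (J.symm : E →L[ℝ] ℝ × V)) (J (1, 0))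
        (logProfileG ((J.symm y).1, (ρ ∘ (extChartAt 𝓘(ℝ, V) x₀).symm) (J.symm y).2))
        (logProfileB ((J.symm y).1, (ρ ∘ (extChartAt 𝓘(ℝ, V) x₀).symm) (J.symm y).2)
          • fderiv ℝ (ρ ∘ (extChartAt 𝓘(ℝ, V) x₀).symm) (J.symm y).2))
      (sharpForm (cylForm (.fst ℝ ℝ V ∘L (J.symm : E →L[ℝ] ℝ × V))
        (.snd ℝ ℝ V ∘L (J.symm : E →L[ℝ] ℝ × V)) (covector (α.inChart x₀ (J.symm y).2))
        (Θ.inChart x₀ (J.symm y).2)))) s := by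
  have ht : IsOpen (extChartAt 𝓘(ℝ, V) x₀).target := isOpen_extChartAt_target x₀
  have hclosed : ∀ {k : ℕ} {η : DiffForm 𝓘(ℝ, V) N k}, η.IsClosed →
      ∀ x ∈ (extChartAt 𝓘(ℝ, V) x₀).target, extDeriv (η.inChart x₀) x = 0 := by
    intro k η hη x hx
    rw [← hη x₀ x hx, extDeriv, extDerivWithin, fderivWithin_of_isOpen ht hx]
  refine isLocalBSymplectic_logProfile (p := .fst ℝ ℝ V ∘L (J.symm : E →L[ℝ] ℝ × V))
    (q := .snd ℝ ℝ V ∘L (J.symm : E →L[ℝ] ℝ × V)) hn (by simp) (by simp) hs ht hst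
    (a := fun v => covector (α.inChart x₀ v)) (contDiff_covector.comp_contDiffOn (hα x₀))
    (fun x hx u v => fderiv_covector_symm
      (((hα x₀).contDiffAt (ht.mem_nhds hx)).differentiableAt (by simp)) (hclosed hαc x hx) u v)
    (hΘ x₀) (hclosed hΘc) (fun y hy => formNondeg_cylForm_inChart J hnd (hst y hy))
    ((hρ.comp_contMDiffOn (contMDiffOn_extChartAt_symm x₀)).contDiffOn) fun x _ => hρ0 _

end

end CenterField

/-! ### Matching the collar field with the given symplectic forms. -/

section CollarForm

variable {E : Type*} [NormedAddCommGroup E] [NormedSpace ℝ E]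
  {H : Type*} [TopologicalSpace H] {I : ModelWithCorners ℝ E H}
  {V : Type*} [NormedAddCommGroup V] [NormedSpace ℝ V]
  {N M X : Type*} [TopologicalSpace N] [TopologicalSpace M] [TopologicalSpace X]
  [ChartedSpace V N] [ChartedSpace H M]
  {c : PartialEquiv (ℝ × N) M} {α : DiffForm 𝓘(ℝ, V) N 1} {Θ : DiffForm 𝓘(ℝ, V) N 2}
  {Ω : DiffForm I M 2}

/-- Away from the boundary, the collar `c` pulls `Ω` back to `dt ∧ α + Θ`. -/
def IsCollarForm (Ω : DiffForm I M 2) (c : PartialEquiv (ℝ × N) M) (α : DiffForm 𝓘(ℝ, V) N 1)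
    (Θ : DiffForm 𝓘(ℝ, V) N 2) : Prop :=
  ∀ p ∈ c.source, 0 < p.1 → ∀ T : (ℝ × V) →L[ℝ] E,
    HasMFDerivAt (𝓘(ℝ, ℝ).prod 𝓘(ℝ, V)) I c p T →
      (Ω.model (c p)).compContinuousLinearMap T = cylModel α Θ p.2

theorem IsSmoothCollar.source_mem_nhds (hc : IsSmoothCollar I V c) {p : ℝ × N} (hp : p ∈ c.source)
    (h0 : 0 < p.1) : c.source ∈ nhds p := by
  rw [hc.source_eq] at hp ⊢
  refine Filter.mem_of_superset ((isOpen_Ioo.prod isOpen_univ).mem_nhds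
    (show p ∈ Ioo (0 : ℝ) 2 ×ˢ univ from ⟨⟨h0, hp.1.2⟩, trivial⟩)) ?_
  exact prod_mono Ioo_subset_Ico_self le_rfl

theorem IsSmoothCollar.exists_equiv (hc : IsSmoothCollar I V c) {p : ℝ × N} (hp : p ∈ c.source)
    (h0 : 0 < p.1) : ∃ T : (ℝ × V) ≃L[ℝ] E,
      HasMFDerivAt (𝓘(ℝ, ℝ).prod 𝓘(ℝ, V)) I c p (T : (ℝ × V) →L[ℝ] E) ∧
      HasMFDerivAt I (𝓘(ℝ, ℝ).prod 𝓘(ℝ, V)) c.symm (c p) (T.symm : E →L[ℝ] ℝ × V) := by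
  have hs := hc.source_mem_nhds hp h0
  have ht := hc.isOpen_target.mem_nhds (c.map_source hp)
  refine exists_equiv_hasMFDerivAt rfl
    (((hc.contMDiffOn_toFun _ hp).contMDiffAt hs).mdifferentiableAt (by simp))
    (((hc.contMDiffOn_symm _ (c.map_source hp)).contMDiffAt ht).mdifferentiableAt (by simp)) ?_ ?_
  · filter_upwards [hs] with x hx
    exact c.left_inv hx
  · filter_upwards [ht] with x hx
    exact c.right_inv hx

/-- The form dt ∧ α + Θ does not involve t, so nondegeneracy at t = 1, inherited from Ω through the
collar, gives it for every t, the seam included. -/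
theorem formNondeg_cylModel (hc : IsSmoothCollar I V c) (hΩ : Ω.IsSymplectic)
    (hω : IsCollarForm Ω c α Θ) (x : N) : FormNondeg (cylModel α Θ x) := by
  have hp : ((1 : ℝ), x) ∈ c.source := hc.mem_source.2 ⟨zero_le_one, one_lt_two⟩
  obtain ⟨T, hT, -⟩ := hc.exists_equiv hp one_pos
  have h := hω _ hp one_pos T hT
  rw [← h]
  exact FormNondeg.comp_equiv (V := ℝ × V) (V' := E) (σ' := Ω.model _) (hΩ.nondegenerate _) T

/-- Writing diag(ε, 1) as the shear with G = ε and μ = 0 lets it match the value of the degenerate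
field outside the thin collar. -/
theorem hasMFDerivAt_scaleFst (ε : ℝ) (p : ℝ × N) :
    HasMFDerivAt (𝓘(ℝ, ℝ).prod 𝓘(ℝ, V)) (𝓘(ℝ, ℝ).prod 𝓘(ℝ, V)) (scaleFst ε) p
      (shear (.fst ℝ ℝ V) (.snd ℝ ℝ V) (1, 0) ε 0) := by
  have h1 : HasMFDerivAt 𝓘(ℝ, ℝ) 𝓘(ℝ, ℝ) (fun t : ℝ => ε * t) p.1
      (ε • ContinuousLinearMap.id ℝ ℝ) :=
    ((hasFDerivAt_id (𝕜 := ℝ) p.1).const_mul ε).hasMFDerivAt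
  have h2 := HasMFDerivAt.comp_model (g := fun t : ℝ => ε * t) h1
    (hasMFDerivAt_fst (I := 𝓘(ℝ, ℝ)) (I' := 𝓘(ℝ, V)) p)
  have h3 := h2.prodMk (hasMFDerivAt_snd (I := 𝓘(ℝ, ℝ)) (I' := 𝓘(ℝ, V)) p)
  have h4 : shear (.fst ℝ ℝ V) (.snd ℝ ℝ V) (1, 0) ε 0
      = ((ε • ContinuousLinearMap.id ℝ ℝ) ∘L .fst ℝ ℝ V).prod (.snd ℝ ℝ V) := by
    ext <;> simp [shear_apply]
  rw [h4]
  exact h3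

variable [FiniteDimensional ℝ E] [FiniteDimensional ℝ V] {ρ : N → ℝ} {ε : ℝ}
  {eC : OpenPartialHomeomorph (ℝ × N) X} {e : OpenPartialHomeomorph M X}

/-- Beyond the width the profile is |τ|, hence G = τ/|τ| = ε and B = 0: the field is the inverse of
dt ∧ α + Θ, reflected on the left side. -/
theorem centerField_scaleFst (hρ : ∀ x, 0 < ρ x) (hε : ε * ε = 1) {p : ℝ × N} (hp : ρ p.2 < p.1) :
    centerField ρ α Θ (scaleFst ε p)
      = pushSharp (shear (.fst ℝ ℝ V) (.snd ℝ ℝ V) (1, 0) ε 0) (sharpForm (cylModel α Θ p.2)) := by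
  have h0 : 0 < p.1 := (hρ _).trans hp
  have hε' : |ε| = 1 := by
    rcases mul_self_eq_one_iff.1 hε with rfl | rfl <;> simp
  have habs : |ε * p.1| = p.1 := by rw [abs_mul, hε', one_mul, abs_of_pos h0]
  have hlt : ((ε * p.1, ρ p.2) : ℝ × ℝ).2 < |((ε * p.1, ρ p.2) : ℝ × ℝ).1| := by
    simpa only [habs] using hp
  unfold centerField scaleFst
  simp only
  rw [logProfileG_of_lt (hρ _) hlt, logProfileB_of_lt (hρ _) hlt, zero_smul]
  simp only [habs]
  rw [mul_div_cancel_right₀ _ h0.ne']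

/-- On the overlap of a side and the two-sided collar, the two fields agree. -/
theorem IsSideOf.exists_centerField_eq (S : IsSideOf eC e c ε)
    (hs : eC.source = Ioo (-2 : ℝ) 2 ×ˢ univ) (hc : IsSmoothCollar I V c) (hΩ : Ω.IsSymplectic)
    (hω : IsCollarForm Ω c α Θ) (hρ : ∀ x, 0 < ρ x) {m : M} (hm : m ∈ e.source ∩ e ⁻¹' eC.target)
    (hmρ : m ∉ thinCollar c ρ) : ∃ T : E →L[ℝ] ℝ × V,
      HasMFDerivAt I (𝓘(ℝ, ℝ).prod 𝓘(ℝ, V)) (eC.symm ∘ e) m T ∧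
      centerField ρ α Θ ((eC.symm ∘ e) m) = pushSharp T (sharpForm (Ω.model m)) := by
  obtain ⟨hmt, hg⟩ := S.center_symm_eq hs hm
  have hlt : ρ (c.symm m).2 < (c.symm m).1 := by
    by_contra h
    exact hmρ ⟨hmt, not_lt.1 h⟩
  have hp := c.map_target hmt
  obtain ⟨T, hT, hT'⟩ := hc.exists_equiv hp ((hρ _).trans hlt)
  have hω' := hω _ hp ((hρ _).trans hlt) T hT
  rw [c.right_inv hmt] at hT' hω'
  refine ⟨shear (.fst ℝ ℝ V) (.snd ℝ ℝ V) (1, 0) ε 0 ∘L (T.symm : E →L[ℝ] ℝ × V), ?_, ?_⟩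
  · refine (HasMFDerivAt.comp_model (g := scaleFst ε) (f := c.symm)
      (hasMFDerivAt_scaleFst ε _) hT').congr_of_eventuallyEq ?_
    filter_upwards [(e.isOpen_inter_preimage eC.open_target).mem_nhds hm] with z hz
    exact (S.center_symm_eq hs hz).2
  -- Both sides equal the ε-reflection of the inverse of dt ∧ α + Θ: the left by the formula beyond
  -- the width, the right because the collar pulls Ω back to that form.
  · have hnd : FormNondeg (Ω.model m) := hΩ.nondegenerate m
    rw [hg, centerField_scaleFst hρ S.mul_self hlt, ← pushSharp_pushSharp,
      ← pushSharp_sharpForm hnd T, hω', pushSharp_pushSharp (T.symm : E →L[ℝ] ℝ × V),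
      ContinuousLinearEquiv.coe_symm_comp_coe]
    rfl

end CollarForm

/-! ### Specialisation to half-space charts and the collars of the statement. -/

section Euclidean

variable {n : ℕ} [NeZero n] {N : Type*} [TopologicalSpace N]
  [ChartedSpace (EuclideanSpace ℝ (Fin (2 * n - 1))) N]
  {W : Type*} [TopologicalSpace W] [ChartedSpace (EuclideanHalfSpace (2 * n)) W]
  {c : PartialEquiv (ℝ × N) W}

theorem model_cylindricalForm {k : ℕ} {N : Type*} [TopologicalSpace N]
    [ChartedSpace (EuclideanSpace ℝ (Fin k)) N] (α : DiffForm (𝓡 k) N 1) (Θ : DiffForm (𝓡 k) N 2)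
    (p : ℝ × N) : (cylindricalForm α Θ).model p = cylModel α Θ p.2 := by
  unfold DiffForm.model cylindricalForm DiffForm.pullback cylModel cylForm
  rw [mfderivWithin_univ, mfderiv_fst, mfderiv_snd]
  rfl

theorem IsCollar.isSmoothCollar [IsManifold (𝓡∂ (2 * n)) ∞ W] (hc : IsCollar n c) :
    IsSmoothCollar (𝓡∂ (2 * n)) (EuclideanSpace ℝ (Fin (2 * n - 1))) c where
  source_eq := hc.source_eq
  isOpen_target := hc.isOpen_target
  continuousOn := hc.contMDiffOn_toFun.continuousOn
  continuousOn_symm := hc.contMDiffOn_symm.continuousOn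
  isClosed_range := by
    rw [hc.image_zero]
    exact (𝓡∂ (2 * n)).isClosed_boundary (n := ∞) (by simp)
  contMDiffOn_toFun := hc.contMDiffOn_toFun
  contMDiffOn_symm := hc.contMDiffOn_symm
  range_eq := hc.image_zero

theorem IsCollar.isCollarForm [IsManifold (𝓡∂ (2 * n)) ∞ W] (hc : IsCollar n c)
    {Ω : DiffForm (𝓡∂ (2 * n)) W 2}
    {α : DiffForm (𝓡 (2 * n - 1)) N 1} {Θ : DiffForm (𝓡 (2 * n - 1)) N 2}
    (h : ∀ p ∈ c.source, DiffForm.pullback (I := 𝓘(ℝ, ℝ).prod (𝓡 (2 * n - 1))) Ω c c.source p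
      = cylindricalForm α Θ p) : IsCollarForm Ω c α Θ := by
  intro p hp h0 T hT
  have h1 : mfderivWithin (𝓘(ℝ, ℝ).prod (𝓡 (2 * n - 1))) (𝓡∂ (2 * n)) c c.source p = T := by
    rw [mfderivWithin_of_mem_nhds (hc.isSmoothCollar.source_mem_nhds hp h0), hT.mfderiv]
  have h2 := h p hp
  unfold DiffForm.pullback at h2
  rw [h1] at h2
  rw [← model_cylindricalForm]
  exact h2

end Euclidean

/-! ### Where the top power vanishes. -/

section Degeneracy

variable {E : Type*} [NormedAddCommGroup E] [NormedSpace ℝ E] [FiniteDimensional ℝ E]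
  {E' : Type*} [NormedAddCommGroup E'] [NormedSpace ℝ E'] [FiniteDimensional ℝ E']

theorem bivectorPow_pushSharp_eq_zero (T : E →L[ℝ] E') {A : (E →L[ℝ] ℝ) →L[ℝ] E} {n : ℕ}
    (h : bivectorPow (bivector A) n = 0) : bivectorPow (bivector (pushSharp T A)) n = 0 := by
  rw [← map_bivector, ← map_bivectorPow, h, map_zero]

theorem bivectorPow_pushSharp_eq_zero_iff (T : E ≃L[ℝ] E') (A : (E →L[ℝ] ℝ) →L[ℝ] E) (n : ℕ) :
    bivectorPow (bivector (pushSharp (T : E →L[ℝ] E') A)) n = 0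
      ↔ bivectorPow (bivector A) n = 0 := by
  refine ⟨fun h => ?_, bivectorPow_pushSharp_eq_zero _⟩
  have h1 := bivectorPow_pushSharp_eq_zero (T.symm : E' →L[ℝ] E) h
  have h2 : pushSharp (T.symm : E' →L[ℝ] E) (pushSharp (T : E →L[ℝ] E') A) = A := by
    rw [pushSharp_pushSharp, ContinuousLinearEquiv.coe_symm_comp_coe]
    rfl
  rwa [h2] at h1

theorem mem_singularLocus_iff {X : Type*} [TopologicalSpace X] [ChartedSpace E X] {n : ℕ}
    {P : MultivectorField 𝓘(ℝ, E) X 2} {w : X} {Q : ⋀[ℝ]^2 E} (h : P w = Q) :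
    w ∈ P.singularLocus n ↔ bivectorPow Q n = 0 := by
  subst h
  rfl

variable {V : Type*} [NormedAddCommGroup V] [NormedSpace ℝ V] [FiniteDimensional ℝ V]
  {N : Type*} [TopologicalSpace N] [ChartedSpace V N]

/-- The top power is the determinant G of the shear times a nonvanishing power, and G = τ/E with E
positive. -/
theorem bivectorPow_centerField_eq_zero_iff {n : ℕ} (hn : Module.finrank ℝ (ℝ × V) = 2 * n)
    {ρ : N → ℝ} {α : DiffForm 𝓘(ℝ, V) N 1} {Θ : DiffForm 𝓘(ℝ, V) N 2}
    (hnd : ∀ x, FormNondeg (cylModel α Θ x)) (hρ : ∀ x, 0 < ρ x) (p : ℝ × N) :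
    bivectorPow (bivector (centerField ρ α Θ p)) n = 0 ↔ p.1 = 0 := by
  rw [centerField, ← map_bivector, ← map_bivectorPow, map_top_eq_det_smul hn,
    det_shear (by simp) (by simp), smul_eq_zero,
    or_iff_left (bivectorPow_ne_zero (hnd _).isSkewSharp (hnd _).surjective_sharpForm hn),
    logProfileG_eq_zero_iff (hρ _)]

variable {H : Type*} [TopologicalSpace H] {I : ModelWithCorners ℝ E H}
  {M X : Type*} [TopologicalSpace M] [ChartedSpace H M] [TopologicalSpace X] [ChartedSpace E' X]

theorem bivectorPow_pushField_eq_zero_iff {e : OpenPartialHomeomorph M X}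
    (he : ContMDiffOn I 𝓘(ℝ, E') ∞ e e.source) (he' : ContMDiffOn 𝓘(ℝ, E') I ∞ e.symm e.target)
    (A : M → (E →L[ℝ] ℝ) →L[ℝ] E) {w : X} (hw : w ∈ e.target) (n : ℕ) :
    bivectorPow (bivector (V := E') (pushField I e A w)) n = 0
      ↔ bivectorPow (bivector (A (e.symm w))) n = 0 := by
  have hm := e.map_target hw
  obtain ⟨T, hT, -⟩ := exists_equiv_hasMFDerivAt (p' := w) (e.right_inv hw)
    (((he _ hm).contMDiffAt (e.open_source.mem_nhds hm)).mdifferentiableAt (by simp))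
    (((he' _ hw).contMDiffAt (e.open_target.mem_nhds hw)).mdifferentiableAt (by simp))
    (by filter_upwards [e.open_source.mem_nhds hm] with x hx using e.left_inv hx)
    (by filter_upwards [e.open_target.mem_nhds hw] with x hx using e.right_inv hx)
  rw [pushField, hT.modelDeriv_eq, bivectorPow_pushSharp_eq_zero_iff]

theorem notMem_singularLocus_of_side {n : ℕ} (hn : Module.finrank ℝ E = 2 * n)
    {e : OpenPartialHomeomorph M X} (he : ContMDiffOn I 𝓘(ℝ, E') ∞ e e.source)
    (he' : ContMDiffOn 𝓘(ℝ, E') I ∞ e.symm e.target) {Ω : DiffForm I M 2} (hΩ : Ω.IsSymplectic)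
    {P : MultivectorField 𝓘(ℝ, E') X 2} {w : X} (hw : w ∈ e.target)
    (hP : P w = (bivector (V := E') (pushField I e (fun m => sharpForm (Ω.model m)) w) :
      ⋀[ℝ]^2 E')) : w ∉ P.singularLocus n := by
  have h : FormNondeg (Ω.model (e.symm w)) := hΩ.nondegenerate _
  rw [mem_singularLocus_iff hP, bivectorPow_pushField_eq_zero_iff he he' _ hw]
  exact bivectorPow_ne_zero h.isSkewSharp h.surjective_sharpForm hn

theorem mem_singularLocus_iff_of_center {n : ℕ} (hn : Module.finrank ℝ (ℝ × V) = 2 * n)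
    {eC : OpenPartialHomeomorph (ℝ × N) X}
    (he : ContMDiffOn (𝓘(ℝ, ℝ).prod 𝓘(ℝ, V)) 𝓘(ℝ, E') ∞ eC eC.source)
    (he' : ContMDiffOn 𝓘(ℝ, E') (𝓘(ℝ, ℝ).prod 𝓘(ℝ, V)) ∞ eC.symm eC.target)
    {ρ : N → ℝ} {α : DiffForm 𝓘(ℝ, V) N 1} {Θ : DiffForm 𝓘(ℝ, V) N 2}
    (hnd : ∀ x, FormNondeg (cylModel α Θ x)) (hρ : ∀ x, 0 < ρ x)
    {P : MultivectorField 𝓘(ℝ, E') X 2} {w : X} (hw : w ∈ eC.target)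
    (hP : P w = (bivector (V := E') (pushField (𝓘(ℝ, ℝ).prod 𝓘(ℝ, V)) eC (centerField ρ α Θ) w) :
      ⋀[ℝ]^2 E')) : w ∈ P.singularLocus n ↔ (eC.symm w).1 = 0 := by
  rw [mem_singularLocus_iff hP, bivectorPow_pushField_eq_zero_iff he he' _ hw]
  exact bivectorPow_centerField_eq_zero_iff hn hnd hρ _

end Degeneracy

/-! ### Gluing the local fields into one bivector field. -/

section Assembly

variable {E : Type*} [NormedAddCommGroup E] [NormedSpace ℝ E] [FiniteDimensional ℝ E]
  {H : Type*} [TopologicalSpace H] {I : ModelWithCorners ℝ E H}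
  {V : Type*} [NormedAddCommGroup V] [NormedSpace ℝ V] [FiniteDimensional ℝ V]
  {N A B X : Type*} [TopologicalSpace N] [TopologicalSpace A] [TopologicalSpace B]
  [TopologicalSpace X] [ChartedSpace V N] [ChartedSpace H A] [ChartedSpace H B]

theorem IsSideOf.pushField_center_eq {M : Type*} [TopologicalSpace M] [ChartedSpace H M]
    [ChartedSpace E X] {c : PartialEquiv (ℝ × N) M} {ε : ℝ}
    {eC : OpenPartialHomeomorph (ℝ × N) X} {e : OpenPartialHomeomorph M X} {Ω : DiffForm I M 2}
    {α : DiffForm 𝓘(ℝ, V) N 1} {Θ : DiffForm 𝓘(ℝ, V) N 2} {ρ : N → ℝ} (S : IsSideOf eC e c ε)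
    (hs : eC.source = Ioo (-2 : ℝ) 2 ×ˢ univ) (hc : IsSmoothCollar I V c) (hΩ : Ω.IsSymplectic)
    (hω : IsCollarForm Ω c α Θ) (hρ : ∀ x, 0 < ρ x)
    (heC : ContMDiffOn (𝓘(ℝ, ℝ).prod 𝓘(ℝ, V)) 𝓘(ℝ, E) ∞ eC eC.source)
    (hthin : ∀ m ∈ e.source, m ∉ thinCollar c ρ) {w : X} (hw : w ∈ e.target)
    (hw' : w ∈ eC.target) :
    pushField (E₀ := E) (𝓘(ℝ, ℝ).prod 𝓘(ℝ, V)) eC (centerField ρ α Θ) w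
      = pushField I e (fun m => sharpForm (Ω.model m)) w := by
  have hm := e.map_target hw
  have hm' : e (e.symm w) ∈ eC.target := by rwa [e.right_inv hw]
  obtain ⟨T, hT, hA⟩ := S.exists_centerField_eq hs hc hΩ hω hρ ⟨hm, hm'⟩ (hthin _ hm)
  have h := pushField_eq_pushField (A := fun m => sharpForm (Ω.model m)) heC hm hm' hT hA
  rwa [e.right_inv hw] at h

/-- A field of values in the model space, as a multivector field. -/
theorem exists_multivectorField_eq [ChartedSpace E X] {k : ℕ} {ι : Type*} {s : ι → Set X}
    {Q' : ι → X → ⋀[ℝ]^k E} (Q : X → ⋀[ℝ]^k E) (h : ∀ i, ∀ w ∈ s i, Q w = Q' i w) :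
    ∃ P : MultivectorField 𝓘(ℝ, E) X k, ∀ i, ∀ w ∈ s i, P w = Q' i w :=
  ⟨Q, h⟩

namespace IsCollarGluing

variable {jA : A → X} {jB : B → X} {cA : PartialEquiv (ℝ × N) A} {cB : PartialEquiv (ℝ × N) B}

/-- The forms on the pieces of a gluing along collars. -/
structure IsFormData (_ : IsCollarGluing I V jA jB cA cB) (ΩA : DiffForm I A 2)
    (ΩB : DiffForm I B 2) (α : DiffForm 𝓘(ℝ, V) N 1) (Θ : DiffForm 𝓘(ℝ, V) N 2) : Prop where
  left : ΩA.IsSymplectic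
  right : ΩB.IsSymplectic
  smooth_one : α.IsSmooth
  closed_one : α.IsClosed
  smooth_two : Θ.IsSmooth
  closed_two : Θ.IsClosed
  collar_left : IsCollarForm ΩA cA α Θ
  collar_right : IsCollarForm ΩB cB α Θ

variable (G : IsCollarGluing I V jA jB cA cB) {ρ : N → ℝ} (hρ : G.IsWidth ρ)
  (ΩA : DiffForm I A 2) (ΩB : DiffForm I B 2) (α : DiffForm 𝓘(ℝ, V) N 1) (Θ : DiffForm 𝓘(ℝ, V) N 2)
  [IsManifold I ∞ A] [IsManifold I ∞ B] [IsManifold 𝓘(ℝ, V) ∞ N]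

/-- The parts of the glued space covered by the pieces. -/
def pieceTarget : A ⊕ B ⊕ N → Set X
  | .inl u => (G.leftPiece u (G.leftOpen hρ).1 (G.leftOpen hρ).2).target
  | .inr (.inl u) => (G.rightPiece u (G.rightOpen hρ).1 (G.rightOpen hρ).2).target
  | .inr (.inr x) => (G.centerPiece x).target

theorem exists_mem_pieceTarget (J : (ℝ × V) ≃L[ℝ] E) (z : X) : ∃ i, z ∈ G.pieceTarget hρ i := by
  obtain ⟨i, hi⟩ := G.exists_mem_chart hρ J z
  refine ⟨i, ?_⟩
  rcases i with u | u | x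
  · exact (mem_pieceChart_source.1 hi).1
  · exact (mem_pieceChart_source.1 hi).1
  · exact (mem_pieceChart_source.1 hi).1

variable [ChartedSpace E X]

/-- The fields on the pieces, pushed forward to the glued space. -/
def pieceField : A ⊕ B ⊕ N → X → (E →L[ℝ] ℝ) →L[ℝ] E
  | .inl u => pushField I (G.leftPiece u (G.leftOpen hρ).1 (G.leftOpen hρ).2)
      fun a => sharpForm (ΩA.model a)
  | .inr (.inl u) => pushField I (G.rightPiece u (G.rightOpen hρ).1 (G.rightOpen hρ).2)
      fun b => sharpForm (ΩB.model b)
  | .inr (.inr x) => pushField (𝓘(ℝ, ℝ).prod 𝓘(ℝ, V)) (G.centerPiece x) (centerField ρ α Θ)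

variable (J : (ℝ × V) ≃L[ℝ] E) {G ΩA ΩB α Θ} (F : G.IsFormData ΩA ΩB α Θ)
  (hat : ∀ k : G.ChartIndex, G.chart J k ∈ IsManifold.maximalAtlas 𝓘(ℝ, E) ∞ X)
include F hat

theorem pieceField_left_center {u : A} {x : N} {w : X} (hw : w ∈ G.pieceTarget hρ (.inl u))
    (hw' : w ∈ G.pieceTarget hρ (.inr (.inr x))) :
    G.pieceField hρ ΩA ΩB α Θ (.inr (.inr x)) w = G.pieceField hρ ΩA ΩB α Θ (.inl u) w :=
  IsSideOf.pushField_center_eq (c := cA) (ε := -1) (eC := G.centerPiece x)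
    (e := G.leftPiece u (G.leftOpen hρ).1 (G.leftOpen hρ).2) G.isSideOf_left rfl G.left F.left F.collar_left
    hρ.pos (G.contMDiffOn_centerPiece J hat) (fun _ hm => hm) hw hw'

theorem pieceField_right_center {u : B} {x : N} {w : X}
    (hw : w ∈ G.pieceTarget hρ (.inr (.inl u))) (hw' : w ∈ G.pieceTarget hρ (.inr (.inr x))) :
    G.pieceField hρ ΩA ΩB α Θ (.inr (.inr x)) w = G.pieceField hρ ΩA ΩB α Θ (.inr (.inl u)) w :=
  IsSideOf.pushField_center_eq (c := cB) (ε := 1) (eC := G.centerPiece x)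
    (e := G.rightPiece u (G.rightOpen hρ).1 (G.rightOpen hρ).2) G.isSideOf_right rfl G.right F.right
    F.collar_right hρ.pos (G.contMDiffOn_centerPiece J hat) (fun _ hm => hm) hw hw'

theorem pieceField_eq {i k : A ⊕ B ⊕ N} {w : X} (hi : w ∈ G.pieceTarget hρ i)
    (hk : w ∈ G.pieceTarget hρ k) :
    G.pieceField hρ ΩA ΩB α Θ i w = G.pieceField hρ ΩA ΩB α Θ k w := by
  rcases i with u | u | x <;> rcases k with u' | u' | x'
  · rfl
  · exact absurd hi (G.rightPiece_ne_leftPiece hk)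
  · exact (pieceField_left_center hρ J F hat hi hk).symm
  · exact absurd hk (G.rightPiece_ne_leftPiece hi)
  · rfl
  · exact (pieceField_right_center hρ J F hat hi hk).symm
  · exact pieceField_left_center hρ J F hat hk hi
  · exact pieceField_right_center hρ J F hat hk hi
  · rfl

/-- At each point the field of any piece containing it may be used, since the piece fields agree on
all overlaps by `pieceField_eq`. -/
theorem exists_bivectorField : ∃ P : MultivectorField 𝓘(ℝ, E) X 2, ∀ i, ∀ w ∈ G.pieceTarget hρ i,
    P w = (bivector (V := E) (G.pieceField hρ ΩA ΩB α Θ i w) : ⋀[ℝ]^2 E) := by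
  choose κ hκ using G.exists_mem_pieceTarget hρ J
  refine exists_multivectorField_eq (fun w => bivector (V := E) (G.pieceField hρ ΩA ΩB α Θ (κ w) w))
    fun i w hw => ?_
  rw [pieceField_eq hρ J F hat (hκ w) hw]

variable {P : MultivectorField 𝓘(ℝ, E) X 2} (hP : ∀ i, ∀ w ∈ G.pieceTarget hρ i,
    P w = (bivector (V := E) (G.pieceField hρ ΩA ΩB α Θ i w) : ⋀[ℝ]^2 E))
  {n : ℕ} (hn : Module.finrank ℝ E = 2 * n)
include hP hn

/-- On the sides the field inverts a nondegenerate form, and the side pieces avoid the seam. On the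
two-sided collar it degenerates exactly at τ = 0. Since invertible push-forward preserves vanishing
of the top power, the two descriptions combine. -/
theorem singularLocus_eq : P.singularLocus n = range fun x : N => twoSided jA jB cA cB (0, x) := by
  have hnd := formNondeg_cylModel G.left F.left F.collar_left
  have hn' : Module.finrank ℝ (ℝ × V) = 2 * n := J.toLinearEquiv.finrank_eq.trans hn
  have hA : ∀ x, twoSided jA jB cA cB (0, x) = jA (cA (0, x)) := fun x => by
    rw [G.gluing.twoSided_of_nonpos le_rfl]
    simp [reflectFst]
  have hB : ∀ x, twoSided jA jB cA cB (0, x) = jB (cB (0, x)) := fun x =>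
    G.gluing.twoSided_of_nonneg le_rfl
  ext w
  obtain ⟨i, hi⟩ := G.exists_mem_pieceTarget hρ J w
  rcases i with u | u | x
  · refine iff_of_false ?_ ?_
    · exact notMem_singularLocus_of_side hn (G.contMDiffOn_leftPiece J hat)
        (contMDiffOn_symm_of_pieceChart_mem _ (G.exists_chart_leftPiece J hat)) F.left hi
        (hP (.inl u) w hi)
    · rintro ⟨x, rfl⟩
      obtain ⟨a, ha, h⟩ := hi
      replace h : jA a = jA (cA (0, x)) := h.trans (hA x)
      have h1 := (G.leftOpen hρ).2 ha
      rw [G.gluing.left_injective h, ← I.compl_boundary, ← G.left.range_eq] at h1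
      exact h1 ⟨x, rfl⟩
  · refine iff_of_false ?_ ?_
    · exact notMem_singularLocus_of_side hn (G.contMDiffOn_rightPiece J hat)
        (contMDiffOn_symm_of_pieceChart_mem _ (G.exists_chart_rightPiece J hat)) F.right hi
        (hP (.inr (.inl u)) w hi)
    · rintro ⟨x, rfl⟩
      obtain ⟨b, hb, h⟩ := hi
      replace h : jB b = jB (cB (0, x)) := h.trans (hB x)
      have h1 := (G.rightOpen hρ).2 hb
      rw [G.gluing.right_injective h, ← I.compl_boundary, ← G.right.range_eq] at h1
      exact h1 ⟨x, rfl⟩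
  · rw [mem_singularLocus_iff_of_center hn' (G.contMDiffOn_centerPiece J hat)
      (contMDiffOn_symm_of_pieceChart_mem _ (G.exists_chart_centerPiece J hat)) hnd hρ.pos hi
      (hP (.inr (.inr x)) w hi)]
    obtain ⟨p, hp, rfl⟩ := hi
    have hps : (G.centerPiece x).symm (twoSided jA jB cA cB p) = p :=
      (G.centerPiece x).left_inv hp
    rw [hps]
    constructor
    · intro h0
      exact ⟨p.2, by simp only [← h0]⟩
    · rintro ⟨x', hx'⟩
      have h0 : ((0 : ℝ), x') ∈ Ioo (-2 : ℝ) 2 ×ˢ (univ : Set N) := by simp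
      rw [← G.gluing.injOn_twoSided G.left.toIsTopCollar G.right.toIsTopCollar h0 hp hx']

variable [IsManifold 𝓘(ℝ, E) ∞ X]
  (hchart : ∀ z : X, ∃ i, chartAt E z = G.chart J (G.preferredIndex hρ i))
include hchart

/-- Each preferred chart lies in one piece, where the field has a single formula: the inverse of a
symplectic form on the sides, the logarithmic model on the collar. -/
theorem isBSymplectic : P.IsBSymplectic n := by
  refine isBSymplectic_of_inChart fun x₀ => ?_
  obtain ⟨i, hi⟩ := hchart x₀
  have ht : (extChartAt 𝓘(ℝ, E) x₀).target = (G.chart J (G.preferredIndex hρ i)).target := by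
    rw [extChartAt_target, hi]
    simp
  rw [ht]
  have hopen := (G.chart J (G.preferredIndex hρ i)).open_target
  rcases i with u | u | x
  · refine ⟨_, isLocalBSymplectic_inChart hn F.left (m := u) hopen fun y hy => ?_, fun y hy => ?_⟩
    · have h := mem_pieceChart_target.1 hy
      exact ⟨h.1, h.2.1⟩
    · have h := mem_pieceChart_target.1 hy
      rw [inChart_eq_of_chartAt_eq (G.contMDiffOn_leftPiece J hat) hi (hP (.inl u)) hy,
        ContinuousLinearEquiv.coe_refl, ContinuousLinearMap.id_comp]
      exact congrArg bivector (pushSharp_mfderiv_sharpForm F.left h.1 h.2.1)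
  · refine ⟨_, isLocalBSymplectic_inChart hn F.right (m := u) hopen fun y hy => ?_, fun y hy => ?_⟩
    · have h := mem_pieceChart_target.1 hy
      exact ⟨h.1, h.2.1⟩
    · have h := mem_pieceChart_target.1 hy
      rw [inChart_eq_of_chartAt_eq (G.contMDiffOn_rightPiece J hat) hi (hP (.inr (.inl u))) hy,
        ContinuousLinearEquiv.coe_refl, ContinuousLinearMap.id_comp]
      exact congrArg bivector (pushSharp_mfderiv_sharpForm F.right h.1 h.2.1)
  · have hnd := formNondeg_cylModel G.left F.left F.collar_left
    have hmem : ∀ y ∈ (G.chart J (G.preferredIndex hρ (.inr (.inr x)))).target,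
        (J.symm y).2 ∈ (extChartAt 𝓘(ℝ, V) x).target := by
      intro y hy
      have h := (mem_pieceChart_target.1 hy).2.1
      rw [extChartAt_prod] at h
      exact h.2
    refine ⟨_, isLocalBSymplectic_centerChart J hn F.smooth_one F.closed_one F.smooth_two
      F.closed_two hnd hρ.contMDiff hρ.pos hopen hmem, fun y hy => ?_⟩
    rw [inChart_eq_of_chartAt_eq (G.contMDiffOn_centerPiece J hat) hi (hP (.inr (.inr x))) hy,
      pushSharp_centerField J hnd hρ.contMDiff (hmem y hy)]

end IsCollarGluing

end Assembly
end
-- The gluing theorem.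
theorem mainTheorem5 (n : ℕ) [NeZero n]
    {Wm : Type*} [TopologicalSpace Wm] [T2Space Wm] [SecondCountableTopology Wm]
    [ChartedSpace (EuclideanHalfSpace (2 * n)) Wm] [IsManifold (𝓡∂ (2 * n)) ∞ Wm]
    {Wp : Type*} [TopologicalSpace Wp] [T2Space Wp] [SecondCountableTopology Wp]
    [ChartedSpace (EuclideanHalfSpace (2 * n)) Wp] [IsManifold (𝓡∂ (2 * n)) ∞ Wp]
    {N : Type*} [TopologicalSpace N] [T2Space N] [SecondCountableTopology N]
    [ChartedSpace (EuclideanSpace ℝ (Fin (2 * n - 1))) N] [IsManifold (𝓡 (2 * n - 1)) ∞ N]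
    (Ωm : DiffForm (𝓡∂ (2 * n)) Wm 2) (hΩm : Ωm.IsSymplectic)
    (Ωp : DiffForm (𝓡∂ (2 * n)) Wp 2) (hΩp : Ωp.IsSymplectic)
    (αN : DiffForm (𝓡 (2 * n - 1)) N 1) (hα_smooth : αN.IsSmooth) (hα_closed : αN.IsClosed)
    (hα_nonsingular : ∀ x : N, αN x ≠ 0)
    (ΩN : DiffForm (𝓡 (2 * n - 1)) N 2) (hΩN_smooth : ΩN.IsSmooth) (hΩN_closed : ΩN.IsClosed)
    (cm : PartialEquiv (ℝ × N) Wm) (hcm : IsCollar n cm)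
    (cp : PartialEquiv (ℝ × N) Wp) (hcp : IsCollar n cp)
    (hcmΩ : ∀ p ∈ cm.source,
      DiffForm.pullback (I := 𝓘(ℝ, ℝ).prod (𝓡 (2 * n - 1))) Ωm cm cm.source p
        = cylindricalForm αN ΩN p)
    (hcpΩ : ∀ p ∈ cp.source,
      DiffForm.pullback (I := 𝓘(ℝ, ℝ).prod (𝓡 (2 * n - 1))) Ωp cp cp.source p
        = cylindricalForm αN ΩN p) :
    T2Space (GluedAlongCollars cm cp) ∧ SecondCountableTopology (GluedAlongCollars cm cp) ∧
    ∃ _ : ChartedSpace (EuclideanSpace ℝ (Fin (2 * n))) (GluedAlongCollars cm cp),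
      IsGluedSmoothStructure n cm cp ∧
      ∃ P : MultivectorField (𝓡 (2 * n)) (GluedAlongCollars cm cp) 2,
        P.IsBSymplectic n ∧
        P.singularLocus n = Glued.inl _ _ '' (𝓡∂ (2 * n)).boundary Wm ∧
        P.singularLocus n = Glued.inr _ _ '' (𝓡∂ (2 * n)).boundary Wp := by
  have hGL : IsSmoothCollar (𝓡∂ (2 * n)) (EuclideanSpace ℝ (Fin (2 * n - 1))) cm :=
    hcm.isSmoothCollar
  have hGR : IsSmoothCollar (𝓡∂ (2 * n)) (EuclideanSpace ℝ (Fin (2 * n - 1))) cp :=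
    hcp.isSmoothCollar
  have G : IsCollarGluing (𝓡∂ (2 * n)) (EuclideanSpace ℝ (Fin (2 * n - 1)))
      (Glued.inl (fun x => cm (0, x)) (fun x => cp (0, x)))
      (Glued.inr (fun x => cm (0, x)) (fun x => cp (0, x))) cm cp :=
    ⟨isGluing_glued hGL.injective_zero hGR.injective_zero, hGL, hGR⟩
  have F : G.IsFormData Ωm Ωp αN ΩN := ⟨hΩm, hΩp, hα_smooth, hα_closed, hΩN_smooth, hΩN_closed,
    hcm.isCollarForm hcmΩ, hcp.isCollarForm hcpΩ⟩
  have hrank : Module.finrank ℝ (EuclideanSpace ℝ (Fin (2 * n))) = 2 * n :=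
    finrank_euclideanSpace_fin
  -- The truncated subtraction gives 1 + (2n - 1) = 2n because n ≥ 1; any linear identification of
  -- the models will do.
  let J : (ℝ × EuclideanSpace ℝ (Fin (2 * n - 1))) ≃L[ℝ] EuclideanSpace ℝ (Fin (2 * n)) :=
    ContinuousLinearEquiv.ofFinrankEq (by
      have := NeZero.pos n
      rw [Module.finrank_prod, finrank_euclideanSpace_fin, finrank_euclideanSpace_fin,
        Module.finrank_self]
      omega)
  -- With second countability, local compactness supplies the normality of W± and the σ-compactness
  -- of N needed to choose a width.
  have : LocallyCompactSpace Wm := Manifold.locallyCompact_of_finiteDimensional (𝓡∂ (2 * n))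
  have : LocallyCompactSpace Wp := Manifold.locallyCompact_of_finiteDimensional (𝓡∂ (2 * n))
  have : LocallyCompactSpace N := Manifold.locallyCompact_of_finiteDimensional (𝓡 (2 * n - 1))
  obtain ⟨ρ, hρ⟩ := G.exists_isWidth
  refine ⟨G.gluing.t2Space hGL.toIsTopCollar hGR.toIsTopCollar,
    G.gluing.secondCountableTopology hGL.toIsTopCollar hGR.toIsTopCollar, ?_⟩
  obtain ⟨cs, hM, hat, hchart⟩ := G.exists_chartedSpace hρ J
  obtain ⟨P, hP⟩ := IsCollarGluing.exists_bivectorField hρ J F hat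
  have hsing := IsCollarGluing.singularLocus_eq hρ J F hat hP hrank
  refine ⟨cs, ⟨hM, G.isLocalDiffeomorphOn_left J hat, G.isLocalDiffeomorphOn_right J hat,
    G.isLocalDiffeomorphOn_twoSided J hat⟩, P,
    IsCollarGluing.isBSymplectic hρ J F hat hP hrank hchart, ?_, ?_⟩
  -- The seam may be read from either side, since both formulas for the two-sided collar hold at τ =
  -- 0.
  · rw [hsing, ← hcm.image_zero, ← range_comp]
    refine congrArg range (funext fun x => ?_)
    rw [G.gluing.twoSided_of_nonpos le_rfl]
    simp [reflectFst]
  · rw [hsing, ← hcp.image_zero, ← range_comp]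
    exact congrArg range (funext fun x => G.gluing.twoSided_of_nonneg le_rfl)
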